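/- **Corollary 3.7 (Liouville theorem, parabolic case).** Let $n\ge 2$ and $Q=\mathbb R^n\times\mathbb R_-$ with $\mathbb R_-=\,]-\infty,0[$; points of $Q$ are written $(x;t)$. Consider the equation $$\mathcal M u\equiv \partial_t u-D_i\big(a_{ij}(x;t)D_ju\big)+b_i(x;t)D_iu=0\qquad\text{in } Q ,$$ where repeated indices are summed from $1$ to $n$ and $D_i=\partial/\partial x_i$. Assume: 1. the coefficients $a_{ij}$ are measurable and essentially bounded on $Q$ (this is automatic from the next inequalities if the measurable matrix $(a_{ij})$ is symmetric), and for some constant $\nu>0$, for almost all $(x;t)\in Q$, $$\nu|\xi|^2\le a_{ij}(x;t)\,\xi_i\xi_j\le\nu^{-1}|\xi|^2\qquad\text{for all }\xi\in\mathbb R^n;$$ 2. $\operatorname{div}\mathbf b\le 0$ in $Q$ in the sense of distributions, where $\mathbf b=(b_i)$ and the divergence is taken in $x$; that is, $\int_Q b_iD_i\varphi\,dx\,dt\ge 0$ for every nonnegative $\varphi\in C_c^\infty(Q)$; 3. $\mathbf b\in L_{q,\ell,\mathrm{loc}}(Q)$ for some $q,\ell\in[1,\infty]$ with $$\alpha\equiv\frac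 nq+\frac 2\ell-1\in[0,1[\qquad\Big(\tfrac1\infty=0\Big),$$ where $\|f\|_{q,\ell,E}$ is the $L_\ell$ norm in $t$ of the $L_q$ norm in $x$ of $f$ extended by zero outside $E$; 4. with $\widehat{\mathcal N}(R,1,1)=R^{-\alpha}\,\|\mathbf b\|_{q,\ell,Q_R}$ and $Q_R=\{x\in\mathbb R^n:|x|<R\}\times\,]-R^2,0[$, one has $$\liminf_{R\to\infty}\widehat{\mathcal N}(R,1,1)<\infty .$$ Then every bounded, locally Lipschitz (in particular, every bounded Lipschitz) solution $u$ of $\mathcal M u=0$ in $Q$ is constant. Here a locally Lipschitz function $u$ on $Q$ is a solution if $$\int_Q\big(\partial_tu\,\eta+a_{ij}D_ju\,D_i\eta+b_iD_iu\,\eta\big)\,dx\,dt=0$$ for every Lipschitz function $\eta$ with compact support in $Q$. -/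

import Mathlib

open MeasureTheory Set Filter Topology
open scoped ENNReal

noncomputable section

namespace ParabolicLiouville

/-- Points `(x; t)` of `ℝⁿ × ℝ`, with the Euclidean structure on `ℝⁿ`. -/
abbrev SpaceTime (n : ℕ) : Type := EuclideanSpace ℝ (Fin n) × ℝ

/-- The half-space `ℝⁿ × ℝ₋ = ℝⁿ × ]-∞, 0[`. -/
def lowerHalfSpace (n : ℕ) : Set (SpaceTime n) := univ ×ˢ Iio (0 : ℝ)

/-- The cylinder `Q_R^{lam, θ}(x⁰; t⁰) = B_{lam R}(x⁰) × ]t⁰ - θ R², t⁰[`. -/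
def parCylinder {n : ℕ} (R lam θ : ℝ) (x₀ : EuclideanSpace ℝ (Fin n)) (t₀ : ℝ) :
    Set (SpaceTime n) :=
  Metric.ball x₀ (lam * R) ×ˢ Ioo (t₀ - θ * R ^ 2) t₀

/-- The anisotropic norm `‖f‖_{q,ℓ,Q}`: the `L_ℓ` norm in `t` of the `L_q` norm in `x` of the
restriction of `f` to `Q` (extended by zero). Its value is `∞` when the norm is not finite;
exponents `∞` give essential suprema. -/
def mixedNorm {n : ℕ} (q l : ℝ≥0∞) (Q : Set (SpaceTime n))
    (f : SpaceTime n → EuclideanSpace ℝ (Fin n)) : ℝ≥0∞ :=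
  eLpNorm (fun t : ℝ =>
    eLpNorm (fun x : EuclideanSpace ℝ (Fin n) => Q.indicator f (x, t)) q volume) l volume

/-- `f ∈ L_{q,ℓ,loc}(Q)` for an open set `Q`. -/
def MemMixedLoc {n : ℕ} (q l : ℝ≥0∞) (Q : Set (SpaceTime n))
    (f : SpaceTime n → EuclideanSpace ℝ (Fin n)) : Prop :=
  AEStronglyMeasurable f (volume.restrict Q) ∧
    ∀ K : Set (SpaceTime n), IsCompact K → K ⊆ Q → mixedNorm q l K f < ∞

/-- `α(q, ℓ) = n/q + 2/ℓ - 1`, with `1/∞ = 0`; used for `q, ℓ ≥ 1` only. -/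
def alphaExp (n : ℕ) (q l : ℝ≥0∞) : ℝ :=
  n * (q⁻¹).toReal + 2 * (l⁻¹).toReal - 1

/-- The scale invariant quantity `R^{-α} ‖b‖_{q,ℓ,Q_R^{lam, θ}(x⁰; t⁰)}`. -/
def scaledNorm {n : ℕ} (q l : ℝ≥0∞) (b : SpaceTime n → EuclideanSpace ℝ (Fin n))
    (R lam θ : ℝ) (x₀ : EuclideanSpace ℝ (Fin n)) (t₀ : ℝ) : ℝ≥0∞ :=
  ENNReal.ofReal (R ^ (-alphaExp n q l)) * mixedNorm q l (parCylinder R lam θ x₀ t₀) b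

/-- `D_i u`, the derivative in the `i`-th space variable. -/
def spaceDeriv {n : ℕ} (i : Fin n) (u : SpaceTime n → ℝ) (p : SpaceTime n) : ℝ :=
  fderiv ℝ u p (EuclideanSpace.single i 1, 0)

/-- `∂_t u`. -/
def timeDeriv {n : ℕ} (u : SpaceTime n → ℝ) (p : SpaceTime n) : ℝ :=
  fderiv ℝ u p (0, 1)

/-- The coefficients `a_{ij}` are measurable and essentially bounded on `Q`. -/
def BoundedCoeff {n : ℕ} (Q : Set (SpaceTime n))
    (a : SpaceTime n → Matrix (Fin n) (Fin n) ℝ) : Prop :=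
  (∀ i j, AEMeasurable (fun p => a p i j) (volume.restrict Q)) ∧
    ∃ C : ℝ, ∀ i j, ∀ᵐ p ∂(volume.restrict Q), |a p i j| ≤ C

/-- Uniform parabolicity on `Q`: `ν |ξ|² ≤ a_{ij} ξ_i ξ_j ≤ ν⁻¹ |ξ|²`. -/
def UniformlyElliptic {n : ℕ} (ν : ℝ) (Q : Set (SpaceTime n))
    (a : SpaceTime n → Matrix (Fin n) (Fin n) ℝ) : Prop :=
  ∀ᵐ p ∂(volume.restrict Q), ∀ ξ : EuclideanSpace ℝ (Fin n),
    ν * ‖ξ‖ ^ 2 ≤ ∑ i, ∑ j, a p i j * ξ i * ξ j ∧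
      ∑ i, ∑ j, a p i j * ξ i * ξ j ≤ ν⁻¹ * ‖ξ‖ ^ 2

/-- `div b ≤ 0` in the sense of distributions on the open set `Q`; the divergence is taken in the
space variables. -/
def DivNonpos {n : ℕ} (Q : Set (SpaceTime n))
    (b : SpaceTime n → EuclideanSpace ℝ (Fin n)) : Prop :=
  ∀ φ : SpaceTime n → ℝ, ContDiff ℝ ((⊤ : ℕ∞) : WithTop ℕ∞) φ → HasCompactSupport φ → tsupport φ ⊆ Q →
    (∀ p, 0 ≤ φ p) → 0 ≤ ∫ p in Q, ∑ i, b p i * spaceDeriv i φ p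

/-- `u` is a locally Lipschitz generalized solution of
`∂_t u - D_i (a_{ij} D_j u) + b_i D_i u = 0` in the open set `Q`: the integral identity holds
for all Lipschitz test functions with compact support in `Q`. -/
def IsLipschitzSolution {n : ℕ} (Q : Set (SpaceTime n))
    (a : SpaceTime n → Matrix (Fin n) (Fin n) ℝ)
    (b : SpaceTime n → EuclideanSpace ℝ (Fin n)) (u : SpaceTime n → ℝ) : Prop :=
  LocallyLipschitzOn Q u ∧
    ∀ η : SpaceTime n → ℝ, (∃ K, LipschitzWith K η) → HasCompactSupport η → tsupport η ⊆ Q →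
      ∫ p in Q, (timeDeriv u p * η p
        + ∑ i, ∑ j, a p i j * spaceDeriv j u p * spaceDeriv i η p
        + ∑ i, b p i * spaceDeriv i u p * η p) = 0

end ParabolicLiouville

end

open ParabolicLiouville

/-! The theorem follows from an expansion of positivity. Normalise `u` affinely so that its infimum
is 0 and its supremum 1. On any cylinder one of `u`, `1 - u` is at least 1/2 on half of the measure,
and `exists_expansion_of_positivity` then bounds that function below by a fixed `κ > 0` on a
smaller, later cylinder. Parabolic dilations carry arbitrarily large cylinders, those along which
the scaled norm of the drift stays bounded, to one fixed cylinder, so `κ` is the same at every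
scale. The smaller cylinders contain any two given points once the scale is large. Choosing one
point where `u` is within `κ` of its infimum and one where it is within `κ` of its supremum gives a
contradiction in either case.

The drift is tamed by the shape of the cylinder. After dilation it has radius `2 * r` but time
length only 4, and the drift norm there is at most `C₀ * (2 * r) ^ α`. Since `div b ≤ 0`, testing
with nonnegative functions removes every product of `b` with derivatives of `u`; the drift only
meets derivatives of cutoffs, of size `1 / r`. Its contribution is thus of order `r ^ (α - 1)`,
which is small for large `r` because `α < 1`.

Expansion of positivity has two halves. In the first (`exists_rarely_small`) the function `w = log
((1 + ε) / (u + ε))` lies between 0 and `Λ = log ((1 + ε) / ε)`. Its weighted Dirichlet energy is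
`O(Λ)`, so its gradient is `O(√Λ)` in `L¹`; as `w ≤ 1` on a sizeable set, the Poincaré inequality
makes the mass of `w` at some time a small fraction of `Λ` (`log_dip`). The energy inequality and
Young's inequality preserve this later (`logMass_propagate`), and Chebyshev shows that `u < κ` only
on a small part of each later time slice. In the second half (`exists_lower_bound`) a De Giorgi
iteration is run on truncations of `1 - barrier - u / κ`, level sets being measured with density `1
+ |b| / r` so that the drift enters the recursion on the same footing as volume. The parabolic
embedding makes the recursion superlinear, and the bad set disappears.

The analysis uses finite exponents larger than 1. The general case is reduced to it by Hölder on
large cylinders, which raises `α` only to `(1 + α) / 2 < 1`. -/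

namespace ParabolicLiouville

open scoped NNReal Convolution

/-! ### Mollification and multiplicative Sobolev inequalities. -/

/-- Smooth approximation of a Lipschitz function by mollification. -/
theorem exists_smooth_approx {E : Type*} [NormedAddCommGroup E] [NormedSpace ℝ E]
    [FiniteDimensional ℝ E] [MeasurableSpace E] [BorelSpace E] (μ : Measure E)
    [μ.IsAddHaarMeasure] {K : ℝ≥0} {f : E → ℝ} (hf : LipschitzWith K f) :
    ∃ g : ℕ → E → ℝ, (∀ k, ContDiff ℝ ((⊤ : ℕ∞) : WithTop ℕ∞) (g k)) ∧
      (∀ k, LipschitzWith K (g k)) ∧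
      (∀ x, Tendsto (fun k => g k x) atTop (𝓝 (f x))) ∧
      (∀ᵐ x ∂μ, Tendsto (fun k => fderiv ℝ (g k) x) atTop (𝓝 (fderiv ℝ f x))) ∧
      (∀ (k : ℕ) x, (∀ y ∈ Metric.closedBall x (1 / ((k : ℝ) + 1)), f y = 0) → g k x = 0) ∧
      ((∀ x, 0 ≤ f x) → ∀ k x, 0 ≤ g k x) := by
  -- The outer radius is exactly twice the inner one: a bounded ratio is what lets the mollified
  -- gradient converge at Lebesgue points.
  let φ : ℕ → ContDiffBump (0 : E) := fun k =>
    { rIn := 1 / (2 * ((k : ℝ) + 1)), rOut := 1 / ((k : ℝ) + 1)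
      rIn_pos := by positivity
      rIn_lt_rOut := by
        apply one_div_lt_one_div_of_lt <;> [positivity; linarith [(Nat.cast_nonneg k : (0 : ℝ) ≤ k)]] }
  have hφ0 : Tendsto (fun k => (φ k).rOut) atTop (𝓝 0) := tendsto_one_div_add_atTop_nhds_zero_nat
  have hφK : ∀ᶠ k in atTop, (φ k).rOut ≤ 2 * (φ k).rIn := by
    refine Eventually.of_forall fun k => ?_
    simp only [φ]
    have : (0 : ℝ) < k + 1 := by positivity
    apply le_of_eq; field_simp
  have hdmeas : Measurable (fderiv ℝ f) := measurable_fderiv ℝ f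
  have hdsm : StronglyMeasurable (fderiv ℝ f) := hdmeas.stronglyMeasurable
  have hint : ∀ k x, Integrable (fun t => (φ k).normed μ t * f (x - t)) μ := fun k x =>
    (((φ k).continuous_normed.mul (hf.continuous.comp (continuous_const.sub continuous_id)))
      ).integrable_of_hasCompactSupport ((φ k).hasCompactSupport_normed.mul_right)
  have hval : ∀ k x, ((φ k).normed μ ⋆[ContinuousLinearMap.lsmul ℝ ℝ, μ] f) x
      = ∫ t, (φ k).normed μ t * f (x - t) ∂μ := fun k x => by
    simp [convolution, smul_eq_mul]
  refine ⟨fun k => (φ k).normed μ ⋆[ContinuousLinearMap.lsmul ℝ ℝ, μ] f, ?_, ?_, ?_, ?_, ?_, ?_⟩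
  · intro k
    exact (φ k).hasCompactSupport_normed.contDiff_convolution_left _ (φ k).contDiff_normed
      hf.continuous.locallyIntegrable
  · intro k
    refine LipschitzWith.of_dist_le_mul fun x y => ?_
    beta_reduce
    rw [Real.dist_eq, hval, hval, ← integral_sub (hint k x) (hint k y)]
    have h1 : ∀ t, ‖(φ k).normed μ t * f (x - t) - (φ k).normed μ t * f (y - t)‖
        ≤ (φ k).normed μ t * (K * dist x y) := fun t => by
      rw [← mul_sub, norm_mul, Real.norm_of_nonneg ((φ k).nonneg_normed t)]
      refine mul_le_mul_of_nonneg_left ?_ ((φ k).nonneg_normed t)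
      have := hf.dist_le_mul (x - t) (y - t)
      rwa [dist_sub_right, Real.dist_eq] at this
    calc |∫ t, ((φ k).normed μ t * f (x - t) - (φ k).normed μ t * f (y - t)) ∂μ|
        ≤ ∫ t, (φ k).normed μ t * (K * dist x y) ∂μ :=
          norm_integral_le_of_norm_le ((φ k).integrable_normed.mul_const _)
            (Eventually.of_forall h1)
      _ = K * dist x y := by rw [integral_mul_const, (φ k).integral_normed, one_mul]
  · intro x
    exact ContDiffBump.convolution_tendsto_right_of_continuous hφ0 hf.continuous x
  · have hloc : LocallyIntegrable (fderiv ℝ f) μ := by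
      have : LocallyIntegrable (fun _ : E => (K : ℝ)) μ := locallyIntegrable_const _
      refine this.mono hdsm.aestronglyMeasurable (Eventually.of_forall fun x => ?_)
      rw [Real.norm_of_nonneg (r := (K : ℝ)) K.2]
      exact norm_fderiv_le_of_lipschitz ℝ hf
    filter_upwards [ContDiffBump.ae_convolution_tendsto_right_of_locallyIntegrable hφ0 hφK hloc]
      with x hx
    refine hx.congr fun k => ?_
    have hq : ∀ᵐ t ∂μ, DifferentiableAt ℝ f (x - t) :=
      (Measure.measurePreserving_sub_left μ x).quasiMeasurePreserving.ae hf.ae_differentiableAt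
    -- The gradient of the mollification is the mollification of the a.e. gradient: by Rademacher,
    -- `f` is differentiable at `x - t` for almost every `t`.
    have := (hasFDerivAt_integral_of_dominated_loc_of_lip (μ := μ) (𝕜 := ℝ)
      (F := fun y t => (φ k).normed μ t * f (y - t))
      (F' := fun t => (φ k).normed μ t • fderiv ℝ f (x - t))
      (bound := fun t => (φ k).normed μ t * K) (x₀ := x) (s := univ) univ_mem ?_ (hint k x)
      ?_ ?_ ((φ k).integrable_normed.mul_const _) ?_).2
    · symm
      have h2 : (fun y => ∫ t, (φ k).normed μ t * f (y - t) ∂μ)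
          = (φ k).normed μ ⋆[ContinuousLinearMap.lsmul ℝ ℝ, μ] f := by
        ext y; rw [hval]
      rw [h2] at this
      rw [this.fderiv]; simp [convolution]
    · exact Eventually.of_forall fun y => (hint k y).aestronglyMeasurable
    · refine ((φ k).continuous_normed.aestronglyMeasurable).smul ?_
      exact (hdsm.comp_measurable (measurable_const.sub measurable_id)).aestronglyMeasurable
    · refine Eventually.of_forall fun t => ?_
      refine LipschitzOnWith.of_dist_le_mul fun y _ z _ => ?_
      have h3 : (Real.nnabs ((φ k).normed μ t * K) : ℝ) = (φ k).normed μ t * K := by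
        rw [Real.coe_nnabs]; exact abs_of_nonneg (mul_nonneg ((φ k).nonneg_normed t) K.2)
      rw [h3, Real.dist_eq, ← mul_sub, abs_mul, abs_of_nonneg ((φ k).nonneg_normed t), mul_assoc]
      refine mul_le_mul_of_nonneg_left ?_ ((φ k).nonneg_normed t)
      have := hf.dist_le_mul (y - t) (z - t)
      rwa [dist_sub_right, Real.dist_eq] at this
    · filter_upwards [hq] with t ht
      have h4 : HasFDerivAt (fun y => f (y - t)) (fderiv ℝ f (x - t)) x := by
        exact (hasFDerivAt_comp_sub t).2 ht.hasFDerivAt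
      exact h4.const_mul _
  · intro k x h
    beta_reduce
    rw [hval]
    refine integral_eq_zero_of_ae (Eventually.of_forall fun t => ?_)
    by_cases ht : t ∈ Metric.ball (0 : E) (φ k).rOut
    · have : f (x - t) = 0 := h _ (by
        rw [mem_ball_zero_iff] at ht
        rw [Metric.mem_closedBall, dist_eq_norm]
        simpa [φ] using ht.le)
      simp [this]
    · rw [← (φ k).support_normed_eq (μ := μ), Function.notMem_support] at ht
      simp [ht]
  · intro h k x
    beta_reduce
    rw [hval]
    exact integral_nonneg fun t => mul_nonneg ((φ k).nonneg_normed t) (h _)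

/-- A Sobolev-type inequality for smooth functions of compact support extends to Lipschitz ones. -/
theorem sobolev_of_smooth {E : Type*} [NormedAddCommGroup E] [NormedSpace ℝ E]
    [FiniteDimensional ℝ E] [MeasurableSpace E] [BorelSpace E] (μ : Measure E)
    [μ.IsAddHaarMeasure] {p s a : ℝ} (hs : 0 < s) {C : ℝ≥0∞} (hC : C ≠ ∞)
    (H : ∀ g : E → ℝ, ContDiff ℝ 1 g → HasCompactSupport g →
      ∫⁻ x, ‖g x‖ₑ ^ p ∂μ ≤ C * (∫⁻ x, ‖fderiv ℝ g x‖ₑ ^ s ∂μ) ^ a)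
    {K : ℝ≥0} {f : E → ℝ} (hf : LipschitzWith K f) (hfc : HasCompactSupport f) :
    ∫⁻ x, ‖f x‖ₑ ^ p ∂μ ≤ C * (∫⁻ x, ‖fderiv ℝ f x‖ₑ ^ s ∂μ) ^ a := by
  obtain ⟨g, hg1, hg2, hg3, hg4, hg5, -⟩ := exists_smooth_approx μ hf
  set S := Metric.cthickening 1 (tsupport f) with hS
  have hSc : IsCompact S := IsCompact.cthickening hfc
  have hg0 : ∀ k x, x ∉ S → g k x = 0 := by
    intro k x hx
    refine hg5 k x fun y hy => ?_
    by_contra hne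
    refine hx (Metric.mem_cthickening_of_dist_le x y 1 _ (subset_tsupport f hne) ?_)
    rw [Metric.mem_closedBall, dist_comm] at hy
    refine hy.trans ?_
    rw [div_le_one (by positivity)]
    linarith [(Nat.cast_nonneg k : (0 : ℝ) ≤ k)]
  have hgc : ∀ k, HasCompactSupport (g k) := fun k => HasCompactSupport.intro hSc (hg0 k)
  have hts : ∀ k, tsupport (g k) ⊆ S := fun k =>
    closure_minimal (fun x hx => by by_contra h; exact hx (hg0 k x h)) hSc.isClosed
  have hd : Tendsto (fun k => ∫⁻ x, ‖fderiv ℝ (g k) x‖ₑ ^ s ∂μ) atTop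
      (𝓝 (∫⁻ x, ‖fderiv ℝ f x‖ₑ ^ s ∂μ)) := by
    refine tendsto_lintegral_of_dominated_convergence (S.indicator fun _ => (K : ℝ≥0∞) ^ s)
      (fun k => ((measurable_fderiv ℝ (g k)).enorm.pow_const s)) ?_ ?_ ?_
    · refine fun k => Eventually.of_forall fun x => ?_
      by_cases hx : x ∈ S
      · rw [indicator_of_mem hx]
        refine ENNReal.rpow_le_rpow ?_ hs.le
        have := norm_fderiv_le_of_lipschitz ℝ (hg2 k) (x₀ := x)
        rw [enorm_eq_nnnorm]
        exact_mod_cast this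
      · have : fderiv ℝ (g k) x = 0 := by
          by_contra h
          exact hx (hts k (support_fderiv_subset ℝ h))
        beta_reduce
        rw [this, enorm_eq_nnnorm, nnnorm_zero, ENNReal.coe_zero, ENNReal.zero_rpow_of_pos hs]
        exact zero_le
    · rw [lintegral_indicator hSc.measurableSet, setLIntegral_const]
      exact ENNReal.mul_ne_top (ENNReal.rpow_ne_top_of_nonneg hs.le ENNReal.coe_ne_top)
        hSc.measure_lt_top.ne
    · filter_upwards [hg4] with x hx
      exact (ENNReal.continuous_rpow_const.tendsto _).comp
        ((continuous_enorm.tendsto _).comp hx)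
  -- Fatou suffices on the left-hand side; only the gradient integrals need genuine convergence.
  have h1 : ∫⁻ x, ‖f x‖ₑ ^ p ∂μ ≤ liminf (fun k => ∫⁻ x, ‖g k x‖ₑ ^ p ∂μ) atTop := by
    refine le_trans (le_of_eq ?_) (lintegral_liminf_le fun k =>
      ((hg1 k).continuous.measurable.enorm.pow_const p))
    refine lintegral_congr fun x => ?_
    exact (((ENNReal.continuous_rpow_const.tendsto _).comp
        ((continuous_enorm.tendsto _).comp (hg3 x))).liminf_eq).symm
  have h2 : Tendsto (fun k => C * (∫⁻ x, ‖fderiv ℝ (g k) x‖ₑ ^ s ∂μ) ^ a) atTop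
      (𝓝 (C * (∫⁻ x, ‖fderiv ℝ f x‖ₑ ^ s ∂μ) ^ a)) :=
    ENNReal.Tendsto.const_mul ((ENNReal.continuous_rpow_const.tendsto _).comp hd) (Or.inr hC)
  refine h1.trans (le_trans (liminf_le_liminf (Eventually.of_forall fun k => ?_))
    h2.liminf_eq.le)
  exact H (g k) ((hg1 k).of_le (by exact_mod_cast le_top)) (hgc k)

/-- The plane is treated apart because the exponent `2n / (n - 2)` degenerates there. The substitute
is the endpoint inequality from gradient in `L¹` to function in `L²`. -/
theorem sobolev_two {K : ℝ≥0} {f : EuclideanSpace ℝ (Fin 2) → ℝ} (hf : LipschitzWith K f)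
    (hfc : HasCompactSupport f) :
    ∫⁻ x, ‖f x‖ₑ ^ (2 : ℝ) ≤
      (lintegralPowLePowLIntegralFDerivConst (volume : Measure (EuclideanSpace ℝ (Fin 2))) 2)
        * (∫⁻ x, ‖fderiv ℝ f x‖ₑ ^ (1 : ℝ)) ^ (2 : ℝ) := by
  refine sobolev_of_smooth volume one_pos ENNReal.coe_ne_top ?_ hf hfc
  intro g hg hgc
  have := lintegral_pow_le_pow_lintegral_fderiv volume hg hgc (p := 2) (by
    rw [finrank_euclideanSpace_fin]; norm_num
    exact Real.HolderConjugate.two_two)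
  simpa using this

/-- Iterating `∫ η^{2m+2} ≤ C ∫ |Dη|² ∫ η^{2m}` in the plane. -/
theorem sobolev_two_pow (m : ℕ) : ∃ C : ℝ≥0, ∀ (K : ℝ≥0) (η : EuclideanSpace ℝ (Fin 2) → ℝ),
    LipschitzWith K η → HasCompactSupport η →
    ∫⁻ x, ‖η x‖ₑ ^ (2 * (m + 1) : ℝ) ≤
      C * (∫⁻ x, ‖η x‖ₑ ^ (2 : ℝ)) * (∫⁻ x, ‖fderiv ℝ η x‖ₑ ^ (2 : ℝ)) ^ (m : ℝ) := by
  induction m with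
  | zero => exact ⟨1, fun K η _ _ => by simp⟩
  | succ m ih =>
    obtain ⟨C, hC⟩ := ih
    set C0 := lintegralPowLePowLIntegralFDerivConst
      (volume : Measure (EuclideanSpace ℝ (Fin 2))) 2
    refine ⟨C0 * ((m + 2 : ℕ) : ℝ≥0) ^ 2 * C, fun K η hη hηc => ?_⟩
    set D := ∫⁻ x, ‖fderiv ℝ η x‖ₑ ^ (2 : ℝ)
    have hb : ∃ B : ℝ≥0, ∀ x, ‖η x‖ ≤ B := by
      obtain ⟨B, hB⟩ := hηc.exists_bound_of_continuous hη.continuous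
      exact ⟨B.toNNReal, fun x => (hB x).trans (Real.le_coe_toNNReal B)⟩
    obtain ⟨B, hB⟩ := hb
    have hlip : LipschitzWith ((m + 2 : ℕ) * B ^ (m + 1) * K) (fun x => η x ^ (m + 2)) := by
      have h1 : LipschitzOnWith ((m + 2 : ℕ) * B ^ (m + 1)) (fun s : ℝ => s ^ (m + 2))
          (Metric.closedBall 0 B) := by
        refine (convex_closedBall (0 : ℝ) (B : ℝ)).lipschitzOnWith_of_nnnorm_hasDerivWithin_le
          (f' := fun s => ((m + 2 : ℕ) : ℝ) * s ^ (m + 1)) (fun s _ => ?_) (fun s hs => ?_)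
        · have := (hasDerivAt_pow (m + 2) s).hasDerivWithinAt (s := Metric.closedBall 0 (B : ℝ))
          simpa using this
        · rw [← NNReal.coe_le_coe]
          push_cast
          rw [norm_mul, norm_pow, mem_closedBall_zero_iff] at *
          rw [Real.norm_of_nonneg (by positivity)]
          gcongr
      refine LipschitzWith.of_dist_le_mul fun x y => ?_
      have h2 := h1.dist_le_mul (η x) (by simpa using hB x) (η y) (by simpa using hB y)
      refine h2.trans ?_
      rw [NNReal.coe_mul _ K, mul_assoc]
      exact mul_le_mul_of_nonneg_left (hη.dist_le_mul x y) (NNReal.coe_nonneg _)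
    have hsupp : HasCompactSupport (fun x => η x ^ (m + 2)) :=
      hηc.comp_left (g := fun s : ℝ => s ^ (m + 2)) (by simp)
    -- The endpoint inequality is applied to `η ^ (m + 2)`. Cauchy–Schwarz splits its gradient `(m +
    -- 2) η ^ (m + 1) Dη`, and squaring brings back the integral of the induction hypothesis.
    have h3 := sobolev_two hlip hsupp
    have h4 : ∫⁻ x, ‖fderiv ℝ (fun x => η x ^ (m + 2)) x‖ₑ ^ (1 : ℝ)
        ≤ ((m + 2 : ℕ) : ℝ≥0∞) * ((∫⁻ x, ‖η x‖ₑ ^ (2 * (m + 1) : ℝ)) ^ (1 / 2 : ℝ) * D ^ (1 / 2 : ℝ)) := by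
      have h5 : ∫⁻ x, ‖fderiv ℝ (fun x => η x ^ (m + 2)) x‖ₑ ^ (1 : ℝ)
          = ((m + 2 : ℕ) : ℝ≥0∞) * ∫⁻ x, ‖η x‖ₑ ^ (m + 1) * ‖fderiv ℝ η x‖ₑ := by
        rw [← lintegral_const_mul']
        · refine lintegral_congr_ae ?_
          filter_upwards [hη.ae_differentiableAt] with x hx
          rw [(hx.hasFDerivAt.pow (m + 2)).fderiv, ENNReal.rpow_one, enorm_smul, ← mul_assoc]
          congr 1
          rw [nsmul_eq_mul, enorm_mul, enorm_pow, Real.enorm_natCast]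
          rfl
        · simp
      rw [h5]
      refine mul_le_mul_right ?_ _
      have h6 := ENNReal.lintegral_mul_le_Lp_mul_Lq volume Real.HolderConjugate.two_two
        (f := fun x => ‖η x‖ₑ ^ (m + 1)) (g := fun x => ‖fderiv ℝ η x‖ₑ)
        (hη.continuous.measurable.enorm.pow_const _).aemeasurable
        (measurable_fderiv ℝ η).enorm.aemeasurable
      refine h6.trans (le_of_eq ?_)
      congr 2
      refine lintegral_congr fun x => ?_
      rw [← ENNReal.rpow_natCast, ← ENNReal.rpow_mul]
      congr 1; push_cast; ring
    have h7 : ∫⁻ x, ‖η x‖ₑ ^ (2 * ((m + 1 : ℕ) + 1) : ℝ) = ∫⁻ x, ‖η x ^ (m + 2)‖ₑ ^ (2 : ℝ) := by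
      refine lintegral_congr fun x => ?_
      rw [enorm_pow, ← ENNReal.rpow_natCast, ← ENNReal.rpow_mul]
      congr 1; push_cast; ring
    rw [h7]
    calc _ ≤ _ := h3
      _ ≤ C0 * (((m + 2 : ℕ) : ℝ≥0∞) * ((∫⁻ x, ‖η x‖ₑ ^ (2 * (m + 1) : ℝ)) ^ (1 / 2 : ℝ)
            * D ^ (1 / 2 : ℝ))) ^ (2 : ℝ) := by gcongr
      _ = C0 * ((m + 2 : ℕ) : ℝ≥0∞) ^ 2 * (∫⁻ x, ‖η x‖ₑ ^ (2 * (m + 1) : ℝ)) * D := by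
          rw [ENNReal.mul_rpow_of_nonneg _ _ two_pos.le, ENNReal.mul_rpow_of_nonneg _ _ two_pos.le,
            ← ENNReal.rpow_mul, ← ENNReal.rpow_mul]
          norm_num
          ring
      _ ≤ C0 * ((m + 2 : ℕ) : ℝ≥0∞) ^ 2 * (C * (∫⁻ x, ‖η x‖ₑ ^ (2 : ℝ)) * D ^ (m : ℝ)) * D := by
          gcongr
          exact hC K η hη hηc
      _ = _ := by
          push_cast
          rw [ENNReal.rpow_add_of_nonneg _ _ (Nat.cast_nonneg m) zero_le_one, ENNReal.rpow_one]
          ring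

theorem sobolev_three {n : ℕ} (hn : 3 ≤ n) : ∃ C : ℝ≥0, ∀ (K : ℝ≥0)
    (η : EuclideanSpace ℝ (Fin n) → ℝ), LipschitzWith K η → HasCompactSupport η →
    ∫⁻ x, ‖η x‖ₑ ^ (2 * n / (n - 2) : ℝ) ≤
      C * (∫⁻ x, ‖fderiv ℝ η x‖ₑ ^ (2 : ℝ)) ^ (n / (n - 2) : ℝ) := by
  have hn3 : (3 : ℝ) ≤ n := by exact_mod_cast hn
  have hn2 : (0 : ℝ) < n - 2 := by linarith
  set p : ℝ≥0 := ⟨2 * n / (n - 2), by positivity⟩ with hp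
  have hpc : (p : ℝ) = 2 * n / (n - 2) := rfl
  have hp0 : (0 : ℝ) < p := by rw [hpc]; positivity
  set C0 := SNormLESNormFDerivOfEqConst ℝ (volume : Measure (EuclideanSpace ℝ (Fin n))) 2
  refine ⟨C0 ^ (p : ℝ), fun K η hη hηc => ?_⟩
  rw [← hpc]
  have hcoe : ((C0 ^ (p : ℝ) : ℝ≥0) : ℝ≥0∞) = (C0 : ℝ≥0∞) ^ (p : ℝ) :=
    ENNReal.coe_rpow_of_nonneg _ hp0.le
  rw [hcoe]
  refine sobolev_of_smooth volume two_pos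
    (ENNReal.rpow_ne_top_of_nonneg hp0.le ENNReal.coe_ne_top) ?_ hη hηc
  intro g hg hgc
  have h := eLpNorm_le_eLpNorm_fderiv_of_eq volume hg hgc (p := 2) (p' := p) (by norm_num)
    (by rw [finrank_euclideanSpace_fin]; omega)
    (by rw [finrank_euclideanSpace_fin, hpc]; push_cast; field_simp)
  have hpne : (p : ℝ≥0∞) ≠ 0 := by
    rw [ENNReal.coe_ne_zero]; intro h0; rw [h0] at hp0; simp at hp0
  rw [eLpNorm_eq_lintegral_rpow_enorm_toReal hpne ENNReal.coe_ne_top,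
    eLpNorm_eq_lintegral_rpow_enorm_toReal (by simp) (by simp)] at h
  have h' := ENNReal.rpow_le_rpow h hp0.le
  rw [← ENNReal.rpow_mul, ENNReal.mul_rpow_of_nonneg _ _ hp0.le, ← ENNReal.rpow_mul] at h'
  simp only [ENNReal.coe_toReal, NNReal.coe_ofNat] at h'
  rw [one_div_mul_cancel hp0.ne', ENNReal.rpow_one] at h'
  refine h'.trans (le_of_eq ?_)
  congr 2
  rw [hpc]; field_simp

/-- Gagliardo–Nirenberg inequality between `L²` and the gradient in `L²`. -/
theorem gagliardo_nirenberg {n : ℕ} (hn : 2 ≤ n) {r : ℝ} (hr : 2 ≤ r)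
    (hr' : ((n : ℝ) - 2) * (r - 2) ≤ 4) : ∃ C : ℝ≥0, ∀ (K : ℝ≥0)
    (η : EuclideanSpace ℝ (Fin n) → ℝ), LipschitzWith K η → HasCompactSupport η →
    ∫⁻ x, ‖η x‖ₑ ^ r ≤ C * (∫⁻ x, ‖η x‖ₑ ^ (2 : ℝ)) ^ (r / 2 - n * (r - 2) / 4)
      * (∫⁻ x, ‖fderiv ℝ η x‖ₑ ^ (2 : ℝ)) ^ (n * (r - 2) / 4) := by
  -- Hölder interpolation between the exponents 2 and `r1`; zeros of `η` are separated because
  -- powers cannot be added at base 0.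
  have key : ∀ (r1 σ : ℝ), 0 ≤ σ → σ ≤ 1 → r = 2 * (1 - σ) + r1 * σ →
      ∀ η : EuclideanSpace ℝ (Fin n) → ℝ, Continuous η → ∫⁻ x, ‖η x‖ₑ ^ r ≤
        (∫⁻ x, ‖η x‖ₑ ^ (2 : ℝ)) ^ (1 - σ) * (∫⁻ x, ‖η x‖ₑ ^ r1) ^ σ := by
    intro r1 σ h0 h1 hrr η hη
    have hm := hη.measurable.enorm
    refine le_trans (le_of_eq ?_) (ENNReal.lintegral_mul_norm_pow_le
      (hm.pow_const _).aemeasurable (hm.pow_const _).aemeasurable (sub_nonneg.2 h1) h0 (by ring))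
    refine lintegral_congr fun x => ?_
    rw [← ENNReal.rpow_mul, ← ENNReal.rpow_mul]
    rcases eq_or_ne (‖η x‖ₑ) 0 with h | h
    · rw [h, ENNReal.zero_rpow_of_pos (by linarith)]
      rcases h0.eq_or_lt with h00 | h00
      · rw [ENNReal.zero_rpow_of_pos (by linarith), zero_mul]
      · by_cases h11 : σ = 1
        · subst h11
          rw [ENNReal.zero_rpow_of_pos (y := r1 * 1) (by linarith), mul_zero]
        · rw [ENNReal.zero_rpow_of_pos (y := 2 * (1 - σ))
            (by have := lt_of_le_of_ne h1 h11; linarith), zero_mul]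
    · rw [← ENNReal.rpow_add _ _ h enorm_ne_top, hrr]
  rcases eq_or_lt_of_le hn with h2 | h3
  · subst h2
    -- There is no critical exponent in the plane; any `2 * (m + 1)` large enough to keep the
    -- interpolation parameter `(r - 2) / (2 * m)` at most 1 will do.
    obtain ⟨m, hm⟩ := exists_nat_gt (r / 2)
    have hm1 : (1 : ℝ) < m := by linarith
    obtain ⟨C, hC⟩ := sobolev_two_pow m
    set σ : ℝ := (r - 2) / (2 * m) with hσ
    have hσ0 : 0 ≤ σ := by apply div_nonneg <;> linarith
    have hσ1 : σ ≤ 1 := by rw [hσ, div_le_one (by linarith)]; linarith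
    have hmσ : m * σ = (r - 2) / 2 := by rw [hσ]; field_simp
    refine ⟨C ^ σ, fun K η hη hηc => ?_⟩
    refine (key (2 * (m + 1)) σ hσ0 hσ1 (by nlinarith) η hη.continuous).trans ?_
    refine (mul_le_mul_right (ENNReal.rpow_le_rpow (hC K η hη hηc) hσ0) _).trans (le_of_eq ?_)
    rw [ENNReal.mul_rpow_of_nonneg _ _ hσ0, ENNReal.mul_rpow_of_nonneg _ _ hσ0, ← ENNReal.rpow_mul,
      ENNReal.coe_rpow_of_nonneg _ hσ0, hmσ]
    have e1 : r / 2 - ((2 : ℕ) : ℝ) * (r - 2) / 4 = (1 - σ) + σ := by push_cast; ring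
    rw [e1, ENNReal.rpow_add_of_nonneg _ _ (sub_nonneg.2 hσ1) hσ0]
    have e2 : ((2 : ℕ) : ℝ) * (r - 2) / 4 = (r - 2) / 2 := by push_cast; ring
    rw [e2]; ring
  · have hn3 : (3 : ℝ) ≤ n := by exact_mod_cast h3
    have hn2 : (0 : ℝ) < n - 2 := by linarith
    obtain ⟨C, hC⟩ := sobolev_three h3
    set σ : ℝ := (r - 2) * (n - 2) / 4 with hσ
    have hσ0 : 0 ≤ σ := by
      apply div_nonneg _ (by norm_num); exact mul_nonneg (by linarith) hn2.le
    have hσ1 : σ ≤ 1 := by rw [hσ, div_le_one (by norm_num)]; linarith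
    refine ⟨C ^ σ, fun K η hη hηc => ?_⟩
    refine (key (2 * n / (n - 2)) σ hσ0 hσ1 (by rw [hσ]; field_simp; ring) η hη.continuous).trans ?_
    refine (mul_le_mul_right (ENNReal.rpow_le_rpow (hC K η hη hηc) hσ0) _).trans (le_of_eq ?_)
    rw [ENNReal.mul_rpow_of_nonneg _ _ hσ0, ← ENNReal.rpow_mul,
      ENNReal.coe_rpow_of_nonneg _ hσ0]
    have e1 : r / 2 - (n : ℝ) * (r - 2) / 4 = 1 - σ := by rw [hσ]; ring
    have e2 : (n : ℝ) / (n - 2) * σ = n * (r - 2) / 4 := by rw [hσ]; field_simp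
    rw [e1, e2]; ring

/-! ### Weighted Poincaré inequality. -/

/-- Integration over a ball of a function of an intermediate point of two points. -/
theorem lintegral_comp_segment_le {n : ℕ} {h : EuclideanSpace ℝ (Fin n) → ℝ≥0∞} (hh : Measurable h)
    (c : EuclideanSpace ℝ (Fin n)) {s : ℝ} (hs : 1 / 2 ≤ s) :
    ∫⁻ y, h (c + s • y) ≤ 2 ^ n * ∫⁻ z, h z := by
  have hs0 : 0 < s := by linarith
  have h1 : ∫⁻ y, h (c + s • y)
      = ∫⁻ z, h (c + z) ∂(Measure.map (fun y => s • y) (volume : Measure (EuclideanSpace ℝ (Fin n)))) := by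
    exact (lintegral_map (f := fun z => h (c + z)) (hh.comp (measurable_const_add c))
      (measurable_const_smul s)).symm
  rw [h1, Measure.map_addHaar_smul _ hs0.ne', lintegral_smul_measure,
    lintegral_add_left_eq_self, smul_eq_mul, finrank_euclideanSpace_fin]
  refine mul_le_mul_left ?_ _
  rw [abs_of_nonneg (by positivity), ← inv_pow]
  have h2 : s⁻¹ ≤ 2 := by rw [inv_le_comm₀ hs0 two_pos]; linarith
  calc ENNReal.ofReal (s⁻¹ ^ n) ≤ ENNReal.ofReal (2 ^ n) := by gcongr
    _ = 2 ^ n := by rw [ENNReal.ofReal_pow two_pos.le]; simp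

/-- Weighted Poincaré inequality in a ball for continuously differentiable functions. -/
theorem poincare_of_contDiff {n : ℕ} {r : ℝ} {ψ : EuclideanSpace ℝ (Fin n) → ℝ≥0∞}
    (hψm : Measurable ψ) (hψ0 : ∀ x, r ≤ ‖x‖ → ψ x = 0)
    (hψ : ∀ x y, ∀ s ∈ Icc (0 : ℝ) 1, ψ x * ψ y ≤ ψ ((1 - s) • x + s • y))
    {f : EuclideanSpace ℝ (Fin n) → ℝ} (hf : ContDiff ℝ 1 f) :
    ∫⁻ x, ∫⁻ y, ‖f x - f y‖ₑ * (ψ x * ψ y) ≤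
      ENNReal.ofReal (2 * r) * (2 ^ n * volume (Metric.ball (0 : EuclideanSpace ℝ (Fin n)) r))
        * ∫⁻ x, ψ x * ‖fderiv ℝ f x‖ₑ := by
  set B := Metric.ball (0 : EuclideanSpace ℝ (Fin n)) r
  set h : EuclideanSpace ℝ (Fin n) → ℝ≥0∞ := fun x => ψ x * ‖fderiv ℝ f x‖ₑ with hh
  have hfd : Continuous (fderiv ℝ f) := hf.continuous_fderiv one_ne_zero
  have hhm : Measurable h := hψm.mul hfd.measurable.enorm
  have hBm : MeasurableSet B := Metric.isOpen_ball.measurableSet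
  let χ : EuclideanSpace ℝ (Fin n) → ℝ≥0∞ := B.indicator 1
  have hχm : Measurable χ := measurable_const.indicator hBm
  have hχ1 : ∀ x, χ x ≤ 1 := fun x => indicator_le_self' (by simp) x
  have hχ0 : ∀ x, ψ x ≠ 0 → χ x = 1 := fun x hx => by
    have : x ∈ B := by
      rw [mem_ball_zero_iff]; by_contra hc; exact hx (hψ0 x (not_lt.1 hc))
    simp [χ, this]
  have hχint : ∫⁻ x, χ x = volume B := by
    simp only [χ]; rw [lintegral_indicator_one hBm]
  have hseg : ∀ x y, ‖f x - f y‖ₑ ≤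
      ∫⁻ s in Icc (0 : ℝ) 1, ‖fderiv ℝ f ((1 - s) • x + s • y)‖ₑ * ‖y - x‖ₑ := by
    intro x y
    have hline : ∀ s : ℝ, HasDerivAt (fun s : ℝ => (1 - s) • x + s • y) (y - x) s := fun s => by
      have h1 := ((hasDerivAt_id s).const_sub 1).smul_const x
      have h2 := (hasDerivAt_id s).smul_const y
      have := h1.add h2
      simp only [neg_smul, one_smul] at this
      rw [neg_add_eq_sub] at this
      exact this
    have hder : ∀ s ∈ uIcc (0 : ℝ) 1, HasDerivAt (fun s : ℝ => f ((1 - s) • x + s • y))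
        (fderiv ℝ f ((1 - s) • x + s • y) (y - x)) s := fun s _ =>
      ((hf.differentiable one_ne_zero) _).hasFDerivAt.comp_hasDerivAt s (hline s)
    have hcont : Continuous fun s : ℝ => fderiv ℝ f ((1 - s) • x + s • y) (y - x) := by
      fun_prop
    have := intervalIntegral.integral_eq_sub_of_hasDerivAt hder (hcont.intervalIntegrable _ _)
    simp only [sub_self, zero_smul, one_smul, zero_add, sub_zero, add_zero] at this
    rw [← enorm_neg, neg_sub, ← this, intervalIntegral.integral_of_le zero_le_one]
    refine (enorm_integral_le_lintegral_enorm _).trans ?_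
    rw [restrict_Ioc_eq_restrict_Icc]
    refine lintegral_mono fun s => ?_
    exact ContinuousLinearMap.le_opENorm _ _
  -- The product of weights is traded for the weight at the intermediate point. The indicators of
  -- the ball are kept so that the variable not used in the change of variables integrates to a
  -- finite volume.
  have hpt : ∀ x y, ‖f x - f y‖ₑ * (ψ x * ψ y) ≤ ENNReal.ofReal (2 * r) *
      ∫⁻ s in Icc (0 : ℝ) 1, χ x * χ y * h ((1 - s) • x + s • y) := by
    intro x y
    by_cases hxy : ψ x * ψ y = 0
    · rw [hxy, mul_zero]; exact zero_le
    obtain ⟨hx, hy⟩ := mul_ne_zero_iff.1 hxy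
    rw [hχ0 x hx, hχ0 y hy, one_mul]
    have hxr : ‖x‖ < r := by by_contra hc; exact hx (hψ0 x (not_lt.1 hc))
    have hyr : ‖y‖ < r := by by_contra hc; exact hy (hψ0 y (not_lt.1 hc))
    have hd : ‖y - x‖ₑ ≤ ENNReal.ofReal (2 * r) := by
      rw [← ofReal_norm]
      exact ENNReal.ofReal_le_ofReal ((norm_sub_le _ _).trans (by linarith))
    calc ‖f x - f y‖ₑ * (ψ x * ψ y)
        ≤ (∫⁻ s in Icc (0 : ℝ) 1, ‖fderiv ℝ f ((1 - s) • x + s • y)‖ₑ * ‖y - x‖ₑ) * (ψ x * ψ y) := by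
          gcongr; exact hseg x y
      _ = ∫⁻ s in Icc (0 : ℝ) 1,
            ‖fderiv ℝ f ((1 - s) • x + s • y)‖ₑ * ‖y - x‖ₑ * (ψ x * ψ y) := by
          refine (lintegral_mul_const _ ?_).symm
          exact (Continuous.measurable (by fun_prop : Continuous fun s : ℝ =>
            fderiv ℝ f ((1 - s) • x + s • y))).enorm.mul_const _
      _ ≤ ∫⁻ s in Icc (0 : ℝ) 1, ENNReal.ofReal (2 * r) * (1 * h ((1 - s) • x + s • y)) := by
          refine setLIntegral_mono' measurableSet_Icc fun s hs => ?_
          rw [one_mul, mul_comm (‖_‖ₑ) (‖y - x‖ₑ), mul_assoc]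
          refine mul_le_mul' hd ?_
          rw [mul_comm]
          exact mul_le_mul_left (hψ x y s hs) _
      _ = _ := by
          rw [lintegral_const_mul' _ _ ENNReal.ofReal_ne_top]
  have hmeas3 : Measurable fun q : (EuclideanSpace ℝ (Fin n) × EuclideanSpace ℝ (Fin n)) × ℝ =>
      χ q.1.1 * χ q.1.2 * h ((1 - q.2) • q.1.1 + q.2 • q.1.2) := by
    refine ((hχm.comp (measurable_fst.comp measurable_fst)).mul
      (hχm.comp (measurable_snd.comp measurable_fst))).mul (hhm.comp ?_)
    exact Continuous.measurable (by fun_prop)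
  have hs : ∀ s ∈ Icc (0 : ℝ) 1, ∫⁻ x, ∫⁻ y, χ x * χ y * h ((1 - s) • x + s • y)
      ≤ 2 ^ n * volume B * ∫⁻ x, h x := by
    intro s hs
    -- One of `s`, `1 - s` is at least 1/2, so the intermediate point is a dilation by at least 1/2
    -- in one of `x`, `y`; integrating in that variable first costs at most `2 ^ n`.
    rcases le_total (1 / 2) s with h2 | h2
    · calc _ ≤ ∫⁻ x, χ x * (2 ^ n * ∫⁻ z, h z) := by
            refine lintegral_mono fun x => ?_
            calc _ ≤ ∫⁻ y, χ x * h ((1 - s) • x + s • y) := by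
                  refine lintegral_mono fun y => ?_
                  gcongr
                  exact mul_le_of_le_one_right' (hχ1 y)
              _ = χ x * ∫⁻ y, h ((1 - s) • x + s • y) := by
                  rw [lintegral_const_mul]
                  exact hhm.comp (Continuous.measurable (by fun_prop))
              _ ≤ _ := by gcongr; exact lintegral_comp_segment_le hhm _ h2
        _ = _ := by rw [lintegral_mul_const _ hχm, hχint]; ring
    · rw [lintegral_lintegral_swap]
      · calc _ ≤ ∫⁻ y, χ y * (2 ^ n * ∫⁻ z, h z) := by
              refine lintegral_mono fun y => ?_
              calc _ ≤ ∫⁻ x, χ y * h (s • y + (1 - s) • x) := by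
                    refine lintegral_mono fun x => ?_
                    rw [add_comm (s • y)]
                    gcongr
                    exact mul_le_of_le_one_left' (hχ1 x)
                _ = χ y * ∫⁻ x, h (s • y + (1 - s) • x) := by
                    rw [lintegral_const_mul]
                    exact hhm.comp (Continuous.measurable (by fun_prop))
                _ ≤ _ := by gcongr; exact lintegral_comp_segment_le hhm _ (by linarith)
          _ = _ := by rw [lintegral_mul_const _ hχm, hχint]; ring
      · exact (hmeas3.comp (measurable_id.prodMk measurable_const)).aemeasurable
  calc ∫⁻ x, ∫⁻ y, ‖f x - f y‖ₑ * (ψ x * ψ y)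
      ≤ ∫⁻ x, ∫⁻ y, ENNReal.ofReal (2 * r) *
          ∫⁻ s in Icc (0 : ℝ) 1, χ x * χ y * h ((1 - s) • x + s • y) :=
        lintegral_mono fun x => lintegral_mono fun y => hpt x y
    _ = ENNReal.ofReal (2 * r) * ∫⁻ x, ∫⁻ y, ∫⁻ s in Icc (0 : ℝ) 1,
          χ x * χ y * h ((1 - s) • x + s • y) := by
        rw [← lintegral_const_mul' _ _ ENNReal.ofReal_ne_top]
        refine lintegral_congr fun x => ?_
        rw [← lintegral_const_mul' _ _ ENNReal.ofReal_ne_top]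
    _ = ENNReal.ofReal (2 * r) * ∫⁻ s in Icc (0 : ℝ) 1, ∫⁻ x, ∫⁻ y,
          χ x * χ y * h ((1 - s) • x + s • y) := by
        congr 1
        rw [lintegral_lintegral (f := fun x y => ∫⁻ s in Icc (0 : ℝ) 1,
          χ x * χ y * h ((1 - s) • x + s • y)) (Measurable.lintegral_prod_right'
            hmeas3).aemeasurable, lintegral_lintegral_swap hmeas3.aemeasurable]
        refine lintegral_congr fun s => ?_
        exact lintegral_prod (fun x : EuclideanSpace ℝ (Fin n) × EuclideanSpace ℝ (Fin n) =>
          χ x.1 * χ x.2 * h ((1 - s) • x.1 + s • x.2))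
          (hmeas3.comp (measurable_id.prodMk measurable_const)).aemeasurable
    _ ≤ ENNReal.ofReal (2 * r) * ∫⁻ s in Icc (0 : ℝ) 1, 2 ^ n * volume B * ∫⁻ x, h x := by
        gcongr 1
        exact setLIntegral_mono' measurableSet_Icc hs
    _ = _ := by
        rw [setLIntegral_const]; simp; ring

/-- Weighted Poincaré inequality in a ball for Lipschitz functions. -/
theorem poincare_of_lipschitz {n : ℕ} {r : ℝ} {ψ : EuclideanSpace ℝ (Fin n) → ℝ≥0∞}
    (hψm : Measurable ψ) (hψ0 : ∀ x, r ≤ ‖x‖ → ψ x = 0) (hψ1 : ∀ x, ψ x ≤ 1)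
    (hψ : ∀ x y, ∀ s ∈ Icc (0 : ℝ) 1, ψ x * ψ y ≤ ψ ((1 - s) • x + s • y))
    {K : ℝ≥0} {f : EuclideanSpace ℝ (Fin n) → ℝ} (hf : LipschitzWith K f) :
    ∫⁻ x, ∫⁻ y, ‖f x - f y‖ₑ * (ψ x * ψ y) ≤
      ENNReal.ofReal (2 * r) * (2 ^ n * volume (Metric.ball (0 : EuclideanSpace ℝ (Fin n)) r))
        * ∫⁻ x, ψ x * ‖fderiv ℝ f x‖ₑ := by
  obtain ⟨g, hg1, hg2, hg3, hg4, -, -⟩ := exists_smooth_approx volume hf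
  have hψtop : ∀ x, ψ x ≠ ∞ := fun x => ne_top_of_le_ne_top ENNReal.one_ne_top (hψ1 x)
  have hd : Tendsto (fun k => ∫⁻ x, ψ x * ‖fderiv ℝ (g k) x‖ₑ) atTop
      (𝓝 (∫⁻ x, ψ x * ‖fderiv ℝ f x‖ₑ)) := by
    refine tendsto_lintegral_of_dominated_convergence
      ((Metric.ball (0 : EuclideanSpace ℝ (Fin n)) r).indicator fun _ => (K : ℝ≥0∞))
      (fun k => hψm.mul (measurable_fderiv ℝ (g k)).enorm) ?_ ?_ ?_
    · refine fun k => Eventually.of_forall fun x => ?_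
      by_cases hx : ‖x‖ < r
      · rw [indicator_of_mem (by simpa using hx)]
        refine (mul_le_of_le_one_left' (hψ1 x)).trans ?_
        have := norm_fderiv_le_of_lipschitz ℝ (hg2 k) (x₀ := x)
        rw [enorm_eq_nnnorm]
        exact_mod_cast this
      · beta_reduce
        rw [hψ0 x (not_lt.1 hx), zero_mul]; exact zero_le
    · rw [lintegral_indicator Metric.isOpen_ball.measurableSet, setLIntegral_const]
      exact ENNReal.mul_ne_top ENNReal.coe_ne_top Metric.isBounded_ball.measure_lt_top.ne
    · filter_upwards [hg4] with x hx
      exact ENNReal.Tendsto.const_mul ((continuous_enorm.tendsto _).comp hx) (Or.inr (hψtop x))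
  have hmf : ∀ f : EuclideanSpace ℝ (Fin n) → ℝ, Continuous f → Measurable fun q :
      EuclideanSpace ℝ (Fin n) × EuclideanSpace ℝ (Fin n) =>
        ‖f q.1 - f q.2‖ₑ * (ψ q.1 * ψ q.2) := fun f hf =>
    (Continuous.measurable (by fun_prop : Continuous fun q :
      EuclideanSpace ℝ (Fin n) × EuclideanSpace ℝ (Fin n) => f q.1 - f q.2)).enorm.mul
      ((hψm.comp measurable_fst).mul (hψm.comp measurable_snd))
  rw [lintegral_lintegral (hmf f hf.continuous).aemeasurable]
  have h1 : ∫⁻ q : EuclideanSpace ℝ (Fin n) × EuclideanSpace ℝ (Fin n),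
      ‖f q.1 - f q.2‖ₑ * (ψ q.1 * ψ q.2) ∂(volume.prod volume) ≤
      liminf (fun k => ∫⁻ q : EuclideanSpace ℝ (Fin n) × EuclideanSpace ℝ (Fin n),
        ‖g k q.1 - g k q.2‖ₑ * (ψ q.1 * ψ q.2) ∂(volume.prod volume)) atTop := by
    refine le_trans (le_of_eq ?_) (lintegral_liminf_le fun k => hmf _ (hg1 k).continuous)
    refine lintegral_congr fun q => ?_
    refine (Tendsto.liminf_eq ?_).symm
    refine ENNReal.Tendsto.mul_const ?_ (Or.inr (ENNReal.mul_ne_top (hψtop _) (hψtop _)))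
    exact (continuous_enorm.tendsto _).comp ((hg3 _).sub (hg3 _))
  have hC : ENNReal.ofReal (2 * r) * (2 ^ n * volume (Metric.ball
      (0 : EuclideanSpace ℝ (Fin n)) r)) ≠ ∞ :=
    ENNReal.mul_ne_top ENNReal.ofReal_ne_top (ENNReal.mul_ne_top (by simp)
      Metric.isBounded_ball.measure_lt_top.ne)
  refine h1.trans (le_trans (liminf_le_liminf (Eventually.of_forall fun k => ?_))
    (ENNReal.Tendsto.const_mul hd (Or.inr hC)).liminf_eq.le)
  rw [lintegral_prod _ (hmf _ (hg1 k).continuous).aemeasurable]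
  exact poincare_of_contDiff hψm hψ0 hψ ((hg1 k).of_le (by exact_mod_cast le_top))

/-! ### Bounded Lipschitz functions, space gradients and Lipschitz test functions for the
divergence. -/

/-- Bounded Lipschitz functions. -/
def BddLip {E : Type*} [PseudoMetricSpace E] (f : E → ℝ) : Prop :=
  (∃ K : ℝ≥0, LipschitzWith K f) ∧ ∃ C : ℝ, ∀ x, |f x| ≤ C

theorem BddLip.mul {E : Type*} [PseudoMetricSpace E] {f g : E → ℝ} (hf : BddLip f)
    (hg : BddLip g) : BddLip fun x => f x * g x := by
  obtain ⟨⟨K, hK⟩, C, hC⟩ := hf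
  obtain ⟨⟨L, hL⟩, D, hD⟩ := hg
  refine ⟨⟨C.toNNReal * L + D.toNNReal * K, LipschitzWith.of_dist_le_mul fun x y => ?_⟩, C * D,
    fun x => ?_⟩
  · have h1 := hK.dist_le_mul x y
    have h2 := hL.dist_le_mul x y
    have hC0 : 0 ≤ C := (abs_nonneg _).trans (hC x)
    have hD0 : 0 ≤ D := (abs_nonneg _).trans (hD x)
    rw [Real.dist_eq] at *
    push_cast
    rw [Real.coe_toNNReal _ hC0, Real.coe_toNNReal _ hD0]
    have e : f x * g x - f y * g y = f x * (g x - g y) + g y * (f x - f y) := by ring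
    rw [e]
    refine (abs_add_le _ _).trans ?_
    rw [abs_mul, abs_mul]
    have := mul_le_mul (hC x) h2 (abs_nonneg _) hC0
    have := mul_le_mul (hD y) h1 (abs_nonneg _) hD0
    nlinarith
  · rw [abs_mul]
    exact mul_le_mul (hC x) (hD x) (abs_nonneg _) ((abs_nonneg _).trans (hC x))

theorem BddLip.continuous {E : Type*} [PseudoMetricSpace E] {f : E → ℝ} (hf : BddLip f) :
    Continuous f := hf.1.choose_spec.continuous

theorem BddLip.comp {E F : Type*} [PseudoMetricSpace E] [PseudoMetricSpace F] {f : E → ℝ}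
    (hf : BddLip f) {g : F → E} {K : ℝ≥0} (hg : LipschitzWith K g) : BddLip fun x => f (g x) := by
  obtain ⟨⟨L, hL⟩, C, hC⟩ := hf
  exact ⟨⟨_, hL.comp hg⟩, C, fun x => hC _⟩

variable {n : ℕ}

instance : (volume : Measure (SpaceTime n)).IsAddHaarMeasure :=
  inferInstanceAs ((volume : Measure (EuclideanSpace ℝ (Fin n))).prod
    (volume : Measure ℝ)).IsAddHaarMeasure

/-- The space gradient. -/
noncomputable def sgrad (u : SpaceTime n → ℝ) (p : SpaceTime n) : EuclideanSpace ℝ (Fin n) :=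
  WithLp.toLp 2 fun i => spaceDeriv i u p

theorem sgrad_apply (u : SpaceTime n → ℝ) (p : SpaceTime n) (i : Fin n) :
    sgrad u p i = spaceDeriv i u p := rfl

theorem inner_sgrad (u : SpaceTime n → ℝ) (p : SpaceTime n) (x : EuclideanSpace ℝ (Fin n)) :
    ∑ i, x i * spaceDeriv i u p = fderiv ℝ u p (x, 0) := by
  have hx : x = ∑ i, x i • EuclideanSpace.single i (1 : ℝ) := by
    ext j; simp [Finset.sum_apply, Pi.single_apply]
  have : ((x, 0) : SpaceTime n) = ∑ i, x i • ((EuclideanSpace.single i (1 : ℝ), (0 : ℝ)) :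
      SpaceTime n) := by
    refine Prod.ext ?_ ?_
    · rw [Prod.fst_sum]; simpa using hx
    · rw [Prod.snd_sum]; simp
  rw [this, map_sum]
  refine Finset.sum_congr rfl fun i _ => ?_
  rw [map_smul, smul_eq_mul]; rfl

/-- The derivative is applied to the vector `(sgrad u p, 0)`, whose norm in the product is that of
the space gradient itself. -/
theorem norm_sgrad_le (u : SpaceTime n → ℝ) (p : SpaceTime n) : ‖sgrad u p‖ ≤ ‖fderiv ℝ u p‖ := by
  have h1 : ‖sgrad u p‖ ^ 2 = fderiv ℝ u p (sgrad u p, 0) := by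
    rw [← inner_sgrad, EuclideanSpace.real_norm_sq_eq]
    exact Finset.sum_congr rfl fun i _ => by rw [sgrad_apply]; ring
  have h2 : fderiv ℝ u p (sgrad u p, 0) ≤ ‖fderiv ℝ u p‖ * ‖sgrad u p‖ := by
    refine (Real.le_norm_self _).trans ((ContinuousLinearMap.le_opNorm _ _).trans (le_of_eq ?_))
    rw [Prod.norm_mk, norm_zero, max_eq_left (norm_nonneg _)]
  rcases (norm_nonneg (sgrad u p)).eq_or_lt with h | h
  · rw [← h]; exact norm_nonneg _
  · nlinarith

theorem abs_timeDeriv_le (u : SpaceTime n → ℝ) (p : SpaceTime n) :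
    |timeDeriv u p| ≤ ‖fderiv ℝ u p‖ := by
  refine (ContinuousLinearMap.le_opNorm (fderiv ℝ u p) (0, 1)).trans (le_of_eq ?_)
  rw [Prod.norm_mk, norm_zero, norm_one, max_eq_right zero_le_one, mul_one]

theorem abs_sum_mul_le (x y : EuclideanSpace ℝ (Fin n)) : |∑ i, x i * y i| ≤ ‖x‖ * ‖y‖ := by
  have := abs_real_inner_le_norm y x
  rw [mul_comm]
  simpa [PiLp.inner_apply] using this

theorem abs_apply_le (x : EuclideanSpace ℝ (Fin n)) (i : Fin n) : |x i| ≤ ‖x‖ :=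
  PiLp.norm_apply_le x i

theorem measurable_sgrad (u : SpaceTime n → ℝ) : Measurable (sgrad u) := by
  have : Measurable fun p => (fun i => spaceDeriv i u p) :=
    measurable_pi_lambda _ fun i => (measurable_fderiv_apply_const ℝ u _)
  exact (MeasurableEquiv.toLp 2 (Fin n → ℝ)).measurable.comp this

theorem measurable_spaceDeriv (i : Fin n) (u : SpaceTime n → ℝ) : Measurable (spaceDeriv i u) :=
  measurable_fderiv_apply_const ℝ u _

theorem measurable_timeDeriv (u : SpaceTime n → ℝ) : Measurable (timeDeriv u) :=
  measurable_fderiv_apply_const ℝ u _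

/-- `div b ≤ 0` may be tested with nonnegative Lipschitz functions. -/
theorem DivNonpos.lipschitz {Q U : Set (SpaceTime n)} {b : SpaceTime n → EuclideanSpace ℝ (Fin n)}
    (hdiv : DivNonpos Q b) (hU : IsOpen U) (hUQ : U ⊆ Q) (hQ : MeasurableSet Q)
    (hb : IntegrableOn b U) {K : ℝ≥0} {φ : SpaceTime n → ℝ} (hφ : LipschitzWith K φ)
    (hφc : HasCompactSupport φ) (hφU : tsupport φ ⊆ U) (hφ0 : ∀ p, 0 ≤ φ p) :
    0 ≤ ∫ p in U, ∑ i, b p i * spaceDeriv i φ p := by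
  obtain ⟨g, hg1, hg2, hg3, hg4, hg5, hg6⟩ := exists_smooth_approx (volume : Measure (SpaceTime n)) hφ
  -- Mollifications at scales below `δ` stay supported in `U`, where `b` is integrable, so dominated
  -- convergence applies with a multiple of `‖b‖`.
  obtain ⟨δ, hδ, hδU⟩ := hφc.exists_cthickening_subset_open hU hφU
  set S := Metric.cthickening δ (tsupport φ) with hS
  have hSc : IsCompact S := IsCompact.cthickening hφc
  obtain ⟨k0, hk0⟩ := exists_nat_one_div_lt hδ
  have hg0 : ∀ k ≥ k0, ∀ x, x ∉ S → g k x = 0 := by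
    intro k hk x hx
    refine hg5 k x fun y hy => ?_
    by_contra hne
    refine hx (Metric.mem_cthickening_of_dist_le x y δ _ (subset_tsupport φ hne) ?_)
    rw [Metric.mem_closedBall, dist_comm] at hy
    refine hy.trans (le_trans ?_ hk0.le)
    have : (k0 : ℝ) ≤ k := by exact_mod_cast hk
    exact one_div_le_one_div_of_le (by positivity) (by linarith)
  have hts : ∀ k ≥ k0, tsupport (g k) ⊆ S := fun k hk =>
    closure_minimal (fun x hx => by by_contra h; exact hx (hg0 k hk x h)) hSc.isClosed
  have hpos : ∀ k ≥ k0, 0 ≤ ∫ p in U, ∑ i, b p i * spaceDeriv i (g k) p := by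
    intro k hk
    have h := hdiv (g k) (hg1 k) (HasCompactSupport.intro hSc (hg0 k hk))
      ((hts k hk).trans (hδU.trans hUQ)) (hg6 hφ0 k)
    rwa [setIntegral_eq_of_subset_of_forall_sdiff_eq_zero hQ hUQ] at h
    intro p hp
    have : fderiv ℝ (g k) p = 0 := by
      by_contra h
      exact hp.2 (hδU (hts k hk (support_fderiv_subset ℝ h)))
    simp [spaceDeriv, this]
  have hlim : Tendsto (fun k => ∫ p in U, ∑ i, b p i * spaceDeriv i (g k) p) atTop
      (𝓝 (∫ p in U, ∑ i, b p i * spaceDeriv i φ p)) := by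
    refine tendsto_integral_of_dominated_convergence (fun p => ‖b p‖ * K) (fun k => ?_)
      (hb.norm.mul_const _) (fun k => Eventually.of_forall fun p => ?_) ?_
    · refine Finset.aestronglyMeasurable_fun_sum _ fun i _ => ?_
      refine AEStronglyMeasurable.mul ?_ (measurable_spaceDeriv i (g k)).aestronglyMeasurable
      exact (EuclideanSpace.proj (𝕜 := ℝ) i).continuous.comp_aestronglyMeasurable hb.1
    · refine (abs_sum_mul_le (b p) (sgrad (g k) p)).trans ?_
      refine mul_le_mul_of_nonneg_left ?_ (norm_nonneg _)
      exact (norm_sgrad_le _ _).trans (norm_fderiv_le_of_lipschitz ℝ (hg2 k))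
    · filter_upwards [ae_restrict_of_ae hg4] with p hp
      refine tendsto_finsetSum _ fun i _ => Tendsto.const_mul _ ?_
      exact ((ContinuousLinearMap.apply ℝ ℝ
        ((EuclideanSpace.single i 1, 0) : SpaceTime n)).continuous.tendsto _).comp hp
  exact ge_of_tendsto hlim (eventually_atTop.2 ⟨k0, hpos⟩)

/-- Essentially bounded measurable real functions. -/
def BddMeas {X : Type*} [MeasurableSpace X] (μ : Measure X) (f : X → ℝ) : Prop :=
  AEStronglyMeasurable f μ ∧ ∃ C : ℝ, ∀ᵐ x ∂μ, ‖f x‖ ≤ C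

namespace BddMeas

variable {X : Type*} [MeasurableSpace X] {μ : Measure X} {f g : X → ℝ}

theorem mul (hf : BddMeas μ f) (hg : BddMeas μ g) : BddMeas μ fun x => f x * g x := by
  obtain ⟨h1, C, hC⟩ := hf
  obtain ⟨h2, D, hD⟩ := hg
  refine ⟨h1.mul h2, C * D, ?_⟩
  filter_upwards [hC, hD] with x hx hy
  rw [norm_mul]
  exact mul_le_mul hx hy (norm_nonneg _) ((norm_nonneg _).trans hx)

theorem add (hf : BddMeas μ f) (hg : BddMeas μ g) : BddMeas μ fun x => f x + g x := by
  obtain ⟨h1, C, hC⟩ := hf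
  obtain ⟨h2, D, hD⟩ := hg
  refine ⟨h1.add h2, C + D, ?_⟩
  filter_upwards [hC, hD] with x hx hy
  exact (norm_add_le _ _).trans (add_le_add hx hy)

theorem sub (hf : BddMeas μ f) (hg : BddMeas μ g) : BddMeas μ fun x => f x - g x := by
  obtain ⟨h1, C, hC⟩ := hf
  obtain ⟨h2, D, hD⟩ := hg
  refine ⟨h1.sub h2, C + D, ?_⟩
  filter_upwards [hC, hD] with x hx hy
  exact (norm_sub_le _ _).trans (add_le_add hx hy)

theorem sum {ι : Type*} {s : Finset ι} {F : ι → X → ℝ} (h : ∀ i, BddMeas μ (F i)) :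
    BddMeas μ fun x => ∑ i ∈ s, F i x := by
  classical
  induction s using Finset.induction_on with
  | empty => exact ⟨by simpa using aestronglyMeasurable_const, 0, by simp⟩
  | insert i s his ih => simpa [Finset.sum_insert his] using (h i).add ih

theorem integrable [IsFiniteMeasure μ] (hf : BddMeas μ f) : Integrable f μ :=
  Integrable.of_bound hf.1 hf.2.choose hf.2.choose_spec

theorem integrable_mul (hf : Integrable f μ) (hg : BddMeas μ g) :
    Integrable (fun x => f x * g x) μ :=
  hf.mul_bdd hg.1 hg.2.choose_spec

theorem integrable_sum_mul {b : X → EuclideanSpace ℝ (Fin n)} (hb : Integrable b μ)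
    {F : Fin n → X → ℝ} (h : ∀ i, BddMeas μ (F i)) :
    Integrable (fun x => ∑ i, b x i * F i x) μ :=
  integrable_finsetSum _ fun i _ => integrable_mul
    ((EuclideanSpace.proj (𝕜 := ℝ) i).integrable_comp hb) (h i)

end BddMeas

theorem BddLip.bddMeas {E : Type*} [PseudoMetricSpace E] [MeasurableSpace E]
    [BorelSpace E] {μ : Measure E} {f : E → ℝ} (hf : BddLip f) : BddMeas μ f :=
  ⟨hf.continuous.measurable.aestronglyMeasurable, hf.2.choose, Eventually.of_forall hf.2.choose_spec⟩

theorem bddMeas_spaceDeriv {μ : Measure (SpaceTime n)} {u : SpaceTime n → ℝ} {K : ℝ≥0}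
    (hu : LipschitzWith K u) (i : Fin n) : BddMeas μ (spaceDeriv i u) :=
  ⟨(measurable_spaceDeriv i u).aestronglyMeasurable, K, Eventually.of_forall fun p =>
    (abs_apply_le (sgrad u p) i).trans ((norm_sgrad_le u p).trans (norm_fderiv_le_of_lipschitz ℝ hu))⟩

theorem bddMeas_timeDeriv {μ : Measure (SpaceTime n)} {u : SpaceTime n → ℝ} {K : ℝ≥0}
    (hu : LipschitzWith K u) : BddMeas μ (timeDeriv u) :=
  ⟨(measurable_timeDeriv u).aestronglyMeasurable, K, Eventually.of_forall fun p =>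
    (abs_timeDeriv_le u p).trans (norm_fderiv_le_of_lipschitz ℝ hu)⟩

/-! ### Local solutions and the energy inequality. -/

/-- The cylinder in which a local solution is considered. -/
def cyl (n : ℕ) (r τ : ℝ) : Set (SpaceTime n) := Metric.ball 0 r ×ˢ Ioo (-4) τ

/-- A globally Lipschitz function that solves the equation in a bounded cylinder. -/
structure LocalSol (ν Ca r τ : ℝ) (a : SpaceTime n → Matrix (Fin n) (Fin n) ℝ)
    (b : SpaceTime n → EuclideanSpace ℝ (Fin n)) (u : SpaceTime n → ℝ) : Prop where
  meas : ∀ i j, AEMeasurable (fun p => a p i j) (volume.restrict (cyl n r τ))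
  bdd : ∀ᵐ p ∂(volume.restrict (cyl n r τ)), ∀ i j, |a p i j| ≤ Ca
  ell : ∀ᵐ p ∂(volume.restrict (cyl n r τ)), ∀ ξ : EuclideanSpace ℝ (Fin n),
    ν * ‖ξ‖ ^ 2 ≤ ∑ i, ∑ j, a p i j * ξ i * ξ j
  int : IntegrableOn b (cyl n r τ)
  div : ∀ φ : SpaceTime n → ℝ, (∃ K, LipschitzWith K φ) → HasCompactSupport φ →
    tsupport φ ⊆ cyl n r τ → (∀ p, 0 ≤ φ p) →
    0 ≤ ∫ p in cyl n r τ, ∑ i, b p i * spaceDeriv i φ p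
  lip : ∃ K, LipschitzWith K u
  eqn : ∀ η : SpaceTime n → ℝ, (∃ K, LipschitzWith K η) → HasCompactSupport η →
    tsupport η ⊆ cyl n r τ →
      ∫ p in cyl n r τ, (timeDeriv u p * η p
        + ∑ i, ∑ j, a p i j * spaceDeriv j u p * spaceDeriv i η p
        + ∑ i, b p i * spaceDeriv i u p * η p) = 0

theorem isOpen_cyl (r τ : ℝ) : IsOpen (cyl n r τ) := Metric.isOpen_ball.prod isOpen_Ioo

theorem volume_cyl_lt_top (r τ : ℝ) : volume (cyl n r τ) < ∞ :=
  (Metric.isBounded_ball.prod (Metric.isBounded_Ioo _ _)).measure_lt_top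

/-- The defect density in the energy inequality. -/
noncomputable def energyDensity (a : SpaceTime n → Matrix (Fin n) (Fin n) ℝ)
    (b : SpaceTime n → EuclideanSpace ℝ (Fin n)) (u F g : SpaceTime n → ℝ) (p : SpaceTime n) : ℝ :=
  ∑ i, ∑ j, a p i j * spaceDeriv j u p * spaceDeriv i g p
    - (timeDeriv F p - timeDeriv u p * g p)
    - ∑ i, b p i * (spaceDeriv i F p - spaceDeriv i u p * g p)

theorem fderiv_mul_time {f : SpaceTime n → ℝ} {χ : ℝ → ℝ} {p : SpaceTime n}
    (hf : DifferentiableAt ℝ f p) (hχ : DifferentiableAt ℝ χ p.2) (v : SpaceTime n) :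
    fderiv ℝ (fun p : SpaceTime n => f p * χ p.2) p v
      = fderiv ℝ f p v * χ p.2 + f p * (deriv χ p.2 * v.2) := by
  have h1 : HasFDerivAt (fun p : SpaceTime n => χ p.2)
      ((deriv χ p.2) • (ContinuousLinearMap.snd ℝ (EuclideanSpace ℝ (Fin n)) ℝ)) p := by
    have := hχ.hasDerivAt.comp_hasFDerivAt p
      (hasFDerivAt_snd (𝕜 := ℝ) (E := EuclideanSpace ℝ (Fin n)) (F := ℝ) (p := p))
    exact this
  have h2 : fderiv ℝ (fun p : SpaceTime n => f p * χ p.2) p = _ :=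
    HasFDerivAt.fderiv (hf.hasFDerivAt.mul h1)
  rw [h2]
  simp
  ring

/-- Integration by parts against the constant 1; the direction `(0, -1)` is reversed by the formula
and becomes the time direction. -/
theorem integral_timeDeriv_eq_zero {F : SpaceTime n → ℝ} {K : ℝ≥0} (hF : LipschitzWith K F)
    (hFc : HasCompactSupport F) : ∫ p, timeDeriv F p = 0 := by
  have h := LipschitzWith.integral_lineDeriv_mul_eq (μ := (volume : Measure (SpaceTime n)))
    (LipschitzWith.const (α := SpaceTime n) (1 : ℝ)) hF hFc ((0, -1) : SpaceTime n)
  have h1 : ∀ p : SpaceTime n, lineDeriv ℝ (fun _ : SpaceTime n => (1 : ℝ)) p (0, -1) = 0 := by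
    intro p; simp [lineDeriv]
  simp only [h1, zero_mul, integral_zero, mul_one] at h
  rw [h]
  refine integral_congr_ae ?_
  filter_upwards [hF.ae_differentiableAt] with p hp
  rw [hp.lineDeriv_eq_fderiv]
  simp [timeDeriv]

theorem integral_sub_sub {X : Type*} [MeasurableSpace X] {μ : Measure X} {f g h : X → ℝ}
    (hf : Integrable f μ) (hg : Integrable g μ) (hh : Integrable h μ) :
    ∫ x, (f x - g x - h x) ∂μ = ∫ x, f x ∂μ - ∫ x, g x ∂μ - ∫ x, h x ∂μ := by
  have := integral_sub (hf.sub hg) hh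
  simp only [Pi.sub_apply] at this
  rw [this, integral_sub hf hg]

namespace LocalSol

variable {ν Ca r τ : ℝ} {a : SpaceTime n → Matrix (Fin n) (Fin n) ℝ}
  {b : SpaceTime n → EuclideanSpace ℝ (Fin n)} {u : SpaceTime n → ℝ}

theorem bddMeas_form (h : LocalSol ν Ca r τ a b u) {g : SpaceTime n → ℝ} {K : ℝ≥0}
    (hg : LipschitzWith K g) : BddMeas (volume.restrict (cyl n r τ))
      fun p => ∑ i, ∑ j, a p i j * spaceDeriv j u p * spaceDeriv i g p := by
  obtain ⟨L, hL⟩ := h.lip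
  refine BddMeas.sum fun i => BddMeas.sum fun j =>
    (BddMeas.mul ⟨(h.meas i j).aestronglyMeasurable, Ca, ?_⟩ (bddMeas_spaceDeriv hL j)).mul
      (bddMeas_spaceDeriv hg i)
  filter_upwards [h.bdd] with p hp using hp i j

theorem integrable_energyDensity (h : LocalSol ν Ca r τ a b u) {F g : SpaceTime n → ℝ}
    (hF : BddLip F) (hg : BddLip g) : IntegrableOn (energyDensity a b u F g) (cyl n r τ) := by
  obtain ⟨L, hL⟩ := h.lip
  have : IsFiniteMeasure (volume.restrict (cyl n r τ)) := ⟨by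
    rw [Measure.restrict_apply_univ]; exact volume_cyl_lt_top r τ⟩
  obtain ⟨KF, hKF⟩ := hF.1
  obtain ⟨Kg, hKg⟩ := hg.1
  refine ((h.bddMeas_form hKg).integrable.sub ((bddMeas_timeDeriv hKF).sub
    ((bddMeas_timeDeriv hL).mul hg.bddMeas)).integrable).sub ?_
  exact BddMeas.integrable_sum_mul h.int fun i => (bddMeas_spaceDeriv hKF i).sub
    ((bddMeas_spaceDeriv hL i).mul hg.bddMeas)

/-- The energy inequality with a cutoff in time. -/
theorem energy_cutoff (h : LocalSol ν Ca r τ a b u) {F g : SpaceTime n → ℝ}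
    (hF : BddLip F) (hg : BddLip g) (hF0 : ∀ p, 0 ≤ F p) {ρ : ℝ} (hρ : ρ < r)
    (hFs : ∀ p, ρ ≤ ‖p.1‖ → F p = 0) (hgs : ∀ p, ρ ≤ ‖p.1‖ → g p = 0)
    {χ : ℝ → ℝ} (hχ : BddLip χ) (hχ0 : ∀ t, 0 ≤ χ t) {s₁ s₂ : ℝ} (hs₁ : -4 < s₁) (hs₂ : s₂ < τ)
    (hχs : ∀ t, t ∉ Icc s₁ s₂ → χ t = 0) :
    ∫ p in cyl n r τ, χ p.2 * energyDensity a b u F g p ≤ ∫ p in cyl n r τ, F p * deriv χ p.2 := by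
  obtain ⟨L, hL⟩ := h.lip
  have hfin : IsFiniteMeasure (volume.restrict (cyl n r τ)) := ⟨by
    rw [Measure.restrict_apply_univ]; exact volume_cyl_lt_top r τ⟩
  obtain ⟨KF, hKF⟩ := hF.1
  obtain ⟨Kg, hKg⟩ := hg.1
  obtain ⟨Kχ, hKχ⟩ := hχ.1
  have hχ2 : BddLip fun p : SpaceTime n => χ p.2 := hχ.comp LipschitzWith.prod_snd
  set S : Set (SpaceTime n) := Metric.closedBall 0 ρ ×ˢ Icc s₁ s₂ with hS
  have hSc : IsCompact S := (isCompact_closedBall _ _).prod isCompact_Icc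
  have hSU : S ⊆ cyl n r τ := prod_mono (Metric.closedBall_subset_ball hρ)
    (Icc_subset_Ioo hs₁ hs₂)
  have hprod : ∀ f : SpaceTime n → ℝ, (∀ p, ρ ≤ ‖p.1‖ → f p = 0) →
      ∀ p, p ∉ S → f p * χ p.2 = 0 := by
    intro f hf p hp
    by_cases h1 : ρ ≤ ‖p.1‖
    · rw [hf p h1, zero_mul]
    · have : p.2 ∉ Icc s₁ s₂ := fun h2 => hp ⟨by simpa using (not_le.1 h1).le, h2⟩
      rw [hχs _ this, mul_zero]
  have hcs : ∀ f : SpaceTime n → ℝ, (∀ p, ρ ≤ ‖p.1‖ → f p = 0) →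
      HasCompactSupport fun p => f p * χ p.2 := fun f hf =>
    HasCompactSupport.intro hSc (hprod f hf)
  have hts : ∀ f : SpaceTime n → ℝ, (∀ p, ρ ≤ ‖p.1‖ → f p = 0) →
      tsupport (fun p => f p * χ p.2) ⊆ cyl n r τ := fun f hf =>
    (closure_minimal (fun x hx => by by_contra h; exact hx (hprod f hf x h)) hSc.isClosed).trans hSU
  have hFχ := hF.mul hχ2
  have hgχ := hg.mul hχ2
  obtain ⟨KFχ, hKFχ⟩ := hFχ.1
  obtain ⟨Kgχ, hKgχ⟩ := hgχ.1
  -- The equation tested with `g χ`, the divergence condition tested with `F χ`, and the vanishing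
  -- integral of `∂_t (F χ)` combine to the claim. The intended pairs are `F = Φ(u) ψ`, `g = Φ'(u)
  -- ψ`: then `DF - g Du = Φ(u) Dψ`, so that no derivative of `u` multiplies `b`.
  have E1 := h.eqn _ hgχ.1 (hcs g hgs) (hts g hgs)
  have E2 := h.div _ hFχ.1 (hcs F hFs) (hts F hFs) fun p => mul_nonneg (hF0 p) (hχ0 _)
  have E3 : ∫ p in cyl n r τ, timeDeriv (fun p => F p * χ p.2) p = 0 := by
    rw [← integral_timeDeriv_eq_zero hKFχ (hcs F hFs)]
    refine setIntegral_eq_integral_of_forall_compl_eq_zero fun p hp => ?_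
    have : fderiv ℝ (fun p : SpaceTime n => F p * χ p.2) p = 0 := by
      by_contra h
      exact hp (hts F hFs (support_fderiv_subset ℝ h))
    simp [timeDeriv, this]
  have hχ' : BddMeas (volume.restrict (cyl n r τ)) fun p : SpaceTime n => deriv χ p.2 :=
    ⟨((measurable_deriv χ).comp measurable_snd).aestronglyMeasurable, Kχ,
      Eventually.of_forall fun p => norm_deriv_le_of_lipschitz hKχ⟩
  have I1 : IntegrableOn (fun p => timeDeriv u p * (g p * χ p.2)
      + ∑ i, ∑ j, a p i j * spaceDeriv j u p * spaceDeriv i (fun p => g p * χ p.2) p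
      + ∑ i, b p i * spaceDeriv i u p * (g p * χ p.2)) (cyl n r τ) := by
    refine (((bddMeas_timeDeriv hL).mul hgχ.bddMeas).integrable.add
      (h.bddMeas_form hKgχ).integrable).add ?_
    have := BddMeas.integrable_sum_mul h.int fun i => (bddMeas_spaceDeriv hL i).mul
      (hgχ.bddMeas (μ := volume.restrict (cyl n r τ)))
    simpa only [mul_assoc] using this
  have I2 : IntegrableOn (fun p => ∑ i, b p i * spaceDeriv i (fun p => F p * χ p.2) p)
      (cyl n r τ) := BddMeas.integrable_sum_mul h.int fun i => bddMeas_spaceDeriv hKFχ i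
  have I3 : IntegrableOn (timeDeriv (fun p => F p * χ p.2)) (cyl n r τ) :=
    (bddMeas_timeDeriv hKFχ).integrable
  have I4 : IntegrableOn (fun p => χ p.2 * energyDensity a b u F g p) (cyl n r τ) := by
    have := BddMeas.integrable_mul (h.integrable_energyDensity hF hg) hχ2.bddMeas
    change Integrable _ _
    simpa only [mul_comm] using this
  have I5 : IntegrableOn (fun p => F p * deriv χ p.2) (cyl n r τ) :=
    (hF.bddMeas.mul hχ').integrable
  have key : ∫ p in cyl n r τ, (χ p.2 * energyDensity a b u F g p - F p * deriv χ p.2)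
      = ∫ p in cyl n r τ, ((timeDeriv u p * (g p * χ p.2)
      + ∑ i, ∑ j, a p i j * spaceDeriv j u p * spaceDeriv i (fun p => g p * χ p.2) p
      + ∑ i, b p i * spaceDeriv i u p * (g p * χ p.2))
      - timeDeriv (fun p => F p * χ p.2) p
      - ∑ i, b p i * spaceDeriv i (fun p => F p * χ p.2) p) := by
    refine integral_congr_ae (ae_restrict_of_ae ?_)
    have hq : ∀ᵐ p : SpaceTime n, DifferentiableAt ℝ χ p.2 :=
      Measure.quasiMeasurePreserving_snd.ae hKχ.ae_differentiableAt
    filter_upwards [hKF.ae_differentiableAt, hKg.ae_differentiableAt, hq] with p h1 h2 h3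
    have e1 : ∀ i, spaceDeriv i (fun p => g p * χ p.2) p = spaceDeriv i g p * χ p.2 := fun i => by
      simp [spaceDeriv, fderiv_mul_time h2 h3]
    have e2 : ∀ i, spaceDeriv i (fun p => F p * χ p.2) p = spaceDeriv i F p * χ p.2 := fun i => by
      simp [spaceDeriv, fderiv_mul_time h1 h3]
    have e3 : timeDeriv (fun p => F p * χ p.2) p = timeDeriv F p * χ p.2 + F p * deriv χ p.2 := by
      simp [timeDeriv, fderiv_mul_time h1 h3]
    simp only [e1, e2, e3, energyDensity, mul_sub, Finset.mul_sum, Finset.sum_sub_distrib]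
    have e4 : ∑ i, ∑ j, χ p.2 * (a p i j * spaceDeriv j u p * spaceDeriv i g p)
        = ∑ i, ∑ j, a p i j * spaceDeriv j u p * (spaceDeriv i g p * χ p.2) :=
      Finset.sum_congr rfl fun i _ => Finset.sum_congr rfl fun j _ => by ring
    have e5 : ∑ i, χ p.2 * (b p i * spaceDeriv i F p) = ∑ i, b p i * (spaceDeriv i F p * χ p.2) :=
      Finset.sum_congr rfl fun i _ => by ring
    have e6 : ∑ i, χ p.2 * (b p i * (spaceDeriv i u p * g p))
        = ∑ i, b p i * spaceDeriv i u p * (g p * χ p.2) :=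
      Finset.sum_congr rfl fun i _ => by ring
    rw [e4, e5, e6]
    ring
  rw [integral_sub I4 I5, integral_sub_sub I1 I3 I2, E1, E3] at key
  linarith

end LocalSol

/-- The trapezoidal cutoff of `[t₁, t₂]` with slopes `±ε⁻¹`. -/
noncomputable def trapezoid (t₁ t₂ ε t : ℝ) : ℝ :=
  max 0 (min 1 (min ((t - t₁) * ε⁻¹) ((t₂ - t) * ε⁻¹)))

section trapezoid

variable {t₁ t₂ ε : ℝ}

theorem trapezoid_nonneg (t : ℝ) : 0 ≤ trapezoid t₁ t₂ ε t := le_max_left _ _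

theorem trapezoid_le_one (t : ℝ) : trapezoid t₁ t₂ ε t ≤ 1 :=
  max_le zero_le_one (min_le_left _ _)

theorem trapezoid_bddLip (hε : 0 < ε) : BddLip (trapezoid t₁ t₂ ε) := by
  refine ⟨⟨(ε⁻¹).toNNReal, ?_⟩, 1, fun t => ?_⟩
  · have h1 : LipschitzWith (ε⁻¹).toNNReal fun t : ℝ => (t - t₁) * ε⁻¹ := by
      refine LipschitzWith.of_dist_le_mul fun x y => ?_
      rw [Real.coe_toNNReal _ (inv_nonneg.2 hε.le), Real.dist_eq, Real.dist_eq, ← sub_mul, abs_mul,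
        abs_of_pos (inv_pos.2 hε), mul_comm, sub_sub_sub_cancel_right]
    have h2 : LipschitzWith (ε⁻¹).toNNReal fun t : ℝ => (t₂ - t) * ε⁻¹ := by
      refine LipschitzWith.of_dist_le_mul fun x y => ?_
      rw [Real.coe_toNNReal _ (inv_nonneg.2 hε.le), Real.dist_eq, Real.dist_eq, ← sub_mul, abs_mul,
        abs_of_pos (inv_pos.2 hε), mul_comm, sub_sub_sub_cancel_left, abs_sub_comm]
    have := ((h1.min h2).const_min 1).const_max 0
    rwa [max_self] at this
  · rw [abs_of_nonneg (trapezoid_nonneg t)]; exact trapezoid_le_one t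

theorem trapezoid_eq_zero (hε : 0 < ε) {t : ℝ} (ht : t ∉ Ioo t₁ t₂) : trapezoid t₁ t₂ ε t = 0 := by
  refine max_eq_left ((min_le_right _ _).trans ?_)
  by_cases h : t₁ < t
  · have : t₂ ≤ t := by by_contra h2; exact ht ⟨h, not_le.1 h2⟩
    exact (min_le_right _ _).trans (mul_nonpos_of_nonpos_of_nonneg (by linarith)
      (inv_nonneg.2 hε.le))
  · exact (min_le_left _ _).trans (mul_nonpos_of_nonpos_of_nonneg (by linarith)
      (inv_nonneg.2 hε.le))

theorem trapezoid_eq_one (hε : 0 < ε) {t : ℝ} (h₁ : t₁ + ε ≤ t) (h₂ : t ≤ t₂ - ε) :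
    trapezoid t₁ t₂ ε t = 1 := by
  have e1 : 1 ≤ (t - t₁) * ε⁻¹ := by
    rw [← div_eq_mul_inv, le_div_iff₀ hε]; linarith
  have e2 : 1 ≤ (t₂ - t) * ε⁻¹ := by
    rw [← div_eq_mul_inv, le_div_iff₀ hε]; linarith
  rw [trapezoid, min_eq_left (le_min e1 e2), max_eq_right zero_le_one]

/-- As `ε → 0` this derivative approximates the difference of the unit masses at `t₁` and `t₂`; the
slice integrals of the energy inequality come from it. The four excluded corners are a null set. -/
theorem deriv_trapezoid (hε : 0 < ε) (h2ε : 2 * ε ≤ t₂ - t₁) {t : ℝ} (a1 : t ≠ t₁) (a2 : t ≠ t₁ + ε)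
    (a3 : t ≠ t₂ - ε) (a4 : t ≠ t₂) : deriv (trapezoid t₁ t₂ ε) t =
      (Ioo t₁ (t₁ + ε)).indicator (fun _ => ε⁻¹) t - (Ioo (t₂ - ε) t₂).indicator (fun _ => ε⁻¹) t := by
  have hi := inv_pos.2 hε
  have hconst : ∀ (c : ℝ) (s : Set ℝ), IsOpen s → t ∈ s → (∀ x ∈ s, trapezoid t₁ t₂ ε x = c) →
      deriv (trapezoid t₁ t₂ ε) t = 0 := fun c s hs ht h => by
    have : trapezoid t₁ t₂ ε =ᶠ[𝓝 t] fun _ => c := by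
      filter_upwards [hs.mem_nhds ht] with x hx using h x hx
    rw [this.deriv_eq, deriv_const]
  rcases lt_or_gt_of_ne a1 with h | h1
  · rw [indicator_of_notMem (by simp; intro; linarith), indicator_of_notMem (by simp; intro; linarith),
      sub_zero]
    exact hconst 0 (Iio t₁) isOpen_Iio h fun x hx => trapezoid_eq_zero hε fun h' => by
      have := h'.1; simp at hx; linarith
  rcases lt_or_gt_of_ne a4 with h4 | h
  swap
  · rw [indicator_of_notMem (by simp; intro; linarith), indicator_of_notMem (by simp; intro; linarith),
      sub_zero]
    exact hconst 0 (Ioi t₂) isOpen_Ioi h fun x hx => trapezoid_eq_zero hε fun h' => by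
      have := h'.2; simp at hx; linarith
  rcases lt_or_gt_of_ne a2 with h2 | h2
  · rw [indicator_of_mem (show t ∈ Ioo t₁ (t₁ + ε) from ⟨h1, h2⟩), indicator_of_notMem (by simp; intro; linarith), sub_zero]
    have : trapezoid t₁ t₂ ε =ᶠ[𝓝 t] fun t => (t - t₁) * ε⁻¹ := by
      filter_upwards [isOpen_Ioo.mem_nhds (⟨h1, h2⟩ : t ∈ Ioo t₁ (t₁ + ε))] with x hx
      have b0 : 0 ≤ (x - t₁) * ε⁻¹ := mul_nonneg (by linarith [hx.1]) hi.le
      have b1 : (x - t₁) * ε⁻¹ ≤ 1 := by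
        rw [← div_eq_mul_inv, div_le_one hε]; linarith [hx.2]
      have b2 : (x - t₁) * ε⁻¹ ≤ (t₂ - x) * ε⁻¹ := mul_le_mul_of_nonneg_right (by linarith [hx.2]) hi.le
      rw [trapezoid, min_eq_left b2, min_eq_right b1, max_eq_right b0]
    rw [this.deriv_eq]
    simp
  rcases lt_or_gt_of_ne a3 with h3 | h3
  · rw [indicator_of_notMem (by simp; intro; linarith), indicator_of_notMem (by simp; intro; linarith),
      sub_zero]
    exact hconst 1 (Ioo (t₁ + ε) (t₂ - ε)) isOpen_Ioo ⟨h2, h3⟩ fun x hx =>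
      trapezoid_eq_one hε hx.1.le hx.2.le
  · rw [indicator_of_notMem (by simp; intro; linarith), indicator_of_mem (show t ∈ Ioo (t₂ - ε) t₂ from ⟨h3, h4⟩), zero_sub]
    have : trapezoid t₁ t₂ ε =ᶠ[𝓝 t] fun t => (t₂ - t) * ε⁻¹ := by
      filter_upwards [isOpen_Ioo.mem_nhds (⟨h3, h4⟩ : t ∈ Ioo (t₂ - ε) t₂)] with x hx
      have b0 : 0 ≤ (t₂ - x) * ε⁻¹ := mul_nonneg (by linarith [hx.2]) hi.le
      have b1 : (t₂ - x) * ε⁻¹ ≤ 1 := by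
        rw [← div_eq_mul_inv, div_le_one hε]; linarith [hx.1]
      have b2 : (t₂ - x) * ε⁻¹ ≤ (x - t₁) * ε⁻¹ := mul_le_mul_of_nonneg_right (by linarith [hx.1]) hi.le
      rw [trapezoid, min_eq_right b2, min_eq_right b1, max_eq_right b0]
    rw [this.deriv_eq]
    simp

end trapezoid

theorem setIntegral_cyl_time {r τ s₁ s₂ c : ℝ} (hs₁ : -4 ≤ s₁) (hs : s₁ ≤ s₂) (hs₂ : s₂ ≤ τ)
    (f : EuclideanSpace ℝ (Fin n) → ℝ) :
    ∫ p in cyl n r τ, f p.1 * (Ioo s₁ s₂).indicator (fun _ => c) p.2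
      = (∫ x in Metric.ball 0 r, f x) * ((s₂ - s₁) * c) := by
  rw [cyl, Measure.volume_eq_prod, setIntegral_prod_mul]
  congr 1
  rw [integral_indicator measurableSet_Ioo, Measure.restrict_restrict measurableSet_Ioo,
    inter_eq_left.2 (Ioo_subset_Ioo hs₁ hs₂)]
  simp [hs]

namespace LocalSol

variable {ν Ca r τ : ℝ} {a : SpaceTime n → Matrix (Fin n) (Fin n) ℝ}
  {b : SpaceTime n → EuclideanSpace ℝ (Fin n)} {u : SpaceTime n → ℝ}

/-- The energy inequality between two times. -/
theorem energy (h : LocalSol ν Ca r τ a b u) {F g : SpaceTime n → ℝ}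
    (hF : BddLip F) (hg : BddLip g) (hF0 : ∀ p, 0 ≤ F p) {ρ : ℝ} (hρ : ρ < r)
    (hFs : ∀ p, ρ ≤ ‖p.1‖ → F p = 0) (hgs : ∀ p, ρ ≤ ‖p.1‖ → g p = 0)
    {t₁ t₂ : ℝ} (ht₁ : -4 < t₁) (ht : t₁ < t₂) (ht₂ : t₂ < τ) :
    (∫ x in Metric.ball (0 : EuclideanSpace ℝ (Fin n)) r, F (x, t₂))
      + ∫ p in Metric.ball (0 : EuclideanSpace ℝ (Fin n)) r ×ˢ Ioo t₁ t₂, energyDensity a b u F g p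
      ≤ ∫ x in Metric.ball (0 : EuclideanSpace ℝ (Fin n)) r, F (x, t₁) := by
  obtain ⟨L, hL⟩ := hF.1
  set B := Metric.ball (0 : EuclideanSpace ℝ (Fin n)) r
  have hBfin : volume B < ∞ := Metric.isBounded_ball.measure_lt_top
  have hfinB : IsFiniteMeasure (volume.restrict B) := ⟨by
    rw [Measure.restrict_apply_univ]; exact hBfin⟩
  have hfin : IsFiniteMeasure (volume.restrict (cyl n r τ)) := ⟨by
    rw [Measure.restrict_apply_univ]; exact volume_cyl_lt_top r τ⟩
  set ε : ℕ → ℝ := fun k => (t₂ - t₁) / 2 * (1 / ((k : ℝ) + 1)) with hεdef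
  have hε : ∀ k, 0 < ε k := fun k => by
    have : 0 < t₂ - t₁ := sub_pos.2 ht
    positivity
  have hε0 : Tendsto ε atTop (𝓝 0) := by
    have := (tendsto_one_div_add_atTop_nhds_zero_nat (𝕜 := ℝ)).const_mul ((t₂ - t₁) / 2)
    simpa [hεdef] using this
  have hε2 : ∀ k, 2 * ε k ≤ t₂ - t₁ := fun k => by
    have h1 : 1 / ((k : ℝ) + 1) ≤ 1 := by
      rw [div_le_one (by positivity)]; linarith [(Nat.cast_nonneg k : (0 : ℝ) ≤ k)]
    have h2 : 0 < t₂ - t₁ := sub_pos.2 ht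
    simp only [hεdef]
    nlinarith
  set V := (volume B).toReal
  have hslice : ∀ t, BddLip fun x : EuclideanSpace ℝ (Fin n) => F (x, t) := fun t =>
    hF.comp (LipschitzWith.prodMk_right t)
  have hsI : ∀ t, Integrable (fun x : EuclideanSpace ℝ (Fin n) => F (x, t)) (volume.restrict B) :=
    fun t => (hslice t).bddMeas.integrable
  have hI : ∀ t c : ℝ, ∫ x in B, (F (x, t) + c) = (∫ x in B, F (x, t)) + c * V := fun t c => by
    rw [integral_add (hsI t) (integrable_const c), setIntegral_const, smul_eq_mul,
      mul_comm (volume.real B)]; rfl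
  -- On each ramp `F` is compared with its value at the end time. The error is at most `L * ε k`
  -- pointwise, hence `L * V * ε k` for each of the two ramps after integration.
  have main : ∀ k, ∫ p in cyl n r τ, trapezoid t₁ t₂ (ε k) p.2 * energyDensity a b u F g p ≤
      (∫ x in B, F (x, t₁)) - (∫ x in B, F (x, t₂)) + 2 * (L * V) * ε k := by
    intro k
    have hk := hε k
    have hki : (ε k) * (ε k)⁻¹ = 1 := mul_inv_cancel₀ hk.ne'
    have hb := trapezoid_bddLip (t₁ := t₁) (t₂ := t₂) hk
    refine (h.energy_cutoff hF hg hF0 hρ hFs hgs hb trapezoid_nonneg ht₁ ht₂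
      fun t ht => trapezoid_eq_zero hk fun h' => ht (Ioo_subset_Icc_self h')).trans ?_
    have e1 : ∫ p in cyl n r τ, (F (p.1, t₁) + L * ε k) *
        (Ioo t₁ (t₁ + ε k)).indicator (fun _ => (ε k)⁻¹) p.2 = (∫ x in B, F (x, t₁)) + L * ε k * V := by
      rw [setIntegral_cyl_time ht₁.le (by linarith) (by linarith [hε2 k])
        (fun x => F (x, t₁) + L * ε k), hI, add_sub_cancel_left, hki, mul_one]
    have e2 : ∫ p in cyl n r τ, (F (p.1, t₂) + -(L * ε k)) *
        (Ioo (t₂ - ε k) t₂).indicator (fun _ => (ε k)⁻¹) p.2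
          = (∫ x in B, F (x, t₂)) - L * ε k * V := by
      rw [setIntegral_cyl_time (by linarith [hε2 k]) (by linarith) ht₂.le
        (fun x => F (x, t₂) + -(L * ε k)), hI, sub_sub_cancel, hki, mul_one]
      ring
    have hcl : ∀ t c s₁ s₂ : ℝ, IntegrableOn (fun p : SpaceTime n => (F (p.1, t) + c) *
        (Ioo s₁ s₂).indicator (fun _ => (ε k)⁻¹) p.2) (cyl n r τ) := fun t c s₁ s₂ => by
      have h1 : BddMeas (volume.restrict (cyl n r τ)) fun p : SpaceTime n => F (p.1, t) :=
        ((hslice t).comp LipschitzWith.prod_fst).bddMeas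
      have h2 : BddMeas (volume.restrict (cyl n r τ)) fun _ : SpaceTime n => c :=
        ⟨aestronglyMeasurable_const, |c|, Eventually.of_forall fun _ => le_rfl⟩
      have h3 : BddMeas (volume.restrict (cyl n r τ)) fun p : SpaceTime n =>
          (Ioo s₁ s₂).indicator (fun _ => (ε k)⁻¹) p.2 := by
        refine ⟨((measurable_const.indicator measurableSet_Ioo).comp
          measurable_snd).aestronglyMeasurable, (ε k)⁻¹, Eventually.of_forall fun p => ?_⟩
        refine (norm_indicator_le_norm_self (fun _ => (ε k)⁻¹) p.2).trans (le_of_eq ?_)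
        exact Real.norm_of_nonneg (inv_nonneg.2 hk.le)
      exact ((h1.add h2).mul h3).integrable
    calc ∫ p in cyl n r τ, F p * deriv (trapezoid t₁ t₂ (ε k)) p.2
        ≤ ∫ p in cyl n r τ, ((F (p.1, t₁) + L * ε k) *
            (Ioo t₁ (t₁ + ε k)).indicator (fun _ => (ε k)⁻¹) p.2 - (F (p.1, t₂) + -(L * ε k)) *
            (Ioo (t₂ - ε k) t₂).indicator (fun _ => (ε k)⁻¹) p.2) := by
          refine integral_mono_ae ?_ ((hcl _ _ _ _).sub (hcl _ _ _ _)) (ae_restrict_of_ae ?_)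
          · obtain ⟨Kχ, hKχ⟩ := hb.1
            have hχ' : BddMeas (volume.restrict (cyl n r τ))
                fun p : SpaceTime n => deriv (trapezoid t₁ t₂ (ε k)) p.2 :=
              ⟨((measurable_deriv _).comp measurable_snd).aestronglyMeasurable, Kχ,
                Eventually.of_forall fun p => norm_deriv_le_of_lipschitz hKχ⟩
            exact (hF.bddMeas.mul hχ').integrable
          · have hne : ∀ s : ℝ, ∀ᵐ p : SpaceTime n, p.2 ≠ s := fun s =>
              Measure.quasiMeasurePreserving_snd.ae (Measure.ae_ne volume s)
            filter_upwards [hne t₁, hne (t₁ + ε k), hne (t₂ - ε k), hne t₂] with p p1 p2 p3 p4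
            rw [deriv_trapezoid hk (hε2 k) p1 p2 p3 p4, mul_sub]
            have hlip : ∀ t, |F p - F (p.1, t)| ≤ L * |p.2 - t| := fun t => by
              have := hL.dist_le_mul p (p.1, t)
              rwa [Real.dist_eq, Prod.dist_eq, dist_self, max_eq_right dist_nonneg,
                Real.dist_eq] at this
            refine sub_le_sub ?_ ?_
            · by_cases hp : p.2 ∈ Ioo t₁ (t₁ + ε k)
              · rw [indicator_of_mem hp]
                refine mul_le_mul_of_nonneg_right ?_ (inv_nonneg.2 hk.le)
                have h1 := (abs_le.1 (hlip t₁)).2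
                have h2 : |p.2 - t₁| ≤ ε k := by rw [abs_le]; constructor <;> linarith [hp.1, hp.2]
                have h3 := mul_le_mul_of_nonneg_left h2 L.coe_nonneg
                linarith
              · rw [indicator_of_notMem hp, mul_zero, mul_zero]
            · by_cases hp : p.2 ∈ Ioo (t₂ - ε k) t₂
              · rw [indicator_of_mem hp]
                refine mul_le_mul_of_nonneg_right ?_ (inv_nonneg.2 hk.le)
                have h1 := (abs_le.1 (hlip t₂)).1
                have h2 : |p.2 - t₂| ≤ ε k := by rw [abs_le]; constructor <;> linarith [hp.1, hp.2]
                have h3 := mul_le_mul_of_nonneg_left h2 L.coe_nonneg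
                linarith
              · rw [indicator_of_notMem hp, mul_zero, mul_zero]
      _ = _ := by
          rw [integral_sub (hcl _ _ _ _) (hcl _ _ _ _), e1, e2]
          ring
  have hJ := h.integrable_energyDensity hF hg
  have hlim : Tendsto (fun k => ∫ p in cyl n r τ, trapezoid t₁ t₂ (ε k) p.2 *
      energyDensity a b u F g p) atTop (𝓝 (∫ p in B ×ˢ Ioo t₁ t₂, energyDensity a b u F g p)) := by
    have hsub : B ×ˢ Ioo t₁ t₂ ⊆ cyl n r τ := prod_mono le_rfl (Ioo_subset_Ioo ht₁.le ht₂.le)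
    have hmB : MeasurableSet (B ×ˢ Ioo t₁ t₂) :=
      (Metric.isOpen_ball.prod isOpen_Ioo).measurableSet
    have e : ∫ p in B ×ˢ Ioo t₁ t₂, energyDensity a b u F g p
        = ∫ p in cyl n r τ, (B ×ˢ Ioo t₁ t₂).indicator (energyDensity a b u F g) p := by
      rw [integral_indicator hmB, Measure.restrict_restrict hmB, inter_eq_left.2 hsub]
    rw [e]
    refine tendsto_integral_of_dominated_convergence (fun p => ‖energyDensity a b u F g p‖)
      (fun k => ?_) hJ.norm (fun k => Eventually.of_forall fun p => ?_) ?_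
    · exact (((trapezoid_bddLip (hε k)).comp
        LipschitzWith.prod_snd).continuous.aestronglyMeasurable).mul hJ.1
    · rw [norm_mul, Real.norm_of_nonneg (trapezoid_nonneg _)]
      exact mul_le_of_le_one_left (norm_nonneg _) (trapezoid_le_one _)
    · filter_upwards [ae_restrict_mem (isOpen_cyl r τ).measurableSet] with p hp
      by_cases hpt : p.2 ∈ Ioo t₁ t₂
      · rw [indicator_of_mem (show p ∈ B ×ˢ Ioo t₁ t₂ from ⟨hp.1, hpt⟩)]
        refine tendsto_const_nhds.congr' ?_
        have hm : 0 < min (p.2 - t₁) (t₂ - p.2) :=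
          lt_min (sub_pos.2 hpt.1) (sub_pos.2 hpt.2)
        filter_upwards [hε0.eventually (gt_mem_nhds hm)] with k hk
        have h1 := lt_min_iff.1 hk
        rw [trapezoid_eq_one (hε k) (by linarith [h1.1]) (by linarith [h1.2]), one_mul]
      · rw [indicator_of_notMem fun h' => hpt h'.2]
        refine tendsto_const_nhds.congr fun k => ?_
        rw [trapezoid_eq_zero (hε k) hpt, zero_mul]
  have hlim2 : Tendsto (fun k => (∫ x in B, F (x, t₁)) - (∫ x in B, F (x, t₂)) + 2 * (L * V) * ε k)
      atTop (𝓝 ((∫ x in B, F (x, t₁)) - (∫ x in B, F (x, t₂)))) := by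
    have := (hε0.const_mul (2 * (L * V))).const_add
      ((∫ x in B, F (x, t₁)) - (∫ x in B, F (x, t₂)))
    simpa using this
  have := le_of_tendsto_of_tendsto' hlim hlim2 main
  linarith

end LocalSol

/-- The estimate is entrywise: the matrix is not assumed symmetric, so Cauchy–Schwarz for the
quadratic form is not at hand. -/
theorem form_abs_le {A : Matrix (Fin n) (Fin n) ℝ} {Ca : ℝ} (hA : ∀ i j, |A i j| ≤ Ca)
    (ξ η : EuclideanSpace ℝ (Fin n)) :
    |∑ i, ∑ j, A i j * ξ j * η i| ≤ (n : ℝ) ^ 2 * Ca * (‖ξ‖ * ‖η‖) := by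
  have h : ∀ i j, |A i j * ξ j * η i| ≤ Ca * (‖ξ‖ * ‖η‖) := fun i j => by
    rw [abs_mul, abs_mul, mul_assoc]
    exact mul_le_mul (hA i j) (mul_le_mul (abs_apply_le ξ j) (abs_apply_le η i) (abs_nonneg _)
      (norm_nonneg _)) (by positivity) ((abs_nonneg _).trans (hA i j))
  calc |∑ i, ∑ j, A i j * ξ j * η i| ≤ ∑ i : Fin n, ∑ j : Fin n, Ca * (‖ξ‖ * ‖η‖) :=
        (Finset.abs_sum_le_sum_abs _ _).trans (Finset.sum_le_sum fun i _ =>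
          (Finset.abs_sum_le_sum_abs _ _).trans (Finset.sum_le_sum fun j _ => h i j))
    _ = _ := by simp; ring

/-! ### The conical cutoff and the logarithmic transform. -/

/-- The conical cutoff function of a ball. -/
noncomputable def cone (r : ℝ) (x : EuclideanSpace ℝ (Fin n)) : ℝ := max 0 (1 - ‖x‖ / r)

section cone

variable {r : ℝ}

theorem cone_nonneg (x : EuclideanSpace ℝ (Fin n)) : 0 ≤ cone r x := le_max_left _ _

theorem cone_le_one (hr : 0 < r) (x : EuclideanSpace ℝ (Fin n)) : cone r x ≤ 1 :=
  max_le zero_le_one (sub_le_self _ (by positivity))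

theorem cone_eq_zero (hr : 0 < r) {x : EuclideanSpace ℝ (Fin n)} (hx : r ≤ ‖x‖) :
    cone r x = 0 := max_eq_left (by rw [sub_nonpos, one_le_div hr]; exact hx)

theorem half_le_cone (hr : 0 < r) {x : EuclideanSpace ℝ (Fin n)} (hx : ‖x‖ ≤ r / 2) :
    1 / 2 ≤ cone r x := le_max_of_le_right (by
      have : ‖x‖ / r ≤ 1 / 2 := by rw [div_le_iff₀ hr]; linarith
      linarith)

theorem cone_lipschitz (hr : 0 < r) :
    LipschitzWith (r⁻¹).toNNReal (cone r : EuclideanSpace ℝ (Fin n) → ℝ) := by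
  have h1 : LipschitzWith (r⁻¹).toNNReal fun x : EuclideanSpace ℝ (Fin n) => 1 - ‖x‖ / r := by
    refine LipschitzWith.of_dist_le_mul fun x y => ?_
    rw [Real.coe_toNNReal _ (inv_nonneg.2 hr.le), Real.dist_eq, sub_sub_sub_cancel_left,
      ← sub_div, abs_div, abs_of_pos hr, div_eq_inv_mul, dist_eq_norm, norm_sub_rev]
    exact mul_le_mul_of_nonneg_left (abs_norm_sub_norm_le _ _) (inv_nonneg.2 hr.le)
  exact h1.const_max 0

/-- The cone decreases with the norm, and the norm is convex. This quasi-concavity is what makes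
powers of the cone admissible weights in the Poincaré inequality. -/
theorem cone_segment (hr : 0 < r) (x y : EuclideanSpace ℝ (Fin n)) {s : ℝ} (hs : s ∈ Icc (0 : ℝ) 1) :
    min (cone r x) (cone r y) ≤ cone r ((1 - s) • x + s • y) := by
  have h : ‖(1 - s) • x + s • y‖ ≤ max ‖x‖ ‖y‖ := by
    refine (norm_add_le _ _).trans ?_
    rw [norm_smul, norm_smul, Real.norm_of_nonneg (sub_nonneg.2 hs.2), Real.norm_of_nonneg hs.1]
    have h1 := mul_le_mul_of_nonneg_left (le_max_left ‖x‖ ‖y‖) (sub_nonneg.2 hs.2)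
    have h2 := mul_le_mul_of_nonneg_left (le_max_right ‖x‖ ‖y‖) hs.1
    linarith
  rcases le_total ‖x‖ ‖y‖ with hxy | hxy
  · rw [max_eq_right hxy] at h
    exact (min_le_right _ _).trans (max_le_max le_rfl (by gcongr))
  · rw [max_eq_left hxy] at h
    exact (min_le_left _ _).trans (max_le_max le_rfl (by gcongr))

theorem cone_bddLip (hr : 0 < r) : BddLip (cone r : EuclideanSpace ℝ (Fin n) → ℝ) :=
  ⟨⟨_, cone_lipschitz hr⟩, 1, fun x => by
    rw [abs_of_nonneg (cone_nonneg x)]; exact cone_le_one hr x⟩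

end cone

theorem BddLip.pow {E : Type*} [PseudoMetricSpace E] {f : E → ℝ} (hf : BddLip f) (N : ℕ) :
    BddLip fun x => f x ^ N := by
  induction N with
  | zero => exact ⟨⟨0, by simp [LipschitzWith.const (1 : ℝ)]⟩, 1, by simp⟩
  | succ N ih => simpa only [pow_succ] using ih.mul hf

theorem BddLip.comp_deriv {E : Type*} [PseudoMetricSpace E] {u : E → ℝ} {K : ℝ≥0}
    (hu : LipschitzWith K u) (hu01 : ∀ p, u p ∈ Icc (0 : ℝ) 1) {f f' : ℝ → ℝ} {C : ℝ}
    (hf : ∀ s ∈ Icc (0 : ℝ) 1, HasDerivAt f (f' s) s) (hC : ∀ s ∈ Icc (0 : ℝ) 1, |f' s| ≤ C) :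
    BddLip fun p => f (u p) := by
  have hC0 : 0 ≤ C := (abs_nonneg _).trans (hC 0 (by simp))
  have h1 : LipschitzOnWith C.toNNReal f (Icc 0 1) := by
    refine (convex_Icc (0 : ℝ) 1).lipschitzOnWith_of_nnnorm_hasDerivWithin_le
      (fun s hs => (hf s hs).hasDerivWithinAt) (fun s hs => ?_)
    rw [← NNReal.coe_le_coe, Real.coe_toNNReal _ hC0]
    exact hC s hs
  obtain ⟨D, hD⟩ := isCompact_Icc.exists_bound_of_continuousOn
    (f := f) (s := Icc (0 : ℝ) 1) fun s hs => (hf s hs).continuousAt.continuousWithinAt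
  refine ⟨⟨C.toNNReal * K, LipschitzWith.of_dist_le_mul fun x y => ?_⟩, D, fun p => hD _ (hu01 p)⟩
  refine (h1.dist_le_mul _ (hu01 x) _ (hu01 y)).trans ?_
  rw [NNReal.coe_mul, mul_assoc]
  exact mul_le_mul_of_nonneg_left (hu.dist_le_mul x y) (NNReal.coe_nonneg _)

/-- The logarithmic transform of a solution. -/
noncomputable def logT (ε : ℝ) (u : SpaceTime n → ℝ) (p : SpaceTime n) : ℝ :=
  Real.log (1 + ε) - Real.log (u p + ε)

section logT

variable {ε : ℝ} {u : SpaceTime n → ℝ}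

theorem logT_nonneg (hε : 0 < ε) (hu01 : ∀ p, u p ∈ Icc (0 : ℝ) 1) (p : SpaceTime n) :
    0 ≤ logT ε u p :=
  sub_nonneg.2 (Real.log_le_log (by linarith [(hu01 p).1]) (by linarith [(hu01 p).2]))

theorem logT_le (hε : 0 < ε) (hu01 : ∀ p, u p ∈ Icc (0 : ℝ) 1) (p : SpaceTime n) :
    logT ε u p ≤ Real.log (1 + ε) - Real.log ε :=
  sub_le_sub_left (Real.log_le_log hε (by linarith [(hu01 p).1])) _

theorem logT_bddLip {K : ℝ≥0} (hε : 0 < ε) (hu : LipschitzWith K u)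
    (hu01 : ∀ p, u p ∈ Icc (0 : ℝ) 1) : BddLip (logT ε u) := by
  refine BddLip.comp_deriv (f := fun s => Real.log (1 + ε) - Real.log (s + ε))
    (f' := fun s => -(s + ε)⁻¹) (C := ε⁻¹) hu hu01 (fun s hs => ?_) (fun s hs => ?_)
  · have hs0 : s + ε ≠ 0 := by linarith [hs.1]
    have := (((hasDerivAt_id s).add_const ε).log hs0).const_sub (Real.log (1 + ε))
    simpa using this
  · have hs0 : 0 < s + ε := by linarith [hs.1]
    rw [abs_neg, abs_of_pos (inv_pos.2 hs0)]
    exact inv_anti₀ hε (by linarith [hs.1])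

theorem inv_bddLip {K : ℝ≥0} (hε : 0 < ε) (hu : LipschitzWith K u)
    (hu01 : ∀ p, u p ∈ Icc (0 : ℝ) 1) : BddLip fun p => -(u p + ε)⁻¹ := by
  refine BddLip.comp_deriv (f := fun s => -(s + ε)⁻¹)
    (f' := fun s => ((s + ε) ^ 2)⁻¹) (C := (ε ^ 2)⁻¹) hu hu01 (fun s hs => ?_) (fun s hs => ?_)
  · have hs0 : s + ε ≠ 0 := by linarith [hs.1]
    have : HasDerivAt (fun s => -(s + ε)⁻¹) _ s := (((hasDerivAt_id s).add_const ε).inv hs0).neg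
    exact this.congr_deriv (by simp [neg_div])
  · have hs0 : 0 < s + ε := by linarith [hs.1]
    rw [abs_of_pos (by positivity)]
    exact inv_anti₀ (by positivity) (by gcongr; linarith [hs.1])

theorem hasFDerivAt_logT (hε : 0 < ε) {p : SpaceTime n} (hp : 0 ≤ u p) (hd : DifferentiableAt ℝ u p) :
    HasFDerivAt (logT ε u) ((-(u p + ε)⁻¹) • fderiv ℝ u p) p := by
  have h0 : u p + ε ≠ 0 := by linarith
  have h1 : HasDerivAt (fun s => Real.log (1 + ε) - Real.log (s + ε)) (-(u p + ε)⁻¹) (u p) := by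
    have := (((hasDerivAt_id (u p)).add_const ε).log h0).const_sub (Real.log (1 + ε))
    simpa using this
  exact h1.comp_hasFDerivAt p hd.hasFDerivAt

theorem hasFDerivAt_inv (hε : 0 < ε) {p : SpaceTime n} (hp : 0 ≤ u p) (hd : DifferentiableAt ℝ u p) :
    HasFDerivAt (fun p => -(u p + ε)⁻¹) (((u p + ε)⁻¹ ^ 2) • fderiv ℝ u p) p := by
  have h0 : u p + ε ≠ 0 := by linarith
  have h1 : HasDerivAt (fun s => -(s + ε)⁻¹) ((u p + ε)⁻¹ ^ 2) (u p) := by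
    have : HasDerivAt (fun s => -(s + ε)⁻¹) _ (u p) :=
      (((hasDerivAt_id (u p)).add_const ε).inv h0).neg
    exact this.congr_deriv (by simp [neg_div])
  exact h1.comp_hasFDerivAt p hd.hasFDerivAt

theorem sgrad_logT (hε : 0 < ε) {p : SpaceTime n} (hp : 0 ≤ u p) (hd : DifferentiableAt ℝ u p) :
    ‖sgrad (logT ε u) p‖ = (u p + ε)⁻¹ * ‖sgrad u p‖ := by
  have : sgrad (logT ε u) p = (-(u p + ε)⁻¹) • sgrad u p := by
    ext i
    simp [sgrad_apply, spaceDeriv, (hasFDerivAt_logT hε hp hd).fderiv]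
  rw [this, norm_smul, norm_neg, Real.norm_of_nonneg (inv_nonneg.2 (by linarith))]

end logT

namespace LocalSol

variable {ν Ca r τ : ℝ} {a : SpaceTime n → Matrix (Fin n) (Fin n) ℝ}
  {b : SpaceTime n → EuclideanSpace ℝ (Fin n)} {u : SpaceTime n → ℝ}

/-- For `Φ(s) = log ((1 + ε) / (s + ε))` one has `Φ'' = (Φ')²`, so ellipticity produces `ν |D
Φ(u)|²` times the cutoff. Half of it absorbs the cross term with the gradient of the cutoff. The
time terms cancel because the cutoff is independent of time, and the drift appears only against that
gradient. -/
theorem energyDensity_logT_ge (h : LocalSol ν Ca (2 * r) τ a b u) (hν : 0 < ν) (hCa : 0 ≤ Ca)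
    (hr : 0 < r) {ε : ℝ} (hε : 0 < ε) (hu01 : ∀ p, u p ∈ Icc (0 : ℝ) 1) (N : ℕ) :
    ∀ᵐ p ∂(volume.restrict (cyl n (2 * r) τ)),
      ν / 2 * (‖sgrad (logT ε u) p‖ ^ 2 * cone r p.1 ^ (N + 2))
        - ((n : ℝ) ^ 2 * Ca * ((N + 2 : ℕ) * r⁻¹)) ^ 2 / (2 * ν)
        - ((N + 2 : ℕ) * r⁻¹) * (‖b p‖ * (logT ε u p * cone r p.1 ^ (N + 1)))
      ≤ energyDensity a b u (fun p => logT ε u p * cone r p.1 ^ (N + 2))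
          (fun p => -(u p + ε)⁻¹ * cone r p.1 ^ (N + 2)) p := by
  obtain ⟨L, hL⟩ := h.lip
  have hYlip : LipschitzWith ((r⁻¹).toNNReal * 1) fun p : SpaceTime n => cone r p.1 :=
    (cone_lipschitz hr).comp LipschitzWith.prod_fst
  filter_upwards [ae_restrict_of_ae hL.ae_differentiableAt,
    ae_restrict_of_ae hYlip.ae_differentiableAt, h.bdd, h.ell] with p hu hY ha hell
  set Y : SpaceTime n → ℝ := fun p => cone r p.1 with hYdef
  have hu0 := (hu01 p).1
  set c := (u p + ε)⁻¹ with hc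
  have hc0 : 0 < c := inv_pos.2 (by linarith)
  set w := logT ε u p with hw
  have hw0 : 0 ≤ w := logT_nonneg hε hu01 p
  set y := cone r p.1 with hy
  have hy0 : 0 ≤ y := cone_nonneg _
  have hψ : HasFDerivAt (fun p => Y p ^ (N + 2)) (((N + 2 : ℕ) * y ^ (N + 1)) • fderiv ℝ Y p) p := by
    have := hY.hasFDerivAt.pow (N + 2)
    simpa using this
  have hF : ∀ v, fderiv ℝ (fun p => logT ε u p * Y p ^ (N + 2)) p v
      = w * ((N + 2 : ℕ) * y ^ (N + 1) * fderiv ℝ Y p v) + y ^ (N + 2) * (-c * fderiv ℝ u p v) := by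
    intro v
    have h2 : fderiv ℝ (fun p => logT ε u p * Y p ^ (N + 2)) p = _ :=
      HasFDerivAt.fderiv ((hasFDerivAt_logT hε hu0 hu).mul hψ)
    rw [h2]
    rfl
  have hg : ∀ v, fderiv ℝ (fun p => -(u p + ε)⁻¹ * Y p ^ (N + 2)) p v
      = -c * ((N + 2 : ℕ) * y ^ (N + 1) * fderiv ℝ Y p v)
        + y ^ (N + 2) * (c ^ 2 * fderiv ℝ u p v) := by
    intro v
    have h2 : fderiv ℝ (fun p => -(u p + ε)⁻¹ * Y p ^ (N + 2)) p = _ :=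
      HasFDerivAt.fderiv ((hasFDerivAt_inv hε hu0 hu).mul hψ)
    rw [h2]
    rfl
  have hYn : ‖sgrad Y p‖ ≤ r⁻¹ := by
    refine (norm_sgrad_le Y p).trans ((norm_fderiv_le_of_lipschitz ℝ hYlip).trans (le_of_eq ?_))
    rw [mul_one, Real.coe_toNNReal _ (inv_nonneg.2 hr.le)]
  have hξ : ‖sgrad (logT ε u) p‖ = c * ‖sgrad u p‖ := sgrad_logT hε hu0 hu
  set k : ℝ := ((N + 2 : ℕ) : ℝ) with hk
  have hk0 : 0 ≤ k := Nat.cast_nonneg _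
  have e1 : ∑ i, ∑ j, a p i j * spaceDeriv j u p *
      spaceDeriv i (fun p => -(u p + ε)⁻¹ * Y p ^ (N + 2)) p
      = y ^ (N + 2) * c ^ 2 * ∑ i, ∑ j, a p i j * sgrad u p i * sgrad u p j
        - c * (k * y ^ (N + 1)) * ∑ i, ∑ j, a p i j * sgrad u p j * sgrad Y p i := by
    simp only [Finset.mul_sum, ← Finset.sum_sub_distrib]
    refine Finset.sum_congr rfl fun i _ => Finset.sum_congr rfl fun j _ => ?_
    simp only [sgrad_apply, spaceDeriv, hg]
    ring
  have e2 : timeDeriv (fun p => logT ε u p * Y p ^ (N + 2)) p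
      - timeDeriv u p * (-(u p + ε)⁻¹ * Y p ^ (N + 2)) = 0 := by
    have hYt : fderiv ℝ Y p (0, 1) = 0 := by
      have h3 : lineDeriv ℝ Y p (0, 1) = 0 := by simp [lineDeriv, Y]
      rwa [hY.lineDeriv_eq_fderiv] at h3
    simp only [timeDeriv, hF, hYt, ← hc]
    simp only [Y, ← hy]
    ring
  have e3 : ∑ i, b p i * (spaceDeriv i (fun p => logT ε u p * Y p ^ (N + 2)) p
      - spaceDeriv i u p * (-(u p + ε)⁻¹ * Y p ^ (N + 2)))
      = w * (k * y ^ (N + 1)) * ∑ i, b p i * sgrad Y p i := by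
    rw [Finset.mul_sum]
    refine Finset.sum_congr rfl fun i _ => ?_
    simp only [sgrad_apply, spaceDeriv, hF, ← hc]
    simp only [Y, ← hy]
    ring
  have key : energyDensity a b u (fun p => logT ε u p * Y p ^ (N + 2))
      (fun p => -(u p + ε)⁻¹ * Y p ^ (N + 2)) p
      = y ^ (N + 2) * c ^ 2 * ∑ i, ∑ j, a p i j * sgrad u p i * sgrad u p j
        - c * (k * y ^ (N + 1)) * ∑ i, ∑ j, a p i j * sgrad u p j * sgrad Y p i
        - w * (k * y ^ (N + 1)) * ∑ i, b p i * sgrad Y p i := by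
    rw [energyDensity, e1, e2, e3, sub_zero]
  refine le_trans ?_ key.ge
  have f1 := hell (sgrad u p)
  have f2 := (abs_le.1 (form_abs_le ha (sgrad u p) (sgrad Y p))).2
  have f3 := (abs_le.1 (abs_sum_mul_le (b p) (sgrad Y p))).2
  set X := ‖sgrad u p‖ with hX
  have hX0 : 0 ≤ X := norm_nonneg _
  have hri : 0 ≤ r⁻¹ := inv_nonneg.2 hr.le
  have g1 : y ^ (N + 2) * c ^ 2 * (ν * X ^ 2) ≤
      y ^ (N + 2) * c ^ 2 * ∑ i, ∑ j, a p i j * sgrad u p i * sgrad u p j :=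
    mul_le_mul_of_nonneg_left f1 (by positivity)
  have g2 : c * (k * y ^ (N + 1)) * ∑ i, ∑ j, a p i j * sgrad u p j * sgrad Y p i ≤
      c * (k * y ^ (N + 1)) * ((n : ℝ) ^ 2 * Ca * (X * r⁻¹)) := by
    refine mul_le_mul_of_nonneg_left (f2.trans ?_) (by positivity)
    gcongr
  have g3 : w * (k * y ^ (N + 1)) * ∑ i, b p i * sgrad Y p i ≤
      w * (k * y ^ (N + 1)) * (‖b p‖ * r⁻¹) := by
    refine mul_le_mul_of_nonneg_left (f3.trans ?_) (by positivity)
    gcongr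
  have hy1 : y ^ N ≤ 1 := pow_le_one₀ hy0 (cone_le_one hr _)
  set S := (n : ℝ) ^ 2 * Ca * (k * r⁻¹) with hS
  -- Completing the square works because differentiating the cutoff costs one power: `y ^ (2 * (N +
  -- 1)) = y ^ N * y ^ (N + 2)`.
  have g4 : S * (c * X) * y ^ (N + 1) ≤ ν / 2 * ((c * X) ^ 2 * y ^ (N + 2)) + S ^ 2 / (2 * ν) := by
    have h1 : 0 ≤ y ^ N * (ν * ((c * X) * y) - S) ^ 2 / (2 * ν) := by positivity
    have h2 : y ^ N * (ν * ((c * X) * y) - S) ^ 2 / (2 * ν)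
        = ν / 2 * ((c * X) ^ 2 * y ^ (N + 2)) + y ^ N * (S ^ 2 / (2 * ν))
          - S * (c * X) * y ^ (N + 1) := by
      field_simp; ring
    have h3 : y ^ N * (S ^ 2 / (2 * ν)) ≤ 1 * (S ^ 2 / (2 * ν)) :=
      mul_le_mul_of_nonneg_right hy1 (by positivity)
    linarith
  rw [hξ]
  have i1 : y ^ (N + 2) * c ^ 2 * (ν * X ^ 2) = ν * ((c * X) ^ 2 * y ^ (N + 2)) := by ring
  have i2 : c * (k * y ^ (N + 1)) * ((n : ℝ) ^ 2 * Ca * (X * r⁻¹)) = S * (c * X) * y ^ (N + 1) := by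
    rw [hS]; ring
  have i3 : w * (k * y ^ (N + 1)) * (‖b p‖ * r⁻¹) = k * r⁻¹ * (‖b p‖ * (w * y ^ (N + 1))) := by ring
  linarith

end LocalSol

/-! ### Integrals against the drift. -/

/-- A cylinder over a centred ball. -/
def tcyl (n : ℕ) (R t₁ t₂ : ℝ) : Set (SpaceTime n) := Metric.ball 0 R ×ˢ Ioo t₁ t₂

theorem measurableSet_tcyl (R t₁ t₂ : ℝ) : MeasurableSet (tcyl n R t₁ t₂) :=
  (Metric.isOpen_ball.prod isOpen_Ioo).measurableSet

theorem restrict_tcyl (R t₁ t₂ : ℝ) : (volume : Measure (SpaceTime n)).restrict (tcyl n R t₁ t₂)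
    = ((volume : Measure (EuclideanSpace ℝ (Fin n))).restrict (Metric.ball 0 R)).prod
      ((volume : Measure ℝ).restrict (Ioo t₁ t₂)) := by
  rw [Measure.prod_restrict]; rfl

theorem volume_tcyl_lt_top (R t₁ t₂ : ℝ) : volume (tcyl n R t₁ t₂) < ∞ :=
  (Metric.isBounded_ball.prod (Metric.isBounded_Ioo _ _)).measure_lt_top

/-- Scale-invariant smallness hypothesis on the drift. -/
def DriftBound (q l R τ M : ℝ) (b : SpaceTime n → EuclideanSpace ℝ (Fin n)) : Prop :=
  ∫⁻ t in Ioo (-4) τ, (∫⁻ x in Metric.ball (0 : EuclideanSpace ℝ (Fin n)) R, ‖b (x, t)‖ₑ ^ q) ^ (l / q)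
    ≤ ENNReal.ofReal M ^ l

/-- Hölder in space with `q`, `q'`, then in time with `l` and its conjugate. The factor 4 bounds the
power of the length of the time interval, which is at most 4. -/
theorem DriftBound.lintegral_le {q q' l R τ M : ℝ} {b : SpaceTime n → EuclideanSpace ℝ (Fin n)}
    (h : DriftBound q l R τ M b) (hq : q.HolderConjugate q') (hl : 1 < l) (hτ : τ ≤ 0)
    (hb : AEStronglyMeasurable b (volume.restrict (tcyl n R (-4) τ)))
    {k : SpaceTime n → ℝ≥0∞} (hk : Measurable k) {t₁ t₂ : ℝ} (ht₁ : -4 ≤ t₁) (ht₂ : t₂ ≤ τ)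
    {A : ℝ≥0∞} (hA : ∀ t ∈ Ioo t₁ t₂,
      ∫⁻ x in Metric.ball (0 : EuclideanSpace ℝ (Fin n)) R, k (x, t) ^ q' ≤ A) :
    ∫⁻ p in tcyl n R t₁ t₂, ‖b p‖ₑ * k p ≤ A ^ (1 / q') * (4 * ENNReal.ofReal M) := by
  set B := Metric.ball (0 : EuclideanSpace ℝ (Fin n)) R
  have hl0 : 0 < l := by linarith
  have hI : Ioo t₁ t₂ ⊆ Ioo (-4) τ := Ioo_subset_Ioo ht₁ ht₂
  have hb1 : AEStronglyMeasurable b (volume.restrict (tcyl n R t₁ t₂)) :=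
    hb.mono_measure (Measure.restrict_mono (prod_mono le_rfl hI) le_rfl)
  rw [restrict_tcyl] at hb hb1
  have hm : AEMeasurable (fun p => ‖b p‖ₑ * k p)
      ((volume.restrict B).prod (volume.restrict (Ioo t₁ t₂))) := hb1.enorm.mul hk.aemeasurable
  have hmG : AEMeasurable (fun t => ∫⁻ x in B, ‖b (x, t)‖ₑ ^ q) (volume.restrict (Ioo (-4) τ)) :=
    (hb.enorm.pow_const q).lintegral_prod_left'
  have hmG' : AEMeasurable (fun t => ∫⁻ x in B, ‖b (x, t)‖ₑ ^ q) (volume.restrict (Ioo t₁ t₂)) :=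
    hmG.mono_measure (Measure.restrict_mono hI le_rfl)
  rw [restrict_tcyl, lintegral_prod_symm _ hm]
  have hsl : ∀ᵐ t ∂(volume.restrict (Ioo t₁ t₂)),
      AEStronglyMeasurable (fun x => b (x, t)) (volume.restrict B) := hb1.prodMk_right
  calc ∫⁻ t in Ioo t₁ t₂, ∫⁻ x in B, ‖b (x, t)‖ₑ * k (x, t)
      ≤ ∫⁻ t in Ioo t₁ t₂, (∫⁻ x in B, ‖b (x, t)‖ₑ ^ q) ^ (1 / q) * A ^ (1 / q') := by
        refine lintegral_mono_ae ?_
        filter_upwards [hsl, ae_restrict_mem measurableSet_Ioo] with t ht htI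
        refine (ENNReal.lintegral_mul_le_Lp_mul_Lq _ hq ht.enorm
          (hk.comp measurable_prodMk_right).aemeasurable).trans ?_
        gcongr
        · exact one_div_nonneg.2 hq.symm.nonneg
        · exact hA t htI
    _ = (∫⁻ t in Ioo t₁ t₂, (∫⁻ x in B, ‖b (x, t)‖ₑ ^ q) ^ (1 / q)) * A ^ (1 / q') := by
        rw [lintegral_mul_const'' _ (hmG'.pow_const _)]
    _ ≤ (∫⁻ t in Ioo (-4) τ, (∫⁻ x in B, ‖b (x, t)‖ₑ ^ q) ^ (1 / q) * 1) * A ^ (1 / q') := by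
        simp only [mul_one]
        gcongr
    _ ≤ (ENNReal.ofReal M * 4) * A ^ (1 / q') := by
        gcongr
        refine (ENNReal.lintegral_mul_le_Lp_mul_Lq _ (Real.HolderConjugate.conjExponent hl)
          (hmG.pow_const _) aemeasurable_const).trans ?_
        gcongr
        · calc (∫⁻ t in Ioo (-4) τ, ((∫⁻ x in B, ‖b (x, t)‖ₑ ^ q) ^ (1 / q)) ^ l) ^ (1 / l)
              = (∫⁻ t in Ioo (-4) τ, (∫⁻ x in B, ‖b (x, t)‖ₑ ^ q) ^ (l / q)) ^ (1 / l) := by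
                congr 1
                refine lintegral_congr fun t => ?_
                rw [← ENNReal.rpow_mul]; congr 1; ring
            _ ≤ (ENNReal.ofReal M ^ l) ^ (1 / l) := by gcongr; exact h
            _ = ENNReal.ofReal M := by
                rw [← ENNReal.rpow_mul, mul_one_div_cancel hl0.ne', ENNReal.rpow_one]
        · have hc := Real.HolderConjugate.conjExponent hl
          have h4 : ∫⁻ t in Ioo (-4) τ, (1 : ℝ≥0∞) ^ Real.conjExponent l ≤ 4 := by
            simp only [ENNReal.one_rpow, lintegral_one, Measure.restrict_apply_univ, Real.volume_Ioo]
            refine (ENNReal.ofReal_le_ofReal (by linarith : τ - -4 ≤ 4)).trans ?_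
            simp
          calc _ ≤ (4 : ℝ≥0∞) ^ (1 / Real.conjExponent l) := by
                gcongr
                exact one_div_nonneg.2 hc.symm.nonneg
            _ ≤ (4 : ℝ≥0∞) ^ (1 : ℝ) := by
                refine ENNReal.rpow_le_rpow_of_exponent_le (by norm_num) ?_
                rw [div_le_one hc.symm.pos]; exact hc.symm.lt.le
            _ = 4 := ENNReal.rpow_one _
    _ = _ := by ring

theorem DriftBound.integral_le {q q' l R τ M : ℝ} {b : SpaceTime n → EuclideanSpace ℝ (Fin n)}
    (h : DriftBound q l R τ M b) (hq : q.HolderConjugate q') (hl : 1 < l) (hτ : τ ≤ 0) (hM : 0 ≤ M)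
    (hb : AEStronglyMeasurable b (volume.restrict (tcyl n R (-4) τ)))
    {k : SpaceTime n → ℝ} (hk : Measurable k) (hk0 : ∀ p, 0 ≤ k p) {t₁ t₂ : ℝ} (ht₁ : -4 ≤ t₁)
    (ht₂ : t₂ ≤ τ) {A : ℝ} (hA0 : 0 ≤ A) (hA : ∀ t ∈ Ioo t₁ t₂,
      ∫⁻ x in Metric.ball (0 : EuclideanSpace ℝ (Fin n)) R, ENNReal.ofReal (k (x, t)) ^ q'
        ≤ ENNReal.ofReal A) :
    ∫ p in tcyl n R t₁ t₂, ‖b p‖ * k p ≤ A ^ (1 / q') * (4 * M) := by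
  have hb1 : AEStronglyMeasurable b (volume.restrict (tcyl n R t₁ t₂)) :=
    hb.mono_measure (Measure.restrict_mono (prod_mono le_rfl (Ioo_subset_Ioo ht₁ ht₂)) le_rfl)
  have hq'0 : 0 ≤ 1 / q' := one_div_nonneg.2 hq.symm.nonneg
  rw [integral_eq_lintegral_of_nonneg_ae (Eventually.of_forall fun p =>
    mul_nonneg (norm_nonneg _) (hk0 p)) (hb1.norm.mul hk.aestronglyMeasurable)]
  refine ENNReal.toReal_le_of_le_ofReal (by positivity) ?_
  have := h.lintegral_le hq hl hτ hb hk.ennreal_ofReal ht₁ ht₂ hA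
  rw [ENNReal.ofReal_mul (by positivity), ENNReal.ofReal_mul (by norm_num),
    ← ENNReal.ofReal_rpow_of_nonneg hA0 hq'0, ENNReal.ofReal_ofNat]
  refine le_trans (le_of_eq ?_) this
  refine lintegral_congr fun p => ?_
  rw [ENNReal.ofReal_mul (norm_nonneg _), ofReal_norm]

/-! ### Time slices and the Poincaré inequality on them. -/

theorem norm_fderiv_slice_le {f : SpaceTime n → ℝ} {x : EuclideanSpace ℝ (Fin n)} {t : ℝ}
    (hf : DifferentiableAt ℝ f (x, t)) :
    ‖fderiv ℝ (fun x => f (x, t)) x‖ ≤ ‖sgrad f (x, t)‖ := by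
  have h1 : HasFDerivAt (fun x : EuclideanSpace ℝ (Fin n) => f (x, t)) _ x :=
    hf.hasFDerivAt.comp x (hasFDerivAt_prodMk_left x t)
  rw [h1.fderiv]
  refine ContinuousLinearMap.opNorm_le_bound _ (norm_nonneg _) fun v => ?_
  have h2 : ((fderiv ℝ f (x, t)).comp (ContinuousLinearMap.inl ℝ (EuclideanSpace ℝ (Fin n)) ℝ)) v
      = fderiv ℝ f (x, t) (v, 0) := rfl
  rw [h2, ← inner_sgrad, mul_comm]
  exact abs_sum_mul_le v (sgrad f (x, t))

/-- The Sobolev and Poincaré inequalities act on slices, while the energy controls the space-time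
derivative. Rademacher in space-time and Fubini connect the two. -/
theorem ae_slice_fderiv_le {f : SpaceTime n → ℝ} {K : ℝ≥0} (hf : LipschitzWith K f) :
    ∀ᵐ t : ℝ, ∀ᵐ x : EuclideanSpace ℝ (Fin n),
      ‖fderiv ℝ (fun x => f (x, t)) x‖ₑ ≤ ‖sgrad f (x, t)‖ₑ := by
  have h : ∀ᵐ p : SpaceTime n, DifferentiableAt ℝ f p := hf.ae_differentiableAt
  have h' : ∀ᵐ z : ℝ × EuclideanSpace ℝ (Fin n) ∂(volume.prod volume),
      DifferentiableAt ℝ f z.swap :=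
    Measure.measurePreserving_swap.quasiMeasurePreserving.ae h
  filter_upwards [Measure.ae_ae_of_ae_prod h'] with t ht
  filter_upwards [ht] with x hx
  rw [enorm_le_iff_norm_le]
  exact norm_fderiv_slice_le hx

/-- A consequence of the weighted Poincaré inequality for functions that are at most one on a
sizeable set. -/
theorem poincare_level {r : ℝ} (hr : 0 < r) {N : ℕ} (hN : 0 < N) {f : EuclideanSpace ℝ (Fin n) → ℝ} (hf : BddLip f)
    {Z : Set (EuclideanSpace ℝ (Fin n))}
    (hZm : MeasurableSet Z) (hZ : ∀ x ∈ Z, ‖x‖ ≤ r / 2) (hZ1 : ∀ x ∈ Z, f x ≤ 1) :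
    ENNReal.ofReal ((∫ x in Metric.ball (0 : EuclideanSpace ℝ (Fin n)) (2 * r), f x * cone r x ^ N)
      - volume.real (Metric.ball (0 : EuclideanSpace ℝ (Fin n)) (2 * r)))
      * (ENNReal.ofReal ((1 / 2) ^ N) * volume Z)
    ≤ ENNReal.ofReal (2 * r) * (2 ^ n * volume (Metric.ball (0 : EuclideanSpace ℝ (Fin n)) r)) *
      ∫⁻ x, ENNReal.ofReal (cone r x ^ N) * ‖fderiv ℝ f x‖ₑ := by
  set B := Metric.ball (0 : EuclideanSpace ℝ (Fin n)) (2 * r)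
  have hfinB : IsFiniteMeasure (volume.restrict B) := ⟨by
    rw [Measure.restrict_apply_univ]; exact Metric.isBounded_ball.measure_lt_top⟩
  obtain ⟨K, hK⟩ := hf.1
  have hcp := (cone_bddLip (n := n) hr).pow N
  have hc0 : ∀ x : EuclideanSpace ℝ (Fin n), 0 ≤ cone r x ^ N := fun x => pow_nonneg (cone_nonneg x) N
  have hc1 : ∀ x : EuclideanSpace ℝ (Fin n), cone r x ^ N ≤ 1 := fun x =>
    pow_le_one₀ (cone_nonneg x) (cone_le_one hr x)
  have hP := poincare_of_lipschitz (r := r) (ψ := fun x => ENNReal.ofReal (cone r x ^ N))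
    hcp.continuous.measurable.ennreal_ofReal (fun x hx => by simp [cone_eq_zero hr hx, hN.ne'])
    (fun x => by rw [← ENNReal.ofReal_one]; exact ENNReal.ofReal_le_ofReal (hc1 x))
    (fun x y s hs => by
      rw [← ENNReal.ofReal_mul (hc0 x), ← mul_pow]
      refine ENNReal.ofReal_le_ofReal (pow_le_pow_left₀ (mul_nonneg (cone_nonneg x)
        (cone_nonneg y)) ((le_min ?_ ?_).trans (cone_segment hr x y hs)) N)
      · exact mul_le_of_le_one_right (cone_nonneg x) (cone_le_one hr y)
      · exact mul_le_of_le_one_left (cone_nonneg y) (cone_le_one hr x)) hK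
  refine le_trans ?_ hP
  have hcm : Measurable fun x : EuclideanSpace ℝ (Fin n) => ENNReal.ofReal (cone r x ^ N) :=
    hcp.continuous.measurable.ennreal_ofReal
  have hone : BddLip fun x : EuclideanSpace ℝ (Fin n) => max (f x - 1) 0 := by
    obtain ⟨C, hC⟩ := hf.2
    have h1 : LipschitzWith K fun x : EuclideanSpace ℝ (Fin n) => f x - 1 := by
      simpa using hK.sub (LipschitzWith.const (1 : ℝ))
    refine ⟨⟨K, h1.max_const 0⟩, C + 1, fun x => ?_⟩
    have := abs_le.1 (hC x)
    rw [abs_le]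
    exact ⟨by linarith [le_max_right (f x - 1) 0, (abs_nonneg _).trans (hC x)],
      max_le (by linarith) (by linarith)⟩
  -- Only the excess above 1 is used: it is at most `|f x - f y|` for every `y` in `Z`, and dropping
  -- the rest costs no more than the volume since the weight is at most 1.
  have h1 : ENNReal.ofReal ((∫ x in B, f x * cone r x ^ N) - volume.real B)
      ≤ ∫⁻ x, ENNReal.ofReal (max (f x - 1) 0 * cone r x ^ N) := by
    have e1 : (∫ x in B, f x * cone r x ^ N) - volume.real B
        ≤ ∫ x in B, max (f x - 1) 0 * cone r x ^ N := by
      have e2 : volume.real B = ∫ x in B, (1 : ℝ) := by simp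
      rw [e2, ← integral_sub (hf.mul hcp).bddMeas.integrable (integrable_const _)]
      refine integral_mono ((hf.mul hcp).bddMeas.integrable.sub (integrable_const _))
        (hone.mul hcp).bddMeas.integrable fun x => ?_
      have := mul_le_mul_of_nonneg_right (le_max_left (f x - 1) 0) (hc0 x)
      dsimp only
      linarith [hc1 x]
    refine (ENNReal.ofReal_le_ofReal e1).trans ?_
    rw [ofReal_integral_eq_lintegral_ofReal (hone.mul hcp).bddMeas.integrable
      (Eventually.of_forall fun x => mul_nonneg (le_max_right _ _) (hc0 x))]
    exact setLIntegral_le_lintegral _ _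
  have hm1 : Measurable fun x : EuclideanSpace ℝ (Fin n) =>
      ENNReal.ofReal (max (f x - 1) 0 * cone r x ^ N) :=
    (hone.mul hcp).continuous.measurable.ennreal_ofReal
  calc _ ≤ (∫⁻ x, ENNReal.ofReal (max (f x - 1) 0 * cone r x ^ N)) *
        (ENNReal.ofReal ((1 / 2) ^ N) * volume Z) := by gcongr
    _ = ∫⁻ x, ENNReal.ofReal (max (f x - 1) 0 * cone r x ^ N) *
        (ENNReal.ofReal ((1 / 2) ^ N) * volume Z) := (lintegral_mul_const _ hm1).symm
    _ ≤ _ := by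
      refine lintegral_mono fun x => ?_
      calc _ = ∫⁻ y in Z, ENNReal.ofReal (max (f x - 1) 0 * cone r x ^ N) *
            ENNReal.ofReal ((1 / 2) ^ N) := by rw [setLIntegral_const, mul_assoc]
        _ ≤ ∫⁻ y in Z, ‖f x - f y‖ₑ *
            (ENNReal.ofReal (cone r x ^ N) * ENNReal.ofReal (cone r y ^ N)) := by
          refine setLIntegral_mono' hZm fun y hy => ?_
          rw [ENNReal.ofReal_mul (le_max_right _ _), mul_assoc]
          refine mul_le_mul' ?_ (mul_le_mul' le_rfl (ENNReal.ofReal_le_ofReal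
            (pow_le_pow_left₀ (by norm_num) (half_le_cone hr (hZ y hy)) N)))
          rw [← ofReal_norm]
          refine ENNReal.ofReal_le_ofReal (max_le ?_ (norm_nonneg _))
          exact le_trans (by linarith [hZ1 y hy]) (Real.le_norm_self _)
        _ ≤ _ := setLIntegral_le_lintegral _ _

/-! ### The mass of the logarithm: a dip at one time and its persistence. -/

/-- The weighted mass of the logarithmic transform at time `t`. -/
noncomputable def logMass (ε r : ℝ) (N : ℕ) (u : SpaceTime n → ℝ) (t : ℝ) : ℝ :=
  ∫ x in Metric.ball (0 : EuclideanSpace ℝ (Fin n)) (2 * r), logT ε u (x, t) * cone r x ^ (N + 2)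

theorem bddMeas_norm_sgrad {μ : Measure (SpaceTime n)} {u : SpaceTime n → ℝ} {K : ℝ≥0}
    (hu : LipschitzWith K u) : BddMeas μ fun p => ‖sgrad u p‖ :=
  ⟨(measurable_sgrad u).norm.aestronglyMeasurable, K, Eventually.of_forall fun p => by
    rw [norm_norm]; exact (norm_sgrad_le u p).trans (norm_fderiv_le_of_lipschitz ℝ hu)⟩

theorem isFiniteMeasure_tcyl (R t₁ t₂ : ℝ) :
    IsFiniteMeasure ((volume : Measure (SpaceTime n)).restrict (tcyl n R t₁ t₂)) := ⟨by
  rw [Measure.restrict_apply_univ]; exact volume_tcyl_lt_top R t₁ t₂⟩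

theorem isFiniteMeasure_ball (R : ℝ) : IsFiniteMeasure
    ((volume : Measure (EuclideanSpace ℝ (Fin n))).restrict (Metric.ball 0 R)) := ⟨by
  rw [Measure.restrict_apply_univ]; exact Metric.isBounded_ball.measure_lt_top⟩

theorem tcyl_subset_cyl {R t₁ t₂ τ : ℝ} (h₁ : -4 ≤ t₁) (h₂ : t₂ ≤ τ) :
    tcyl n R t₁ t₂ ⊆ cyl n R τ := prod_mono le_rfl (Ioo_subset_Ioo h₁ h₂)

theorem volume_tcyl_real (R : ℝ) {t₁ t₂ : ℝ} (h : t₁ ≤ t₂) : volume.real (tcyl n R t₁ t₂)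
    = volume.real (Metric.ball (0 : EuclideanSpace ℝ (Fin n)) R) * (t₂ - t₁) := by
  rw [tcyl, Measure.volume_eq_prod, measureReal_prod_prod]
  simp [h]

theorem lintegral_ball_le_of_integral {R : ℝ} {f : EuclideanSpace ℝ (Fin n) → ℝ} (hf : BddLip f)
    (h0 : ∀ x, 0 ≤ f x) : ∫⁻ x in Metric.ball 0 R, ENNReal.ofReal (f x)
      = ENNReal.ofReal (∫ x in Metric.ball 0 R, f x) := by
  have := isFiniteMeasure_ball (n := n) R
  exact (ofReal_integral_eq_lintegral_ofReal hf.bddMeas.integrable (Eventually.of_forall h0)).symm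

namespace LocalSol

variable {ν Ca r τ q q' l M ε : ℝ} {a : SpaceTime n → Matrix (Fin n) (Fin n) ℝ}
  {b : SpaceTime n → EuclideanSpace ℝ (Fin n)} {u : SpaceTime n → ℝ} {N : ℕ}

/-- The bound `A` on the slice integrals is left free because it serves twice: crudely, with the
supremum of the logarithm, and then self-consistently, with the mass being estimated. -/
theorem log_energy (h : LocalSol ν Ca (2 * r) τ a b u) (hν : 0 < ν) (hCa : 0 ≤ Ca)
    (hr : 0 < r) (hε : 0 < ε) (hu01 : ∀ p, u p ∈ Icc (0 : ℝ) 1)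
    (hD : DriftBound q l (2 * r) τ M b) (hq : q.HolderConjugate q') (hl : 1 < l) (hτ : τ ≤ 0)
    (hM : 0 ≤ M) {t₁ t₂ : ℝ} (ht₁ : -4 < t₁) (ht : t₁ < t₂) (ht₂ : t₂ < τ) {A : ℝ} (hA0 : 0 ≤ A)
    (hA : ∀ t ∈ Ioo t₁ t₂, ∫⁻ x in Metric.ball (0 : EuclideanSpace ℝ (Fin n)) (2 * r),
      ENNReal.ofReal (logT ε u (x, t) * cone r x ^ (N + 1)) ^ q' ≤ ENNReal.ofReal A) :
    logMass ε r N u t₂ + ν / 2 * ∫ p in tcyl n (2 * r) t₁ t₂,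
        ‖sgrad (logT ε u) p‖ ^ 2 * cone r p.1 ^ (N + 2)
      ≤ logMass ε r N u t₁ + ((n : ℝ) ^ 2 * Ca * ((N + 2 : ℕ) * r⁻¹)) ^ 2 / (2 * ν) *
        (volume.real (Metric.ball (0 : EuclideanSpace ℝ (Fin n)) (2 * r)) * (t₂ - t₁))
        + (N + 2 : ℕ) * r⁻¹ * (A ^ (1 / q') * (4 * M)) := by
  obtain ⟨L, hL⟩ := h.lip
  have hw := logT_bddLip hε hL hu01
  obtain ⟨Kw, hKw⟩ := hw.1
  have hcone : ∀ m : ℕ, BddLip fun p : SpaceTime n => cone r p.1 ^ m := fun m =>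
    ((cone_bddLip hr).comp LipschitzWith.prod_fst).pow m
  have hF := hw.mul (hcone (N + 2))
  have hg := (inv_bddLip hε hL hu01).mul (hcone (N + 2))
  have hw0 := logT_nonneg hε hu01
  have hfin := isFiniteMeasure_tcyl (n := n) (2 * r) t₁ t₂
  have hsub : tcyl n (2 * r) t₁ t₂ ⊆ cyl n (2 * r) τ := tcyl_subset_cyl ht₁.le ht₂.le
  have hmono : (volume : Measure (SpaceTime n)).restrict (tcyl n (2 * r) t₁ t₂)
      ≤ volume.restrict (cyl n (2 * r) τ) := Measure.restrict_mono hsub le_rfl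
  have key := h.energy hF hg (fun p => mul_nonneg (hw0 p) (pow_nonneg (cone_nonneg _) _))
    (ρ := r) (by linarith) (fun p hp => by simp [cone_eq_zero hr hp])
    (fun p hp => by simp [cone_eq_zero hr hp]) ht₁ ht ht₂
  have hb := (hD.integral_le hq hl hτ hM h.int.1 (k := fun p => logT ε u p * cone r p.1 ^ (N + 1))
    (hw.mul (hcone (N + 1))).continuous.measurable
    (fun p => mul_nonneg (hw0 p) (pow_nonneg (cone_nonneg _) _)) ht₁.le ht₂.le hA0 hA)
  have I1 : IntegrableOn (fun p => ν / 2 * (‖sgrad (logT ε u) p‖ ^ 2 * cone r p.1 ^ (N + 2)))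
      (tcyl n (2 * r) t₁ t₂) := by
    have h2 := (bddMeas_norm_sgrad (μ := volume.restrict (tcyl n (2 * r) t₁ t₂)) hKw)
    have h3 := ((h2.mul h2).mul (hcone (N + 2)).bddMeas).integrable
    refine (Integrable.const_mul ?_ (ν / 2))
    simpa only [pow_two] using h3
  have I2 : IntegrableOn (fun p => (N + 2 : ℕ) * r⁻¹ * (‖b p‖ * (logT ε u p * cone r p.1 ^ (N + 1))))
      (tcyl n (2 * r) t₁ t₂) :=
    (BddMeas.integrable_mul (h.int.mono_set hsub).norm
      (hw.mul (hcone (N + 1))).bddMeas).const_mul _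
  have hJ : IntegrableOn _ (tcyl n (2 * r) t₁ t₂) :=
    (h.integrable_energyDensity hF hg).mono_set hsub
  have hmon := integral_mono_ae ((I1.sub (integrable_const
    (((n : ℝ) ^ 2 * Ca * ((N + 2 : ℕ) * r⁻¹)) ^ 2 / (2 * ν)))).sub I2) hJ
    (ae_mono hmono (h.energyDensity_logT_ge hν hCa hr hε hu01 N))
  have e := integral_sub_sub I1 (integrable_const
    (((n : ℝ) ^ 2 * Ca * ((N + 2 : ℕ) * r⁻¹)) ^ 2 / (2 * ν))) I2
  simp only [Pi.sub_apply] at hmon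
  rw [e, integral_const_mul, integral_const_mul, setIntegral_const, smul_eq_mul,
    volume_tcyl_real _ ht.le] at hmon
  have hb' := mul_le_mul_of_nonneg_left hb (show 0 ≤ ((N + 2 : ℕ) : ℝ) * r⁻¹ by positivity)
  simp only [logMass]
  simp only [tcyl] at hmon hb' key ⊢
  linarith

theorem logMass_le (hr : 0 < r) (hε : 0 < ε) (hL : ∃ L, LipschitzWith L u)
    (hu01 : ∀ p, u p ∈ Icc (0 : ℝ) 1) (t : ℝ) : logMass ε r N u t ≤
      (Real.log (1 + ε) - Real.log ε) *
        volume.real (Metric.ball (0 : EuclideanSpace ℝ (Fin n)) (2 * r)) := by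
  obtain ⟨L, hL⟩ := hL
  have hfin := isFiniteMeasure_ball (n := n) (2 * r)
  have hw := (logT_bddLip hε hL hu01).comp (LipschitzWith.prodMk_right (α := EuclideanSpace ℝ (Fin n)) t)
  have h1 : ∀ x, logT ε u (x, t) * cone r x ^ (N + 2) ≤ Real.log (1 + ε) - Real.log ε := fun x =>
    (mul_le_of_le_one_right (logT_nonneg hε hu01 _) (pow_le_one₀ (cone_nonneg x)
      (cone_le_one hr x))).trans (logT_le hε hu01 _)
  refine (integral_mono (hw.mul ((cone_bddLip hr).pow (N + 2))).bddMeas.integrable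
    (integrable_const (Real.log (1 + ε) - Real.log ε)) h1).trans (le_of_eq ?_)
  rw [setIntegral_const, smul_eq_mul, mul_comm]

theorem logMass_nonneg (hε : 0 < ε) (hu01 : ∀ p, u p ∈ Icc (0 : ℝ) 1) (t : ℝ) :
    0 ≤ logMass ε r N u t :=
  integral_nonneg fun x => mul_nonneg (logT_nonneg hε hu01 _) (pow_nonneg (cone_nonneg x) _)

/-- If `u` is not small on a sizeable set then the logarithmic mass must be relatively small at
some time. -/
theorem poincare_time (h : LocalSol ν Ca (2 * r) τ a b u)
    (hr : 0 < r) (hε : 0 < ε) (hu01 : ∀ p, u p ∈ Icc (0 : ℝ) 1) {m : ℝ}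
    (hm : ∀ t ∈ Ioo (-2 : ℝ) (-1), m ≤ logMass ε r N u t) {z : ℝ} (hz0 : 0 ≤ z)
    (hz : ENNReal.ofReal z ≤ volume {p : SpaceTime n | ‖p.1‖ < r / 2 ∧ p.2 ∈ Ioo (-2 : ℝ) (-1) ∧
      1 / 2 ≤ u p}) :
    (m - volume.real (Metric.ball (0 : EuclideanSpace ℝ (Fin n)) (2 * r))) * ((1 / 2) ^ (N + 2) * z)
    ≤ 2 * r * (2 ^ n * volume.real (Metric.ball (0 : EuclideanSpace ℝ (Fin n)) r)) *
      ∫ p in tcyl n (2 * r) (-2) (-1), cone r p.1 ^ (N + 2) * ‖sgrad (logT ε u) p‖ := by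
  obtain ⟨L, hL⟩ := h.lip
  have hw := logT_bddLip hε hL hu01
  obtain ⟨Kw, hKw⟩ := hw.1
  set V := volume.real (Metric.ball (0 : EuclideanSpace ℝ (Fin n)) (2 * r))
  set V1 := volume.real (Metric.ball (0 : EuclideanSpace ℝ (Fin n)) r)
  have hV1 : volume (Metric.ball (0 : EuclideanSpace ℝ (Fin n)) r) = ENNReal.ofReal V1 :=
    (ENNReal.ofReal_toReal Metric.isBounded_ball.measure_lt_top.ne).symm
  set Z : Set (SpaceTime n) := {p | ‖p.1‖ < r / 2 ∧ p.2 ∈ Ioo (-2 : ℝ) (-1) ∧ 1 / 2 ≤ u p} with hZ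
  have hZm : MeasurableSet Z := by
    refine MeasurableSet.inter (measurableSet_lt measurable_fst.norm measurable_const)
      (MeasurableSet.inter (measurable_snd measurableSet_Ioo)
      (measurableSet_le measurable_const hL.continuous.measurable))
  have hcone : BddLip fun p : SpaceTime n => cone r p.1 ^ (N + 2) :=
    ((cone_bddLip hr).comp LipschitzWith.prod_fst).pow _
  have hc0 : ∀ p : SpaceTime n, 0 ≤ cone r p.1 ^ (N + 2) := fun p => pow_nonneg (cone_nonneg _) _
  have hfin := isFiniteMeasure_tcyl (n := n) (2 * r) (-2) (-1)
  have hint : IntegrableOn (fun p => cone r p.1 ^ (N + 2) * ‖sgrad (logT ε u) p‖)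
      (tcyl n (2 * r) (-2) (-1)) := (hcone.bddMeas.mul (bddMeas_norm_sgrad hKw)).integrable
  have hslice : ∀ᵐ t : ℝ, t ∈ Ioo (-2 : ℝ) (-1) →
      ENNReal.ofReal (m - V) * (ENNReal.ofReal ((1 / 2) ^ (N + 2)) *
        volume ((fun x => (x, t)) ⁻¹' Z)) ≤
      ENNReal.ofReal (2 * r) * (2 ^ n * ENNReal.ofReal V1) *
        ∫⁻ x in Metric.ball (0 : EuclideanSpace ℝ (Fin n)) (2 * r),
          ENNReal.ofReal (cone r x ^ (N + 2) * ‖sgrad (logT ε u) (x, t)‖) := by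
    filter_upwards [ae_slice_fderiv_le hKw] with t ht htI
    -- Where `u ≥ 1/2` one has `1 + ε ≤ 2 * (u + ε)`, so the logarithm is at most `log 2 < 1`.
    have hP := poincare_level hr (N := N + 2) (by omega) (f := fun x => logT ε u (x, t))
      (hw.comp (LipschitzWith.prodMk_right t)) (Z := (fun x => (x, t)) ⁻¹' Z)
      (measurable_prodMk_right hZm) (fun x hx => le_of_lt hx.1) (fun x hx => by
        have h1 : 1 / 2 ≤ u (x, t) := hx.2.2
        have h2 : Real.log (1 + ε) ≤ Real.log (2 * (u (x, t) + ε)) :=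
          Real.log_le_log (by linarith) (by linarith)
        rw [Real.log_mul two_ne_zero (by linarith)] at h2
        have h3 := Real.log_two_lt_d9
        simp only [logT]
        linarith)
    rw [hV1] at hP
    refine le_trans (mul_le_mul_left (ENNReal.ofReal_le_ofReal ?_) _) (hP.trans ?_)
    · exact sub_le_sub_right (hm t htI) _
    · refine mul_le_mul_right ?_ _
      have hsupp : ∫⁻ x, ENNReal.ofReal (cone r x ^ (N + 2)) *
          ‖fderiv ℝ (fun x => logT ε u (x, t)) x‖ₑ
          = ∫⁻ x in Metric.ball (0 : EuclideanSpace ℝ (Fin n)) (2 * r),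
            ENNReal.ofReal (cone r x ^ (N + 2)) * ‖fderiv ℝ (fun x => logT ε u (x, t)) x‖ₑ := by
        symm
        refine setLIntegral_eq_of_support_subset fun x hx => ?_
        rw [mem_ball_zero_iff]
        by_contra hc
        refine hx ?_
        simp [cone_eq_zero hr (by linarith : r ≤ ‖x‖)]
      rw [hsupp]
      refine lintegral_mono_ae (ae_restrict_of_ae ?_)
      filter_upwards [ht] with x hx
      rw [ENNReal.ofReal_mul (pow_nonneg (cone_nonneg x) _), ofReal_norm]
      gcongr
  have hmain : ENNReal.ofReal (m - V) * (ENNReal.ofReal ((1 / 2) ^ (N + 2)) * volume Z) ≤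
      ENNReal.ofReal (2 * r) * (2 ^ n * ENNReal.ofReal V1) *
        ENNReal.ofReal (∫ p in tcyl n (2 * r) (-2) (-1),
          cone r p.1 ^ (N + 2) * ‖sgrad (logT ε u) p‖) := by
    rw [ofReal_integral_eq_lintegral_ofReal hint (Eventually.of_forall fun p =>
      mul_nonneg (hc0 p) (norm_nonneg _))]
    have hm2 : Measurable fun p : SpaceTime n =>
        ENNReal.ofReal (cone r p.1 ^ (N + 2) * ‖sgrad (logT ε u) p‖) :=
      (hcone.continuous.measurable.mul (measurable_sgrad _).norm).ennreal_ofReal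
    rw [restrict_tcyl, lintegral_prod_symm _ hm2.aemeasurable]
    have hZvol : volume Z = ∫⁻ t in Ioo (-2 : ℝ) (-1), volume ((fun x => (x, t)) ⁻¹' Z) := by
      rw [Measure.volume_eq_prod, Measure.prod_apply_symm hZm]
      symm
      refine setLIntegral_eq_of_support_subset fun t ht => ?_
      by_contra hc
      refine ht ?_
      have : (fun x : EuclideanSpace ℝ (Fin n) => (x, t)) ⁻¹' Z = ∅ := by
        ext x; simp only [mem_preimage, hZ, Set.mem_ofPred_eq, mem_empty_iff_false, iff_false]
        exact fun hx => hc hx.2.1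
      simp [this]
    rw [hZvol, ← lintegral_const_mul _ (measurable_measure_prodMk_right hZm),
      ← lintegral_const_mul _ ((measurable_measure_prodMk_right hZm).const_mul _),
      ← lintegral_const_mul _ hm2.lintegral_prod_left']
    refine setLIntegral_mono_ae' measurableSet_Ioo hslice
  have hz' := (mul_le_mul_right (mul_le_mul_right hz (ENNReal.ofReal ((1 / 2) ^ (N + 2))))
    (ENNReal.ofReal (m - V))).trans hmain
  have hI0 : 0 ≤ ∫ p in tcyl n (2 * r) (-2) (-1), cone r p.1 ^ (N + 2) * ‖sgrad (logT ε u) p‖ :=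
    integral_nonneg fun p => mul_nonneg (hc0 p) (norm_nonneg _)
  have hV10 : 0 ≤ V1 := ENNReal.toReal_nonneg
  have hR0 : 0 ≤ 2 * r * (2 ^ n * V1) * ∫ p in tcyl n (2 * r) (-2) (-1),
      cone r p.1 ^ (N + 2) * ‖sgrad (logT ε u) p‖ := by positivity
  by_cases hmV : m - V ≤ 0
  · exact (mul_nonpos_of_nonpos_of_nonneg hmV (by positivity)).trans hR0
  · rw [not_le] at hmV
    rw [← ENNReal.ofReal_mul (by positivity), ← ENNReal.ofReal_mul hmV.le,
      show (2 : ℝ≥0∞) ^ n = ENNReal.ofReal (2 ^ n) by rw [ENNReal.ofReal_pow two_pos.le]; simp,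
      ← ENNReal.ofReal_mul (by positivity), ← ENNReal.ofReal_mul (by positivity),
      ← ENNReal.ofReal_mul (by positivity)] at hz'
    exact (ENNReal.ofReal_le_ofReal_iff hR0).1 hz'

end LocalSol

namespace LocalSol

variable {ν Ca r τ q q' l M ε : ℝ} {a : SpaceTime n → Matrix (Fin n) (Fin n) ℝ}
  {b : SpaceTime n → EuclideanSpace ℝ (Fin n)} {u : SpaceTime n → ℝ} {N : ℕ}

/-- A crude bound for the weighted energy of the logarithm. -/
noncomputable def logEnergyConst (n : ℕ) (ν Ca r M q' : ℝ) (N : ℕ) : ℝ :=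
  volume.real (Metric.ball (0 : EuclideanSpace ℝ (Fin n)) (2 * r))
    + ((n : ℝ) ^ 2 * Ca * ((N + 2 : ℕ) * r⁻¹)) ^ 2 / (2 * ν) *
        volume.real (Metric.ball (0 : EuclideanSpace ℝ (Fin n)) (2 * r))
    + (N + 2 : ℕ) * r⁻¹ *
      (volume.real (Metric.ball (0 : EuclideanSpace ℝ (Fin n)) (2 * r)) ^ (1 / q') * (4 * M))

/-- Bounding the logarithm by its maximum `Λ` makes the initial mass and the drift term linear in
`Λ`; the remaining constant is absorbed by `1 ≤ Λ`. -/
theorem log_energy_crude (h : LocalSol ν Ca (2 * r) τ a b u) (hν : 0 < ν) (hCa : 0 ≤ Ca)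
    (hr : 0 < r) (hε : 0 < ε) (hu01 : ∀ p, u p ∈ Icc (0 : ℝ) 1)
    (hD : DriftBound q l (2 * r) τ M b) (hq : q.HolderConjugate q') (hl : 1 < l) (hτ : τ ≤ 0)
    (hτ1 : -1 < τ) (hM : 0 ≤ M) {Λ : ℝ} (hΛ : Real.log (1 + ε) - Real.log ε = Λ) (hΛ1 : 1 ≤ Λ) :
    ν / 2 * ∫ p in tcyl n (2 * r) (-2) (-1), ‖sgrad (logT ε u) p‖ ^ 2 * cone r p.1 ^ (N + 2)
      ≤ Λ * logEnergyConst n ν Ca r M q' N := by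
  set V := volume.real (Metric.ball (0 : EuclideanSpace ℝ (Fin n)) (2 * r)) with hV
  have hV0 : 0 ≤ V := ENNReal.toReal_nonneg
  have hVe : volume (Metric.ball (0 : EuclideanSpace ℝ (Fin n)) (2 * r)) = ENNReal.ofReal V :=
    (ENNReal.ofReal_toReal Metric.isBounded_ball.measure_lt_top.ne).symm
  have hΛ0 : 0 ≤ Λ := by linarith
  have hq'0 : 0 < q' := hq.symm.pos
  have key := h.log_energy (N := N) hν hCa hr hε hu01 hD hq hl hτ hM (t₁ := -2) (t₂ := -1)
    (by norm_num) (by norm_num) hτ1 (A := Λ ^ q' * V) (by positivity) (fun t _ => by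
      calc _ ≤ ∫⁻ x in Metric.ball (0 : EuclideanSpace ℝ (Fin n)) (2 * r),
            ENNReal.ofReal Λ ^ q' := by
            refine lintegral_mono fun x => ENNReal.rpow_le_rpow (ENNReal.ofReal_le_ofReal ?_) hq'0.le
            exact (mul_le_of_le_one_right (logT_nonneg hε hu01 _) (pow_le_one₀ (cone_nonneg x)
              (cone_le_one hr x))).trans ((logT_le hε hu01 _).trans hΛ.le)
        _ = _ := by
          rw [setLIntegral_const, hVe, ENNReal.ofReal_rpow_of_nonneg hΛ0 hq'0.le,
            ENNReal.ofReal_mul (by positivity)])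
  have h1 := logMass_nonneg (r := r) (N := N) hε hu01 (-1)
  have h2 := logMass_le (N := N) hr hε h.lip hu01 (-2)
  rw [hΛ] at h2
  rw [Real.mul_rpow (by positivity) hV0, ← Real.rpow_mul hΛ0, mul_one_div_cancel hq'0.ne',
    Real.rpow_one] at key
  rw [← hV] at key h2
  have hc : 0 ≤ ((n : ℝ) ^ 2 * Ca * ((N + 2 : ℕ) * r⁻¹)) ^ 2 / (2 * ν) * V := by positivity
  have h3 := mul_le_mul_of_nonneg_right hΛ1 hc
  rw [logEnergyConst, ← hV]
  have e : Λ * (V + ((n : ℝ) ^ 2 * Ca * ((N + 2 : ℕ) * r⁻¹)) ^ 2 / (2 * ν) * V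
      + (N + 2 : ℕ) * r⁻¹ * (V ^ (1 / q') * (4 * M)))
    = Λ * V + Λ * (((n : ℝ) ^ 2 * Ca * ((N + 2 : ℕ) * r⁻¹)) ^ 2 / (2 * ν) * V)
      + (N + 2 : ℕ) * r⁻¹ * (Λ * V ^ (1 / q') * (4 * M)) := by ring
  rw [e]
  have e2 : (-1 : ℝ) - -2 = 1 := by norm_num
  rw [e2, mul_one] at key
  linarith

/-- With maximum `X ^ 2` the energy is `O(X ^ 2)`, so the inequality `2 y X ≤ y ^ 2 + X ^ 2` makes
the `L¹` norm of the gradient `O(X)`. If the mass never fell below `δ * X ^ 2`, Poincaré would force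
that norm to be of order `X ^ 2`, contrary to `hδ`. -/
theorem log_dip (h : LocalSol ν Ca (2 * r) τ a b u) (hν : 0 < ν) (hCa : 0 ≤ Ca)
    (hr : 0 < r) (hε : 0 < ε) (hu01 : ∀ p, u p ∈ Icc (0 : ℝ) 1)
    (hD : DriftBound q l (2 * r) τ M b) (hq : q.HolderConjugate q') (hl : 1 < l) (hτ : τ ≤ 0)
    (hτ1 : -1 < τ) (hM : 0 ≤ M) {X : ℝ} (hX1 : 1 ≤ X)
    (hX : Real.log (1 + ε) - Real.log ε = X ^ 2) {z δ : ℝ} (hz0 : 0 ≤ z)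
    (hz : ENNReal.ofReal z ≤ volume {p : SpaceTime n | ‖p.1‖ < r / 2 ∧ p.2 ∈ Ioo (-2 : ℝ) (-1) ∧
      1 / 2 ≤ u p})
    (hδ : 2 * r * (2 ^ n * volume.real (Metric.ball (0 : EuclideanSpace ℝ (Fin n)) r)) *
      ((logEnergyConst n ν Ca r M q' N / ν
        + volume.real (Metric.ball (0 : EuclideanSpace ℝ (Fin n)) (2 * r)) / 2) * X)
      < (δ * X ^ 2 - volume.real (Metric.ball (0 : EuclideanSpace ℝ (Fin n)) (2 * r)))
        * ((1 / 2) ^ (N + 2) * z)) :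
    ∃ t ∈ Ioo (-2 : ℝ) (-1), logMass ε r N u t < δ * X ^ 2 := by
  by_contra! hcon
  have h1 := h.poincare_time hr hε hu01 hcon hz0 hz
  have h2 := h.log_energy_crude (N := N) hν hCa hr hε hu01 hD hq hl hτ hτ1 hM hX (by nlinarith)
  refine absurd (hδ.trans_le h1) (not_lt.2 ?_)
  have hV1 : 0 ≤ volume.real (Metric.ball (0 : EuclideanSpace ℝ (Fin n)) r) := ENNReal.toReal_nonneg
  refine mul_le_mul_of_nonneg_left ?_ (by positivity)
  obtain ⟨L, hL⟩ := h.lip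
  have hw := logT_bddLip hε hL hu01
  obtain ⟨Kw, hKw⟩ := hw.1
  have hcone : BddLip fun p : SpaceTime n => cone r p.1 ^ (N + 2) :=
    ((cone_bddLip hr).comp LipschitzWith.prod_fst).pow _
  have hfin := isFiniteMeasure_tcyl (n := n) (2 * r) (-2) (-1)
  have hX0 : 0 < X := by linarith
  have hs := bddMeas_norm_sgrad (μ := volume.restrict (tcyl n (2 * r) (-2) (-1))) hKw
  have I1 : IntegrableOn (fun p => cone r p.1 ^ (N + 2) * ‖sgrad (logT ε u) p‖)
      (tcyl n (2 * r) (-2) (-1)) := (hcone.bddMeas.mul hs).integrable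
  have I2 : IntegrableOn (fun p => ‖sgrad (logT ε u) p‖ ^ 2 * cone r p.1 ^ (N + 2))
      (tcyl n (2 * r) (-2) (-1)) := by
    have := ((hs.mul hs).mul hcone.bddMeas).integrable
    change Integrable _ _
    simpa only [pow_two] using this
  have h3 : ∫ p in tcyl n (2 * r) (-2) (-1), cone r p.1 ^ (N + 2) * ‖sgrad (logT ε u) p‖
      ≤ ∫ p in tcyl n (2 * r) (-2) (-1), ((2 * X)⁻¹ * (‖sgrad (logT ε u) p‖ ^ 2 * cone r p.1 ^ (N + 2))
        + X / 2) := by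
    refine integral_mono I1 ((I2.const_mul _).add (integrable_const _)) fun p => ?_
    dsimp only
    have hc0 : 0 ≤ cone r p.1 ^ (N + 2) := pow_nonneg (cone_nonneg _) _
    have hc1 : cone r p.1 ^ (N + 2) ≤ 1 := pow_le_one₀ (cone_nonneg _) (cone_le_one hr _)
    set c := cone r p.1 ^ (N + 2)
    set y := ‖sgrad (logT ε u) p‖
    have e1 : 0 ≤ c * ((2 * X)⁻¹ * (y - X) ^ 2) := by positivity
    have e2 : c * ((2 * X)⁻¹ * (y - X) ^ 2) = (2 * X)⁻¹ * (y ^ 2 * c) - c * y + c * (X / 2) := by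
      field_simp
      ring
    have e3 := mul_le_mul_of_nonneg_right hc1 (show 0 ≤ X / 2 by positivity)
    linarith
  rw [integral_add (I2.const_mul _) (integrable_const _), integral_const_mul, setIntegral_const,
    smul_eq_mul, volume_tcyl_real _ (by norm_num), show (-1 : ℝ) - -2 = 1 by norm_num, mul_one] at h3
  refine h3.trans ?_
  set J := ∫ p in tcyl n (2 * r) (-2) (-1), ‖sgrad (logT ε u) p‖ ^ 2 * cone r p.1 ^ (N + 2)
  set Cc := logEnergyConst n ν Ca r M q' N
  have h4 : (2 * X)⁻¹ * J ≤ Cc / ν * X := by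
    have : (2 * X)⁻¹ * J = (ν * X)⁻¹ * (ν / 2 * J) := by field_simp
    rw [this]
    refine (mul_le_mul_of_nonneg_left h2 (by positivity)).trans (le_of_eq ?_)
    field_simp
  linarith

/-- The supremum `Wm` of the later masses satisfies an inequality with `e * (Λ ^ (q' - 1) * Wm) ^ (1
/ q')` on its right-hand side. As `(q' - 1) / q' = 1 / q`, Young turns this into `Wm / q'` plus `e ^
q * Λ / q`; the first part is absorbed, and the drift survives only through the small factor `e ^
q`. -/
theorem logMass_propagate (h : LocalSol ν Ca (2 * r) τ a b u) (hν : 0 < ν) (hCa : 0 ≤ Ca)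
    (hr : 0 < r) (hε : 0 < ε) (hu01 : ∀ p, u p ∈ Icc (0 : ℝ) 1)
    (hD : DriftBound q l (2 * r) τ M b) (hq : q.HolderConjugate q') (hl : 1 < l) (hτ : τ ≤ 0)
    (hM : 0 ≤ M) (hN : q ≤ N + 2) {Λ : ℝ} (hΛ : Real.log (1 + ε) - Real.log ε = Λ) (hΛ0 : 0 < Λ)
    {t₀ δ : ℝ} (ht₀ : -2 < t₀) (hδ : logMass ε r N u t₀ ≤ δ) {t : ℝ} (ht : t ∈ Ioo t₀ τ) :
    logMass ε r N u t ≤ q * (δ + ((n : ℝ) ^ 2 * Ca * ((N + 2 : ℕ) * r⁻¹)) ^ 2 / (2 * ν) *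
        (2 * volume.real (Metric.ball (0 : EuclideanSpace ℝ (Fin n)) (2 * r))))
      + ((N + 2 : ℕ) * r⁻¹ * (4 * M)) ^ q * Λ := by
  set V := volume.real (Metric.ball (0 : EuclideanSpace ℝ (Fin n)) (2 * r)) with hV
  have hV0 : 0 ≤ V := ENNReal.toReal_nonneg
  have hq0 : 0 < q := hq.pos
  have hq'0 : 0 < q' := hq.symm.pos
  have hq'1 : 1 < q' := hq.symm.lt
  set S : Set ℝ := (fun s => logMass ε r N u s) '' Ioo t₀ τ with hS
  have hbdd : BddAbove S := ⟨Λ * V, by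
    rintro _ ⟨s, -, rfl⟩
    have := logMass_le (N := N) hr hε h.lip hu01 s
    rwa [hΛ] at this⟩
  set Wm := sSup S with hWm
  have hle : ∀ s ∈ Ioo t₀ τ, logMass ε r N u s ≤ Wm := fun s hs => le_csSup hbdd ⟨s, hs, rfl⟩
  have hWm0 : 0 ≤ Wm := (logMass_nonneg hε hu01 t).trans (hle t ht)
  obtain ⟨L, hL⟩ := h.lip
  have hslice : ∀ s, BddLip fun x : EuclideanSpace ℝ (Fin n) => logT ε u (x, s) * cone r x ^ (N + 2) :=
    fun s => ((logT_bddLip hε hL hu01).comp (LipschitzWith.prodMk_right s)).mul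
      ((cone_bddLip hr).pow _)
  -- This is equivalent to `q ≤ N + 2`: the power of the cutoff lost by differentiation is regained
  -- on raising to the power `q'`.
  have hexp : ((N + 2 : ℕ) : ℝ) ≤ ((N + 1 : ℕ) : ℝ) * q' := by
    have hqq := hq.sub_one_mul_conj
    have h1 : 0 < q - 1 := hq.sub_one_pos
    push_cast
    have h2 : (q - 1) * (N + 2) ≤ (q - 1) * ((N + 1) * q') := by
      have : (q - 1) * ((N + 1) * q') = (N + 1) * ((q - 1) * q') := by ring
      rw [hqq] at this
      rw [this]; linarith
    exact le_of_mul_le_mul_left h2 h1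
  have hA : ∀ s ∈ Ioo t₀ τ, ∫⁻ x in Metric.ball (0 : EuclideanSpace ℝ (Fin n)) (2 * r),
      ENNReal.ofReal (logT ε u (x, s) * cone r x ^ (N + 1)) ^ q'
        ≤ ENNReal.ofReal (Λ ^ (q' - 1) * Wm) := by
    intro s hs
    calc _ ≤ ∫⁻ x in Metric.ball (0 : EuclideanSpace ℝ (Fin n)) (2 * r),
        ENNReal.ofReal (Λ ^ (q' - 1)) * ENNReal.ofReal (logT ε u (x, s) * cone r x ^ (N + 2)) := by
          refine lintegral_mono fun x => ?_
          have hw0 := logT_nonneg hε hu01 (x, s)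
          have hw1 : logT ε u (x, s) ≤ Λ := (logT_le hε hu01 _).trans hΛ.le
          have hc0 := cone_nonneg (r := r) x
          have hc1 := cone_le_one hr x
          beta_reduce
          rw [ENNReal.ofReal_rpow_of_nonneg (by positivity) hq'0.le,
            ← ENNReal.ofReal_mul (by positivity)]
          refine ENNReal.ofReal_le_ofReal ?_
          rw [Real.mul_rpow hw0 (by positivity), ← mul_assoc]
          refine mul_le_mul ?_ ?_ (by positivity) (by positivity)
          · rcases hw0.eq_or_lt with h0 | h0
            · rw [← h0, Real.zero_rpow hq'0.ne', mul_zero]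
            · have : logT ε u (x, s) ^ q' = logT ε u (x, s) ^ (q' - 1) * logT ε u (x, s) := by
                rw [Real.rpow_sub_one h0.ne', div_mul_cancel₀ _ h0.ne']
              rw [this]
              exact mul_le_mul_of_nonneg_right (Real.rpow_le_rpow hw0 hw1 (by linarith)) hw0
          · rcases hc0.eq_or_lt with h0 | h0
            · rw [← h0]; simp [Real.zero_rpow hq'0.ne']
            · rw [← Real.rpow_natCast, ← Real.rpow_natCast, ← Real.rpow_mul hc0]
              exact Real.rpow_le_rpow_of_exponent_ge h0 hc1 hexp
      _ = ENNReal.ofReal (Λ ^ (q' - 1)) * ENNReal.ofReal (logMass ε r N u s) := by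
          rw [lintegral_const_mul _ (hslice s).continuous.measurable.ennreal_ofReal,
            lintegral_ball_le_of_integral (hslice s) fun x =>
              mul_nonneg (logT_nonneg hε hu01 _) (pow_nonneg (cone_nonneg x) _)]
          rfl
      _ ≤ _ := by
          rw [← ENNReal.ofReal_mul (by positivity)]
          exact ENNReal.ofReal_le_ofReal (mul_le_mul_of_nonneg_left (hle s hs) (by positivity))
  set c1 := ((n : ℝ) ^ 2 * Ca * ((N + 2 : ℕ) * r⁻¹)) ^ 2 / (2 * ν) with hc1
  have hc10 : 0 ≤ c1 := by positivity
  set e := ((N + 2 : ℕ) : ℝ) * r⁻¹ * (4 * M) with he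
  have he0 : 0 ≤ e := by positivity
  have hup : ∀ s ∈ Ioo t₀ τ, logMass ε r N u s
      ≤ δ + c1 * (2 * V) + e * (Λ ^ (q' - 1) * Wm) ^ (1 / q') := by
    intro s hs
    have key := h.log_energy (N := N) hν hCa hr hε hu01 hD hq hl hτ hM (t₁ := t₀) (t₂ := s)
      (by linarith) hs.1 hs.2 (A := Λ ^ (q' - 1) * Wm) (by positivity)
      (fun t ht => hA t ⟨ht.1, ht.2.trans hs.2⟩)
    have h0 : 0 ≤ ν / 2 * ∫ p in tcyl n (2 * r) t₀ s,
        ‖sgrad (logT ε u) p‖ ^ 2 * cone r p.1 ^ (N + 2) :=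
      mul_nonneg (by positivity) (integral_nonneg fun p =>
        mul_nonneg (sq_nonneg _) (pow_nonneg (cone_nonneg _) _))
    have h1 : c1 * (V * (s - t₀)) ≤ c1 * (2 * V) := by
      refine mul_le_mul_of_nonneg_left ?_ hc10
      nlinarith [hs.2]
    have h2 : (N + 2 : ℕ) * r⁻¹ * ((Λ ^ (q' - 1) * Wm) ^ (1 / q') * (4 * M))
      = e * (Λ ^ (q' - 1) * Wm) ^ (1 / q') := by rw [he]; ring
    rw [h2] at key
    linarith
  have hWmle : Wm ≤ δ + c1 * (2 * V) + e * (Λ ^ (q' - 1) * Wm) ^ (1 / q') :=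
    csSup_le ⟨_, t, ht, rfl⟩ (by rintro _ ⟨s, hs, rfl⟩; exact hup s hs)
  have hy := Real.young_inequality_of_nonneg (a := e * Λ ^ (1 / q)) (b := Wm ^ (1 / q'))
    (by positivity) (by positivity) hq
  rw [Real.mul_rpow he0 (by positivity), ← Real.rpow_mul hΛ0.le, ← Real.rpow_mul hWm0,
    one_div_mul_cancel hq0.ne', one_div_mul_cancel hq'0.ne', Real.rpow_one, Real.rpow_one] at hy
  have e3 : e * (Λ ^ (q' - 1) * Wm) ^ (1 / q') = e * Λ ^ (1 / q) * Wm ^ (1 / q') := by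
    have h1 : (q' - 1) * (1 / q') = 1 / q := by
      have := hq.inv_add_inv_eq_one
      rw [sub_mul, mul_one_div_cancel hq'0.ne', one_mul, one_div, one_div]
      linarith
    rw [Real.mul_rpow (by positivity) hWm0, ← Real.rpow_mul hΛ0.le, h1]
    ring
  rw [e3] at hWmle
  have hinv := hq.inv_add_inv_eq_one
  have e4 : Wm / q' = Wm - Wm / q := by
    have : q'⁻¹ = 1 - q⁻¹ := by linarith
    rw [div_eq_mul_inv, this, div_eq_mul_inv]; ring
  rw [e4] at hy
  have h5 : Wm / q ≤ δ + c1 * (2 * V) + e ^ q * Λ / q := by linarith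
  have h6 : Wm ≤ q * (δ + c1 * (2 * V)) + e ^ q * Λ := by
    have := mul_le_mul_of_nonneg_left h5 hq0.le
    rw [mul_div_cancel₀ _ hq0.ne', mul_add, mul_div_cancel₀ _ hq0.ne'] at this
    exact this
  exact (hle t ht).trans h6

/-- Chebyshev's inequality: on the half ball the weight is at least `(1 / 2) ^ (N + 2)`, and the
logarithm at least `Λ / 2`. -/
theorem volume_small_le (hr : 0 < r) (hL : ∃ L, LipschitzWith L u) (hε : 0 < ε)
    (hu01 : ∀ p, u p ∈ Icc (0 : ℝ) 1)
    {Λ κ δ t : ℝ} (hΛ0 : 0 < Λ) (hκ : ∀ p, u p < κ → Λ / 2 ≤ logT ε u p)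
    (hW : logMass ε r N u t ≤ δ * Λ) :
    volume {x : EuclideanSpace ℝ (Fin n) | ‖x‖ < r / 2 ∧ u (x, t) < κ}
      ≤ ENNReal.ofReal (2 ^ (N + 3) * δ) := by
  obtain ⟨L, hL⟩ := hL
  have hsl : BddLip fun x : EuclideanSpace ℝ (Fin n) => logT ε u (x, t) * cone r x ^ (N + 2) :=
    ((logT_bddLip hε hL hu01).comp (LipschitzWith.prodMk_right t)).mul ((cone_bddLip hr).pow _)
  set S := {x : EuclideanSpace ℝ (Fin n) | ‖x‖ < r / 2 ∧ u (x, t) < κ} with hS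
  have hSm : MeasurableSet S := MeasurableSet.inter (measurableSet_lt measurable_norm
    measurable_const) (measurableSet_lt (hL.continuous.comp (by fun_prop)).measurable measurable_const)
  have h1 : ENNReal.ofReal (Λ / 2 * (1 / 2) ^ (N + 2)) * volume S
      ≤ ENNReal.ofReal (δ * Λ) := by
    refine le_trans ?_ (ENNReal.ofReal_le_ofReal hW)
    rw [logMass, ← lintegral_ball_le_of_integral hsl fun x =>
      mul_nonneg (logT_nonneg hε hu01 _) (pow_nonneg (cone_nonneg x) _), ← setLIntegral_const]
    refine (setLIntegral_mono' hSm fun x hx => ENNReal.ofReal_le_ofReal ?_).trans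
      (lintegral_mono_set fun x hx => ?_)
    · exact mul_le_mul (hκ _ hx.2) (pow_le_pow_left₀ (by norm_num) (half_le_cone hr hx.1.le) _)
        (by positivity) (logT_nonneg hε hu01 _)
    · rw [mem_ball_zero_iff]; have := hx.1; linarith
  have h2 : ENNReal.ofReal (2 ^ (N + 3) * δ)
      = ENNReal.ofReal (δ * Λ) / ENNReal.ofReal (Λ / 2 * (1 / 2) ^ (N + 2)) := by
    rw [← ENNReal.ofReal_div_of_pos (by positivity)]
    congr 1
    rw [one_div, inv_pow]
    field_simp
    ring
  rw [h2, ENNReal.le_div_iff_mul_le (Or.inl (by simp; positivity)) (Or.inl ENNReal.ofReal_ne_top),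
    mul_comm]
  exact h1

end LocalSol

/-- A quadratic outgrows a linear function. The first inequality is the hypothesis of the dip; the
second makes the fixed error of the propagation negligible. -/
theorem exists_large_of_pos {P V γ c q δ : ℝ} (hP : 0 ≤ P) (hV : 0 ≤ V) (hγ : 0 < γ) (hc : 0 ≤ c)
    (hq : 0 < q) (hδ : 0 < δ) :
    ∃ X : ℝ, 1 ≤ X ∧ P * X < (δ / (4 * q) * X ^ 2 - V) * γ ∧ q * c ≤ δ / 4 * X ^ 2 := by
  set δ' := δ / (4 * q)
  have hδ'0 : 0 < δ' := by positivity
  have h1 : 0 ≤ (P + V * γ + 1) / (δ' * γ) := by positivity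
  have h2 : 0 ≤ q * c / (δ / 4) := by positivity
  obtain ⟨X, hX⟩ : ∃ X, X = 1 + (P + V * γ + 1) / (δ' * γ) + q * c / (δ / 4) := ⟨_, rfl⟩
  have hX1 : 1 ≤ X := by linarith
  have hXa : (P + V * γ + 1) / (δ' * γ) ≤ X := by linarith
  have hXb : q * c / (δ / 4) ≤ X := by linarith
  rw [div_le_iff₀ (by positivity)] at hXa hXb
  refine ⟨X, hX1, ?_, ?_⟩
  · have h3 := mul_le_mul_of_nonneg_right hXa (by linarith : 0 ≤ X)
    have h4 : V * γ ≤ V * γ * X := le_mul_of_one_le_right (by positivity) hX1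
    linarith
  · have h3 : δ / 4 * X ≤ δ / 4 * X ^ 2 := mul_le_mul_of_nonneg_left (by nlinarith) (by positivity)
    linarith

/-- A solution that is at least `1/2` on half of a cylinder is rarely small later on. -/
theorem exists_rarely_small {ν Ca r q q' l M δ : ℝ} {N : ℕ} (hν : 0 < ν) (hCa : 0 ≤ Ca) (hr : 0 < r)
    (hq : q.HolderConjugate q') (hl : 1 < l) (hM : 0 ≤ M) (hN : q ≤ N + 2) (hδ : 0 < δ)
    (hMδ : ((N + 2 : ℕ) * r⁻¹ * (4 * M)) ^ q ≤ δ / 2) :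
    ∃ κ : ℝ, 0 < κ ∧ ∀ (τ : ℝ) (a : SpaceTime n → Matrix (Fin n) (Fin n) ℝ)
      (b : SpaceTime n → EuclideanSpace ℝ (Fin n)) (u : SpaceTime n → ℝ),
      LocalSol ν Ca (2 * r) τ a b u → (∀ p, u p ∈ Icc (0 : ℝ) 1) → -1 < τ → τ ≤ 0 →
      DriftBound q l (2 * r) τ M b →
      volume (Metric.ball (0 : EuclideanSpace ℝ (Fin n)) (r / 2)) / 2 ≤
        volume {p : SpaceTime n | ‖p.1‖ < r / 2 ∧ p.2 ∈ Ioo (-2 : ℝ) (-1) ∧ 1 / 2 ≤ u p} →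
      ∀ t ∈ Ioo (-1) τ, volume {x : EuclideanSpace ℝ (Fin n) | ‖x‖ < r / 2 ∧ u (x, t) < κ}
        ≤ ENNReal.ofReal (2 ^ (N + 3) * δ) := by
  set V := volume.real (Metric.ball (0 : EuclideanSpace ℝ (Fin n)) (2 * r)) with hV
  set V1 := volume.real (Metric.ball (0 : EuclideanSpace ℝ (Fin n)) r) with hV1
  set z := volume.real (Metric.ball (0 : EuclideanSpace ℝ (Fin n)) (r / 2)) / 2 with hz
  have hz0 : 0 < z := half_pos (ENNReal.toReal_pos (Metric.measure_ball_pos _ _ (by linarith)).ne'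
    Metric.isBounded_ball.measure_lt_top.ne)
  have hzv : ENNReal.ofReal z = volume (Metric.ball (0 : EuclideanSpace ℝ (Fin n)) (r / 2)) / 2 := by
    rw [hz, ENNReal.ofReal_div_of_pos two_pos, Measure.real,
      ENNReal.ofReal_toReal Metric.isBounded_ball.measure_lt_top.ne, ENNReal.ofReal_ofNat]
  have hV0 : 0 ≤ V := ENNReal.toReal_nonneg
  have hV10 : 0 ≤ V1 := ENNReal.toReal_nonneg
  have hq0 : 0 < q := hq.pos
  set γ := (1 / 2 : ℝ) ^ (N + 2) * z with hγ
  have hγ0 : 0 < γ := by positivity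
  set c1 := ((n : ℝ) ^ 2 * Ca * ((N + 2 : ℕ) * r⁻¹)) ^ 2 / (2 * ν) with hc1
  have hc10 : 0 ≤ c1 := by positivity
  set P := 2 * r * (2 ^ n * V1) * (LocalSol.logEnergyConst n ν Ca r M q' N / ν + V / 2) with hP
  have hP0 : 0 ≤ P := by
    have : 0 ≤ LocalSol.logEnergyConst n ν Ca r M q' N := by
      rw [LocalSol.logEnergyConst, ← hV]; positivity
    positivity
  obtain ⟨X, hX1, hdip, hXb⟩ := exists_large_of_pos hP0 hV0 hγ0 (show 0 ≤ c1 * (2 * V) by positivity)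
    hq0 hδ
  clear_value P V V1 z γ c1
  have hE : 1 < Real.exp (X ^ 2) := by
    rw [Real.one_lt_exp_iff]; positivity
  -- The solution of `log ((1 + ε) / ε) = X ^ 2`.
  set ε := (Real.exp (X ^ 2) - 1)⁻¹ with hε
  have hε0 : 0 < ε := inv_pos.2 (by linarith)
  have hΛ : Real.log (1 + ε) - Real.log ε = X ^ 2 := by
    rw [← Real.log_div (by positivity) hε0.ne']
    have : (1 + ε) / ε = Real.exp (X ^ 2) := by
      rw [hε, div_inv_eq_mul, add_mul, inv_mul_cancel₀ (by linarith)]; ring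
    rw [this, Real.log_exp]
  -- The value of `u` at which the logarithm equals half its maximum; it is positive because `ε = (1
  -- + ε) * exp (-X ^ 2)`.
  refine ⟨(1 + ε) * Real.exp (-(X ^ 2 / 2)) - ε, ?_, ?_⟩
  · have h1 : ε = (1 + ε) * Real.exp (-(X ^ 2)) := by
      rw [← hΛ, Real.exp_neg, Real.exp_sub, Real.exp_log (by positivity), Real.exp_log hε0]
      field_simp
    have h2 : Real.exp (-(X ^ 2)) < Real.exp (-(X ^ 2 / 2)) := by
      rw [Real.exp_lt_exp]
      have : 0 < X ^ 2 := by positivity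
      linarith
    have h3 := mul_lt_mul_of_pos_left h2 (show 0 < 1 + ε by positivity)
    linarith
  · intro τ a b u h hu01 hτ1 hτ hD hvol t ht
    obtain ⟨t₀, ht₀, hm⟩ := h.log_dip (N := N) hν hCa hr hε0 hu01 hD hq hl hτ hτ1 hM hX1 hΛ
      (z := z) (δ := δ / (4 * q)) hz0.le (hzv.trans_le hvol) (by
        rw [← mul_assoc, ← hV1, ← hV, ← hP, ← hγ]
        exact hdip)
    have hW := h.logMass_propagate (N := N) hν hCa hr hε0 hu01 hD hq hl hτ hM hN hΛ
      (by positivity) ht₀.1 hm.le (t := t) ⟨ht₀.2.trans ht.1, ht.2⟩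
    refine LocalSol.volume_small_le hr h.lip hε0 hu01 (Λ := X ^ 2) (by positivity) (fun p hp => ?_)
      (hW.trans ?_)
    · have hup := (hu01 p).1
      have h1 : Real.log (u p + ε) ≤ Real.log ((1 + ε) * Real.exp (-(X ^ 2 / 2))) :=
        Real.log_le_log (by linarith) (by linarith)
      rw [Real.log_mul (by positivity) (Real.exp_ne_zero _), Real.log_exp] at h1
      rw [logT]
      linarith
    -- The budget, in units of `X ^ 2`: `δ / 4` from the dip, `δ / 4` from the fixed error and `δ /
    -- 2` from the drift.
    · have h1 : q * (δ / (4 * q) * X ^ 2) = δ / 4 * X ^ 2 := by field_simp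
      have h2 := mul_le_mul_of_nonneg_right hMδ (sq_nonneg X)
      rw [← hV, ← hc1, mul_add, h1]
      linarith

/-! ### Fast geometric convergence and parabolic embeddings. -/

/-- Fast geometric convergence: superlinear recursive inequalities force decay to zero. -/
theorem exists_fast_convergence {K B β : ℝ} (hK : 0 < K) (hB : 1 < B) (hβ : 0 < β) :
    ∃ δ : ℝ, 0 < δ ∧ ∀ m : ℕ → ℝ≥0∞, m 0 ≤ ENNReal.ofReal δ →
      (∀ j, m (j + 1) ≤ ENNReal.ofReal (K * B ^ j) * m j ^ (1 + β)) →
      Tendsto m atTop (𝓝 0) := by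
  -- The ratio `L` and the threshold `δ` solve `B * L ^ β = 1` and `K * δ ^ β = L`, so that the
  -- bound `δ * L ^ j` reproduces itself exactly under the recursion.
  set L := B ^ (-β⁻¹) with hL
  have hB0 : 0 < B := by linarith
  have hL0 : 0 < L := Real.rpow_pos_of_pos hB0 _
  have hL1 : L < 1 := Real.rpow_lt_one_of_one_lt_of_neg hB (by simpa using hβ)
  have hLβ : B * L ^ β = 1 := by
    rw [hL, ← Real.rpow_mul hB0.le, neg_mul, inv_mul_cancel₀ hβ.ne', Real.rpow_neg_one,
      mul_inv_cancel₀ hB0.ne']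
  set δ := (L / K) ^ β⁻¹ with hδ
  have hδ0 : 0 < δ := by positivity
  have hδβ : K * δ ^ β = L := by
    rw [hδ, ← Real.rpow_mul (by positivity), inv_mul_cancel₀ hβ.ne', Real.rpow_one]
    field_simp
  refine ⟨δ, hδ0, fun m h0 hm => ?_⟩
  have hj : ∀ j, m j ≤ ENNReal.ofReal (δ * L ^ j) := by
    intro j
    induction j with
    | zero => simpa using h0
    | succ j ih =>
      refine (hm j).trans ((mul_le_mul_right (ENNReal.rpow_le_rpow ih (by linarith)) _).trans ?_)
      rw [ENNReal.ofReal_rpow_of_nonneg (by positivity) (by linarith),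
        ← ENNReal.ofReal_mul (by positivity)]
      refine ENNReal.ofReal_le_ofReal (le_of_eq ?_)
      have e1 : (L ^ j) ^ β = (L ^ β) ^ j := by
        rw [← Real.rpow_natCast, ← Real.rpow_natCast, ← Real.rpow_mul hL0.le,
          ← Real.rpow_mul hL0.le, mul_comm]
      rw [Real.rpow_add (by positivity), Real.rpow_one, Real.mul_rpow hδ0.le (by positivity), e1]
      calc K * B ^ j * (δ * L ^ j * (δ ^ β * (L ^ β) ^ j))
          = δ * L ^ j * (K * δ ^ β) * (B * L ^ β) ^ j := by rw [mul_pow]; ring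
        _ = δ * L ^ (j + 1) := by rw [hLβ, hδβ]; ring
  have hlim : Tendsto (fun j => ENNReal.ofReal (δ * L ^ j)) atTop (𝓝 0) := by
    rw [← ENNReal.ofReal_zero]
    refine ENNReal.tendsto_ofReal ?_
    simpa using (tendsto_pow_atTop_nhds_zero_of_lt_one hL0.le hL1).const_mul δ
  exact tendsto_of_tendsto_of_tendsto_of_le_of_le tendsto_const_nhds hlim (fun _ => zero_le) hj

/-- The squared `L₂` norm of the space gradient at time `t`. -/
noncomputable def sliceDirichlet (R : ℝ) (η : SpaceTime n → ℝ) (t : ℝ) : ℝ≥0∞ :=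
  ∫⁻ x in Metric.ball (0 : EuclideanSpace ℝ (Fin n)) R, ‖sgrad η (x, t)‖ₑ ^ (2 : ℝ)

theorem measurable_sliceDirichlet (R : ℝ) (η : SpaceTime n → ℝ) :
    Measurable (sliceDirichlet R η) := by
  have : Measurable fun p : SpaceTime n => ‖sgrad η p‖ₑ ^ (2 : ℝ) :=
    (measurable_sgrad η).enorm.pow_const _
  exact this.lintegral_prod_left'

theorem lintegral_sliceDirichlet (R t₁ t₂ : ℝ) (η : SpaceTime n → ℝ) :
    ∫⁻ t in Ioo t₁ t₂, sliceDirichlet R η t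
      = ∫⁻ p in tcyl n R t₁ t₂, ‖sgrad η p‖ₑ ^ (2 : ℝ) := by
  have : Measurable fun p : SpaceTime n => ‖sgrad η p‖ₑ ^ (2 : ℝ) :=
    (measurable_sgrad η).enorm.pow_const _
  rw [restrict_tcyl, lintegral_prod_symm _ this.aemeasurable]
  rfl

/-- Multiplicative inequality on almost every time slice. -/
theorem exists_slice_gagliardo_nirenberg (hn : 2 ≤ n) {s : ℝ} (hs : 2 ≤ s)
    (hs' : ((n : ℝ) - 2) * (s - 2) ≤ 4) : ∃ C : ℝ≥0, ∀ (η : SpaceTime n → ℝ) (ρ R t₁ t₂ : ℝ)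
      (E : ℝ≥0∞), BddLip η → ρ < R → (∀ p, ρ ≤ ‖p.1‖ → η p = 0) →
      (∀ t ∈ Ioo t₁ t₂, ∫⁻ x, ‖η (x, t)‖ₑ ^ (2 : ℝ) ≤ E) →
      ∀ᵐ t ∂(volume.restrict (Ioo t₁ t₂)), ∫⁻ x, ‖η (x, t)‖ₑ ^ s
        ≤ C * E ^ (s / 2 - n * (s - 2) / 4) * sliceDirichlet R η t ^ (n * (s - 2) / 4) := by
  obtain ⟨C, hC⟩ := gagliardo_nirenberg hn hs hs'
  refine ⟨C, fun η ρ R t₁ t₂ E hη hρ hsupp hE => ?_⟩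
  obtain ⟨K, hK⟩ := hη.1
  have h1 : 0 ≤ s / 2 - n * (s - 2) / 4 := by linarith
  have h2 : 0 ≤ (n : ℝ) * (s - 2) / 4 := by
    have : 0 ≤ s - 2 := by linarith
    positivity
  filter_upwards [ae_restrict_of_ae (ae_slice_fderiv_le hK), ae_restrict_mem measurableSet_Ioo]
    with t ht htI
  have hcs : HasCompactSupport fun x => η (x, t) :=
    HasCompactSupport.intro (isCompact_closedBall 0 ρ) fun x hx => hsupp _ (by
      simpa using (not_le.1 fun h => hx (by simpa using h)).le)
  refine (hC _ (fun x => η (x, t)) (hK.comp (LipschitzWith.prodMk_right t)) hcs).trans ?_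
  have hD : ∫⁻ x, ‖fderiv ℝ (fun x => η (x, t)) x‖ₑ ^ (2 : ℝ) ≤ sliceDirichlet R η t := by
    have hsub : ∫⁻ x, ‖fderiv ℝ (fun x => η (x, t)) x‖ₑ ^ (2 : ℝ)
        = ∫⁻ x in Metric.ball 0 R, ‖fderiv ℝ (fun x => η (x, t)) x‖ₑ ^ (2 : ℝ) := by
      symm
      refine setLIntegral_eq_of_support_subset fun x hx => ?_
      by_contra hc
      have hxR : ρ < ‖x‖ := hρ.trans_le (by simpa using hc)
      refine hx ?_
      beta_reduce
      have : (fun x => η (x, t)) =ᶠ[𝓝 x] fun _ => 0 := by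
        filter_upwards [(isOpen_lt continuous_const continuous_norm).mem_nhds hxR] with y hy
        exact hsupp _ (le_of_lt hy)
      rw [this.fderiv_eq, fderiv_const_apply, ← ofReal_norm, norm_zero, ENNReal.ofReal_zero,
        ENNReal.zero_rpow_of_pos two_pos]
    rw [hsub]
    refine lintegral_mono_ae (ae_restrict_of_ae ?_)
    filter_upwards [ht] with x hx
    gcongr
  gcongr
  exact hE t htI

/-- Parabolic embedding without weights. -/
theorem exists_parabolic_embedding (hn : 2 ≤ n) {p : ℝ} (hp : 2 < p)
    (hp' : (n : ℝ) * (p - 2) < 4) : ∃ C : ℝ≥0, ∀ (η : SpaceTime n → ℝ) (ρ R t₁ t₂ : ℝ)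
      (E : ℝ≥0∞), BddLip η → ρ < R → (∀ p, ρ ≤ ‖p.1‖ → η p = 0) →
      (∀ t ∈ Ioo t₁ t₂, ∫⁻ x, ‖η (x, t)‖ₑ ^ (2 : ℝ) ≤ E) →
      ∫⁻ p in tcyl n R t₁ t₂, ‖sgrad η p‖ₑ ^ (2 : ℝ) ≤ E → t₂ - t₁ ≤ 1 →
      ∫⁻ z in tcyl n R t₁ t₂, ‖η z‖ₑ ^ p ≤ C * E ^ (p / 2) := by
  have hp0 : 0 < p - 2 := by linarith
  have hn0 : (0 : ℝ) < n := by positivity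
  have hcond : ((n : ℝ) - 2) * (p - 2) ≤ 4 := by nlinarith
  obtain ⟨C, hC⟩ := exists_slice_gagliardo_nirenberg hn hp.le hcond
  refine ⟨C, fun η ρ R t₁ t₂ E hη hρ hsupp hE hD ht => ?_⟩
  set A := (n : ℝ) * (p - 2) / 4 with hA
  have hA0 : 0 < A := by positivity
  have hA1 : A < 1 := by rw [hA]; linarith
  have hB0 : 0 ≤ p / 2 - A := by rw [hA]; linarith
  have hm : Measurable fun z => ‖η z‖ₑ ^ p := hη.continuous.measurable.enorm.pow_const _
  have hmD := measurable_sliceDirichlet R η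
  -- Since `A < 1` and the time interval has length at most 1, Hölder bounds the integral of the
  -- power by the power of the integral.
  have hT : ∫⁻ t in Ioo t₁ t₂, sliceDirichlet R η t ^ A ≤ E ^ A := by
    have hc : (1 / A).HolderConjugate (Real.conjExponent (1 / A)) :=
      Real.HolderConjugate.conjExponent (by rw [lt_div_iff₀ hA0]; linarith)
    have := ENNReal.lintegral_mul_le_Lp_mul_Lq (volume.restrict (Ioo t₁ t₂)) hc
      (f := fun t => sliceDirichlet R η t ^ A) (g := fun _ => 1)
      (hmD.pow_const A).aemeasurable aemeasurable_const
    simp only [Pi.mul_apply, mul_one, ← ENNReal.rpow_mul, mul_one_div_cancel hA0.ne',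
      ENNReal.rpow_one, one_div_one_div, ENNReal.one_rpow, lintegral_one,
      Measure.restrict_apply_univ, Real.volume_Ioo] at this
    refine this.trans ?_
    rw [lintegral_sliceDirichlet]
    refine (mul_le_mul' (ENNReal.rpow_le_rpow hD hA0.le)
      (ENNReal.rpow_le_one (by simpa using ht) (one_div_nonneg.2 hc.symm.nonneg))).trans ?_
    rw [mul_one]
  calc ∫⁻ z in tcyl n R t₁ t₂, ‖η z‖ₑ ^ p
      = ∫⁻ t in Ioo t₁ t₂, ∫⁻ x in Metric.ball 0 R, ‖η (x, t)‖ₑ ^ p := by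
        rw [restrict_tcyl, lintegral_prod_symm _ hm.aemeasurable]
    _ ≤ ∫⁻ t in Ioo t₁ t₂, C * E ^ (p / 2 - A) * sliceDirichlet R η t ^ A := by
        refine lintegral_mono_ae ?_
        filter_upwards [hC η ρ R t₁ t₂ E hη hρ hsupp hE] with t ht
        exact (setLIntegral_le_lintegral _ _).trans ht
    _ = C * E ^ (p / 2 - A) * ∫⁻ t in Ioo t₁ t₂, sliceDirichlet R η t ^ A :=
        lintegral_const_mul _ (hmD.pow_const A)
    _ ≤ C * E ^ (p / 2 - A) * E ^ A := by gcongr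
    _ = C * E ^ (p / 2) := by
        rw [mul_assoc, ← ENNReal.rpow_add_of_nonneg _ _ hB0 hA0.le, sub_add_cancel]

/-- Parabolic embedding weighted by the drift. -/
theorem exists_parabolic_embedding_drift (hn : 2 ≤ n) {q q' l l' p : ℝ}
    (hq : q.HolderConjugate q') (hl : l.HolderConjugate l') (hp : p = 2 / q' + 4 / (n * l'))
    (hql : n / q + 2 / l < 2) : ∃ C : ℝ≥0, ∀ (b : SpaceTime n → EuclideanSpace ℝ (Fin n))
      (η : SpaceTime n → ℝ) (ρ R τ M t₁ t₂ : ℝ)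
      (E : ℝ≥0∞), DriftBound q l R τ M b → -4 ≤ t₁ → t₂ ≤ τ → 
      AEStronglyMeasurable b (volume.restrict (tcyl n R (-4) τ)) →
      BddLip η → ρ < R → (∀ p, ρ ≤ ‖p.1‖ → η p = 0) →
      (∀ t ∈ Ioo t₁ t₂, ∫⁻ x, ‖η (x, t)‖ₑ ^ (2 : ℝ) ≤ E) →
      ∫⁻ p in tcyl n R t₁ t₂, ‖sgrad η p‖ₑ ^ (2 : ℝ) ≤ E →
      ∫⁻ z in tcyl n R t₁ t₂, ‖b z‖ₑ * ‖η z‖ₑ ^ p ≤ C * ENNReal.ofReal M * E ^ (p / 2) := by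
  have hn0 : (0 : ℝ) < n := by positivity
  have hq0 := hq.pos
  have hq'0 := hq.symm.pos
  have hl0 := hl.pos
  have hl'0 := hl.symm.pos
  -- The exponent `p` is the one for which Hölder in space leaves the Dirichlet integral to the
  -- power `1 / l'`, exactly what Hölder in time against the drift can use.
  have hs : p * q' = 2 + 4 * q' / (n * l') := by rw [hp]; field_simp
  have hA : (n : ℝ) * (p * q' - 2) / 4 = q' / l' := by rw [hs]; field_simp; ring
  have hs2 : 2 ≤ p * q' := by rw [hs]; have : 0 ≤ 4 * q' / (n * l') := by positivity
                              linarith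
  -- In terms of `q` and `l` this reads `n / q + 2 / l ≤ 2 + n / l`, which the subcriticality of the
  -- drift implies.
  have hcond : ((n : ℝ) - 2) * (p * q' - 2) ≤ 4 := by
    have h1 : ((n : ℝ) - 2) * q' ≤ n * l' := by
      have i1 : q'⁻¹ = 1 - q⁻¹ := by linarith [hq.inv_add_inv_eq_one]
      have i2 : l'⁻¹ = 1 - l⁻¹ := by linarith [hl.inv_add_inv_eq_one]
      have h2n : (2 : ℝ) ≤ n := by exact_mod_cast hn
      have hli : 0 < l⁻¹ := inv_pos.2 hl0
      rw [div_eq_mul_inv, div_eq_mul_inv] at hql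
      have h3 : ((n : ℝ) - 2) * l'⁻¹ ≤ n * q'⁻¹ := by
        rw [i1, i2]; nlinarith
      have h4 := mul_le_mul_of_nonneg_right h3 (show 0 ≤ q' * l' by positivity)
      calc ((n : ℝ) - 2) * q' = ((n : ℝ) - 2) * l'⁻¹ * (q' * l') := by field_simp
        _ ≤ _ := h4
        _ = _ := by field_simp
    rw [hs, add_sub_cancel_left]
    calc ((n : ℝ) - 2) * (4 * q' / (n * l')) = 4 * (((n : ℝ) - 2) * q') / (n * l') := by ring
      _ ≤ 4 * (n * l') / (n * l') := by gcongr
      _ = 4 := by field_simp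
  obtain ⟨C, hC⟩ := exists_slice_gagliardo_nirenberg hn hs2 hcond
  rw [hA] at hC
  have hB0 : 0 ≤ p * q' / 2 - q' / l' := by rw [← hA]; linarith
  refine ⟨C ^ (1 / q'), fun b η ρ R τ M t₁ t₂ E hDr ht₁ ht₂ hb hη hρ hsupp hE hD => ?_⟩
  set B := Metric.ball (0 : EuclideanSpace ℝ (Fin n)) R
  have hI : Ioo t₁ t₂ ⊆ Ioo (-4) τ := Ioo_subset_Ioo ht₁ ht₂
  have hb1 : AEStronglyMeasurable b (volume.restrict (tcyl n R t₁ t₂)) :=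
    hb.mono_measure (Measure.restrict_mono (prod_mono le_rfl hI) le_rfl)
  rw [restrict_tcyl] at hb1
  have hm : Measurable fun z => ‖η z‖ₑ ^ p := hη.continuous.measurable.enorm.pow_const _
  have hmm : AEMeasurable (fun z => ‖b z‖ₑ * ‖η z‖ₑ ^ p)
      ((volume.restrict B).prod (volume.restrict (Ioo t₁ t₂))) := hb1.enorm.mul hm.aemeasurable
  have hmG : AEMeasurable (fun t => ∫⁻ x in B, ‖b (x, t)‖ₑ ^ q) (volume.restrict (Ioo t₁ t₂)) :=
    (hb1.enorm.pow_const q).lintegral_prod_left'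
  have hmD := measurable_sliceDirichlet R η
  have hsl : ∀ᵐ t ∂(volume.restrict (Ioo t₁ t₂)),
      AEStronglyMeasurable (fun x => b (x, t)) (volume.restrict B) := hb1.prodMk_right
  have hT : ∫⁻ t in Ioo t₁ t₂, (∫⁻ x in B, ‖b (x, t)‖ₑ ^ q) ^ (1 / q) *
      sliceDirichlet R η t ^ (1 / l') ≤ ENNReal.ofReal M * E ^ (1 / l') := by
    refine (ENNReal.lintegral_mul_le_Lp_mul_Lq _ hl (hmG.pow_const _)
      (hmD.pow_const _).aemeasurable).trans ?_
    have hi : 0 ≤ 1 / l' := by positivity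
    gcongr
    · calc (∫⁻ t in Ioo t₁ t₂, ((∫⁻ x in B, ‖b (x, t)‖ₑ ^ q) ^ (1 / q)) ^ l) ^ (1 / l)
          = (∫⁻ t in Ioo t₁ t₂, (∫⁻ x in B, ‖b (x, t)‖ₑ ^ q) ^ (l / q)) ^ (1 / l) := by
            congr 1
            refine lintegral_congr fun t => ?_
            rw [← ENNReal.rpow_mul]; congr 1; ring
        _ ≤ (ENNReal.ofReal M ^ l) ^ (1 / l) := by
            gcongr
            exact (lintegral_mono_set hI).trans hDr
        _ = ENNReal.ofReal M := by
            rw [← ENNReal.rpow_mul, mul_one_div_cancel hl0.ne', ENNReal.rpow_one]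
    · simp only [← ENNReal.rpow_mul, one_div_mul_cancel hl'0.ne', ENNReal.rpow_one]
      rw [lintegral_sliceDirichlet]
      exact hD
  have hq'i : 0 ≤ 1 / q' := by positivity
  calc ∫⁻ z in tcyl n R t₁ t₂, ‖b z‖ₑ * ‖η z‖ₑ ^ p
      = ∫⁻ t in Ioo t₁ t₂, ∫⁻ x in B, ‖b (x, t)‖ₑ * ‖η (x, t)‖ₑ ^ p := by
        rw [restrict_tcyl, lintegral_prod_symm _ hmm]
    _ ≤ ∫⁻ t in Ioo t₁ t₂, C ^ (1 / q') * E ^ (p / 2 - 1 / l') *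
          ((∫⁻ x in B, ‖b (x, t)‖ₑ ^ q) ^ (1 / q) * sliceDirichlet R η t ^ (1 / l')) := by
        refine lintegral_mono_ae ?_
        filter_upwards [hC η ρ R t₁ t₂ E hη hρ hsupp hE, hsl] with t ht hbt
        refine (ENNReal.lintegral_mul_le_Lp_mul_Lq _ hq hbt.enorm
          (hm.comp measurable_prodMk_right).aemeasurable).trans ?_
        have h1 : (∫⁻ x in B, (‖η (x, t)‖ₑ ^ p) ^ q') ^ (1 / q')
            ≤ C ^ (1 / q') * E ^ (p / 2 - 1 / l') * sliceDirichlet R η t ^ (1 / l') := by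
          simp only [← ENNReal.rpow_mul]
          refine (ENNReal.rpow_le_rpow ((setLIntegral_le_lintegral _ _).trans ht) hq'i).trans
            (le_of_eq ?_)
          rw [ENNReal.mul_rpow_of_nonneg _ _ hq'i, ENNReal.mul_rpow_of_nonneg _ _ hq'i,
            ← ENNReal.rpow_mul, ← ENNReal.rpow_mul]
          have x1 : (p * q' / 2 - q' / l') * (1 / q') = p / 2 - 1 / l' := by field_simp
          have x2 : q' / l' * (1 / q') = 1 / l' := by field_simp
          rw [x1, x2]
        refine (mul_le_mul_right h1 _).trans (le_of_eq ?_)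
        ring
    _ = C ^ (1 / q') * E ^ (p / 2 - 1 / l') * ∫⁻ t in Ioo t₁ t₂,
          (∫⁻ x in B, ‖b (x, t)‖ₑ ^ q) ^ (1 / q) * sliceDirichlet R η t ^ (1 / l') :=
        lintegral_const_mul'' _ ((hmG.pow_const _).mul (hmD.pow_const _).aemeasurable)
    _ ≤ C ^ (1 / q') * E ^ (p / 2 - 1 / l') * (ENNReal.ofReal M * E ^ (1 / l')) := by gcongr
    _ = C ^ (1 / q') * ENNReal.ofReal M * (E ^ (p / 2 - 1 / l') * E ^ (1 / l')) := by ring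
    _ = _ := by
        have h0 : 0 ≤ p / 2 - 1 / l' := by
          have : p / 2 - 1 / l' = (p * q' / 2 - q' / l') / q' := by field_simp
          rw [this]; positivity
        rw [← ENNReal.rpow_add_of_nonneg _ _ h0 (by positivity), sub_add_cancel,
          ENNReal.coe_rpow_of_nonneg _ hq'i]

/-! ### The barrier, the truncations and their energy. -/

theorem abs_fderiv_apply_le {E : Type*} [NormedAddCommGroup E] [NormedSpace ℝ E] {f : E → ℝ}
    {p v : E} {C : ℝ} (hf : DifferentiableAt ℝ f p) (hC : 0 ≤ C)
    (h : ∀ s : ℝ, |f (p + s • v) - f p| ≤ C * |s|) : |fderiv ℝ f p v| ≤ C := by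
  have h1 : HasDerivAt (fun s : ℝ => f (p + s • v)) (fderiv ℝ f p v) 0 :=
    hf.hasFDerivAt.hasLineDerivAt v
  exact h1.le_of_lip' hC (Eventually.of_forall fun s => by simpa using h s)

/-- A paraboloidal barrier. -/
noncomputable def barrier (r : ℝ) (p : SpaceTime n) : ℝ := 2 * r⁻¹ * ‖p.1‖ + 2 * max (-p.2) 0

theorem barrier_nonneg {r : ℝ} (hr : 0 < r) (p : SpaceTime n) : 0 ≤ barrier r p := by
  have := le_max_right (-p.2) 0
  have h2 : 0 ≤ 2 * r⁻¹ * ‖p.1‖ := by positivity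
  rw [barrier]; linarith

theorem barrier_lipschitz {r : ℝ} (hr : 0 < r) :
    LipschitzWith (2 * r⁻¹ + 2).toNNReal (barrier r : SpaceTime n → ℝ) := by
  refine LipschitzWith.of_dist_le_mul fun x y => ?_
  rw [Real.coe_toNNReal _ (by positivity), Real.dist_eq, barrier, barrier]
  have h1 : |‖x.1‖ - ‖y.1‖| ≤ dist x y :=
    (abs_norm_sub_norm_le _ _).trans ((dist_eq_norm x.1 y.1).ge.trans (le_max_left _ _))
  have h2 : |max (-x.2) 0 - max (-y.2) 0| ≤ dist x y := by
    refine (abs_max_sub_max_le_abs _ _ _).trans (le_trans (le_of_eq ?_) (le_max_right _ _))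
    rw [Real.dist_eq, ← abs_neg]; congr 1; ring
  have hri : 0 < r⁻¹ := inv_pos.2 hr
  calc |2 * r⁻¹ * ‖x.1‖ + 2 * max (-x.2) 0 - (2 * r⁻¹ * ‖y.1‖ + 2 * max (-y.2) 0)|
      = |2 * r⁻¹ * (‖x.1‖ - ‖y.1‖) + 2 * (max (-x.2) 0 - max (-y.2) 0)| := by congr 1; ring
    _ ≤ |2 * r⁻¹ * (‖x.1‖ - ‖y.1‖)| + |2 * (max (-x.2) 0 - max (-y.2) 0)| := abs_add_le _ _
    _ = 2 * r⁻¹ * |‖x.1‖ - ‖y.1‖| + 2 * |max (-x.2) 0 - max (-y.2) 0| := by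
        rw [abs_mul (2 * r⁻¹), abs_of_pos (by positivity : (0 : ℝ) < 2 * r⁻¹), abs_mul, abs_two]
    _ ≤ 2 * r⁻¹ * dist x y + 2 * dist x y := by gcongr
    _ = _ := by ring

/-- Time and space derivatives of the barrier are bounded separately: the joint Lipschitz constant
would hide the decay `2 / r` of the space gradient, on which the control of the drift rests. -/
theorem abs_timeDeriv_barrier_le {r : ℝ} {p : SpaceTime n}
    (h : DifferentiableAt ℝ (barrier r) p) : |timeDeriv (barrier r) p| ≤ 2 := by
  refine abs_fderiv_apply_le h zero_le_two fun s => ?_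
  have h2 := abs_max_sub_max_le_abs (-(p.2 + s)) (-p.2) 0
  rw [show -(p.2 + s) - -p.2 = -s by ring, abs_neg] at h2
  calc |barrier r (p + s • (0, 1)) - barrier r p|
      = |2 * (max (-(p.2 + s)) 0 - max (-p.2) 0)| := by
        congr 1
        simp only [barrier, Prod.fst_add, Prod.smul_fst, smul_zero, add_zero, Prod.snd_add,
          Prod.smul_snd, smul_eq_mul, mul_one]
        ring
    _ ≤ 2 * |s| := by rw [abs_mul, abs_two]; gcongr

theorem norm_sgrad_barrier_le {r : ℝ} (hr : 0 < r) {p : SpaceTime n}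
    (h : DifferentiableAt ℝ (barrier r) p) : ‖sgrad (barrier r) p‖ ≤ 2 * r⁻¹ := by
  have h1 : ∀ v, |fderiv ℝ (barrier r) p (v, 0)| ≤ 2 * r⁻¹ * ‖v‖ := fun v => by
    refine abs_fderiv_apply_le h (by positivity) fun s => ?_
    calc |barrier r (p + s • (v, 0)) - barrier r p|
        = |2 * r⁻¹ * (‖p.1 + s • v‖ - ‖p.1‖)| := by
          congr 1
          simp only [barrier, Prod.fst_add, Prod.smul_fst, Prod.snd_add,
            Prod.smul_snd, smul_zero, add_zero]
          ring
      _ ≤ 2 * r⁻¹ * (|s| * ‖v‖) := by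
          rw [abs_mul, abs_of_pos (by positivity : (0 : ℝ) < 2 * r⁻¹)]
          gcongr
          refine (abs_norm_sub_norm_le _ _).trans ?_
          rw [add_sub_cancel_left, norm_smul, Real.norm_eq_abs]
      _ = _ := by ring
  have h2 := (le_abs_self _).trans (h1 (sgrad (barrier r) p))
  rw [← inner_sgrad] at h2
  have h3 : ∑ i, sgrad (barrier r) p i * spaceDeriv i (barrier r) p = ‖sgrad (barrier r) p‖ ^ 2 := by
    rw [EuclideanSpace.norm_sq_eq]
    refine Finset.sum_congr rfl fun i _ => ?_
    rw [Real.norm_eq_abs, sq_abs, sgrad_apply, pow_two]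
  rw [h3, pow_two] at h2
  by_contra hc
  rw [not_le] at hc
  have : 0 < ‖sgrad (barrier r) p‖ := lt_of_le_of_lt (by positivity) hc
  exact absurd (le_of_mul_le_mul_right h2 this) (not_le.2 hc)

/-- The truncations used in the level set iteration. -/
noncomputable def trunc (r κ k : ℝ) (u : SpaceTime n → ℝ) (p : SpaceTime n) : ℝ :=
  max (1 - barrier r p - κ⁻¹ * u p - k) 0

section trunc

variable {r κ k : ℝ} {u : SpaceTime n → ℝ}

theorem trunc_nonneg (p : SpaceTime n) : 0 ≤ trunc r κ k u p := le_max_right _ _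

theorem trunc_le_one (hr : 0 < r) (hκ : 0 < κ) (hk : 0 ≤ k) (hu01 : ∀ p, u p ∈ Icc (0 : ℝ) 1)
    (p : SpaceTime n) : trunc r κ k u p ≤ 1 := by
  have h1 := barrier_nonneg hr p
  have h2 : 0 ≤ κ⁻¹ * u p := mul_nonneg (inv_nonneg.2 hκ.le) (hu01 p).1
  exact max_le (by linarith) zero_le_one

theorem trunc_bddLip (hr : 0 < r) (hκ : 0 < κ) (hk : 0 ≤ k) (hL : ∃ L, LipschitzWith L u)
    (hu01 : ∀ p, u p ∈ Icc (0 : ℝ) 1) : BddLip (trunc r κ k u) := by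
  obtain ⟨L, hL⟩ := hL
  have h1 : LipschitzWith _ fun p => κ⁻¹ * u p :=
    (lipschitzWith_smul κ⁻¹ : LipschitzWith _ fun x : ℝ => κ⁻¹ • x).comp hL
  have h2 := (((LipschitzWith.const (α := SpaceTime n) (1 : ℝ)).sub (barrier_lipschitz hr)).sub h1).sub
    (LipschitzWith.const k)
  exact ⟨⟨_, h2.max_const 0⟩, 1, fun p => by
    rw [abs_of_nonneg (trunc_nonneg p)]; exact trunc_le_one hr hκ hk hu01 p⟩

theorem trunc_eq_zero (hκ : 0 < κ) (hk : 0 ≤ k) (hu01 : ∀ p, u p ∈ Icc (0 : ℝ) 1)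
    {p : SpaceTime n} (hp : 1 ≤ barrier r p) : trunc r κ k u p = 0 := by
  have h2 : 0 ≤ κ⁻¹ * u p := mul_nonneg (inv_nonneg.2 hκ.le) (hu01 p).1
  exact max_eq_right (by linarith)

/-- Together with `one_le_barrier_of_time`, this makes every truncation with nonnegative level
vanish outside the ball of radius `r / 2` and up to time `-1 / 2`. The truncations are their own
cutoffs, and no initial term enters the energy inequality. -/
theorem one_le_barrier_of_norm (hr : 0 < r) {p : SpaceTime n} (hp : r / 2 ≤ ‖p.1‖) :
    1 ≤ barrier r p := by
  have h1 := mul_le_mul_of_nonneg_left hp (show 0 ≤ 2 * r⁻¹ by positivity)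
  have h2 : 2 * r⁻¹ * (r / 2) = 1 := by field_simp
  have := le_max_right (-p.2) 0
  rw [barrier]; linarith

theorem one_le_barrier_of_time (hr : 0 < r) {p : SpaceTime n} (hp : p.2 ≤ -1 / 2) :
    1 ≤ barrier r p := by
  have := le_max_left (-p.2) 0
  have h2 : 0 ≤ 2 * r⁻¹ * ‖p.1‖ := by positivity
  rw [barrier]; linarith

end trunc

namespace LocalSol

variable {ν Ca r τ κ k : ℝ} {a : SpaceTime n → Matrix (Fin n) (Fin n) ℝ}
  {b : SpaceTime n → EuclideanSpace ℝ (Fin n)} {u : SpaceTime n → ℝ}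

/-- The constant of the energy inequality for truncations. -/
noncomputable def truncConst (n : ℕ) (ν Ca : ℝ) : ℝ := 2 + ((n : ℝ) ^ 2 * Ca * 2) ^ 2 / (2 * ν)

/-- Where the truncation `η` is positive, `Du = -κ (Dη + D barrier)`. Substituting this eliminates
`u`: the quadratic term is the energy of `η`, the cross term is absorbed by half of it, and `b`
meets only `η` times the gradient of the barrier, of size `2 / r`. -/
theorem energyDensity_trunc_ge (h : LocalSol ν Ca (2 * r) τ a b u) (hν : 0 < ν) (hCa : 0 ≤ Ca)
    (hr : 1 ≤ r) (hκ : 0 < κ) (hk : 0 ≤ k) (hu01 : ∀ p, u p ∈ Icc (0 : ℝ) 1) :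
    ∀ᵐ p ∂(volume.restrict (cyl n (2 * r) τ)),
      ν / 2 * ‖sgrad (trunc r κ k u) p‖ ^ 2
        - {p | 0 < trunc r κ k u p}.indicator
          (fun p => truncConst n ν Ca * (1 + r⁻¹ * ‖b p‖)) p
      ≤ energyDensity a b u (fun p => trunc r κ k u p ^ 2 / 2)
          (fun p => -κ⁻¹ * trunc r κ k u p) p := by
  have hr0 : 0 < r := by linarith
  obtain ⟨Kη, hKη⟩ := (trunc_bddLip hr0 hκ hk h.lip hu01).1
  obtain ⟨L, hL⟩ := h.lip
  filter_upwards [ae_restrict_of_ae hL.ae_differentiableAt,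
    ae_restrict_of_ae hKη.ae_differentiableAt,
    ae_restrict_of_ae (barrier_lipschitz (n := n) hr0).ae_differentiableAt, h.bdd, h.ell]
    with p hu hηd hφ ha hell
  set η := trunc r κ k u with hη
  have hη0 : 0 ≤ η p := trunc_nonneg p
  have hη1 : η p ≤ 1 := trunc_le_one hr0 hκ hk hu01 p
  have hF : ∀ v, fderiv ℝ (fun p => η p ^ 2 / 2) p v = η p * fderiv ℝ η p v := fun v => by
    have h1 : HasFDerivAt (fun p => η p ^ 2 / 2) _ p := (hηd.hasFDerivAt.pow 2).mul_const (2⁻¹ : ℝ)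
    rw [h1.fderiv]
    simp
    ring
  have hg : ∀ v, fderiv ℝ (fun p => -κ⁻¹ * η p) p v = -κ⁻¹ * fderiv ℝ η p v := fun v => by
    have h1 : HasFDerivAt (fun p => -κ⁻¹ * η p) _ p := hηd.hasFDerivAt.const_mul (-κ⁻¹)
    rw [h1.fderiv]
    simp
  rcases hη0.eq_or_lt with h0 | h0
  -- A point of differentiability where `η` vanishes is a minimum of `η`, so its derivative is zero
  -- and both sides vanish.
  · have hD : fderiv ℝ η p = 0 := IsLocalMin.fderiv_eq_zero
      (Eventually.of_forall fun x => by rw [← h0]; exact trunc_nonneg x)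
    have hs : sgrad η p = 0 := by ext i; simp [sgrad_apply, spaceDeriv, hD]
    rw [indicator_of_notMem (by simp [← h0]), hs, norm_zero, energyDensity]
    simp only [timeDeriv, spaceDeriv, hF, hg, hD, ← h0]
    simp
  · have hev : η =ᶠ[𝓝 p] fun p => 1 - barrier r p - κ⁻¹ * u p - k := by
      have hc : ContinuousAt η p := hηd.continuousAt
      filter_upwards [hc.eventually (lt_mem_nhds h0)] with x hx
      rw [hη, trunc] at hx ⊢
      exact max_eq_left ((lt_max_iff.1 hx).resolve_right (lt_irrefl _)).le
    have hη' : ∀ v, fderiv ℝ η p v = -fderiv ℝ (barrier r) p v - κ⁻¹ * fderiv ℝ u p v := fun v => by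
      have h1 : HasFDerivAt (fun p => 1 - barrier r p - κ⁻¹ * u p - k) _ p :=
        (((hφ.hasFDerivAt.const_sub 1).sub (hu.hasFDerivAt.const_mul κ⁻¹)).sub_const k)
      rw [hev.fderiv_eq, h1.fderiv]
      simp
    have hu' : ∀ v, fderiv ℝ u p v = -κ * (fderiv ℝ η p v + fderiv ℝ (barrier r) p v) := fun v => by
      rw [hη']; field_simp; ring
    rw [indicator_of_mem (show p ∈ {p | 0 < η p} from h0)]
    have e1 : ∑ i, ∑ j, a p i j * spaceDeriv j u p * spaceDeriv i (fun p => -κ⁻¹ * η p) p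
        = ∑ i, ∑ j, a p i j * sgrad η p i * sgrad η p j
          + ∑ i, ∑ j, a p i j * sgrad (barrier r) p j * sgrad η p i := by
      simp only [← Finset.sum_add_distrib]
      refine Finset.sum_congr rfl fun i _ => Finset.sum_congr rfl fun j _ => ?_
      simp only [sgrad_apply, spaceDeriv, hg, hu']
      field_simp
    have e2 : timeDeriv (fun p => η p ^ 2 / 2) p - timeDeriv u p * (-κ⁻¹ * η p)
        = -(η p * timeDeriv (barrier r) p) := by
      simp only [timeDeriv, hF, hu']
      field_simp
      ring
    have e3 : ∑ i, b p i * (spaceDeriv i (fun p => η p ^ 2 / 2) p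
        - spaceDeriv i u p * (-κ⁻¹ * η p)) = -(η p * ∑ i, b p i * sgrad (barrier r) p i) := by
      rw [Finset.mul_sum, ← Finset.sum_neg_distrib]
      refine Finset.sum_congr rfl fun i _ => ?_
      simp only [sgrad_apply, spaceDeriv, hF, hu']
      field_simp
      ring
    rw [energyDensity, e1, e2, e3]
    have f1 := hell (sgrad η p)
    have f2 := (abs_le.1 (form_abs_le ha (sgrad (barrier r) p) (sgrad η p))).1
    have f3 := (abs_le.1 (abs_sum_mul_le (b p) (sgrad (barrier r) p))).1
    have f4 := (abs_le.1 (abs_timeDeriv_barrier_le hφ)).1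
    have f5 := norm_sgrad_barrier_le hr0 hφ
    have hri : 0 < r⁻¹ := inv_pos.2 hr0
    have hri1 : r⁻¹ ≤ 1 := inv_le_one_of_one_le₀ hr
    set X := ‖sgrad η p‖ with hX
    have hX0 : 0 ≤ X := norm_nonneg _
    set Y := ‖sgrad (barrier r) p‖ with hY
    set S := (n : ℝ) ^ 2 * Ca * 2 with hS
    have hS0 : 0 ≤ S := by positivity
    have g2 : (n : ℝ) ^ 2 * Ca * (Y * X) ≤ S * X := by
      have : (n : ℝ) ^ 2 * Ca * (Y * X) ≤ (n : ℝ) ^ 2 * Ca * (2 * X) := by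
        gcongr; linarith
      rw [hS]; linarith
    have g3 : S * X ≤ ν / 2 * X ^ 2 + S ^ 2 / (2 * ν) := by
      have h1 : 0 ≤ (ν * X - S) ^ 2 / (2 * ν) := by positivity
      have h2 : (ν * X - S) ^ 2 / (2 * ν) = ν / 2 * X ^ 2 + S ^ 2 / (2 * ν) - S * X := by
        field_simp; ring
      linarith
    have g4 : -2 ≤ η p * timeDeriv (barrier r) p := by
      nlinarith
    have g5 : -(2 * (r⁻¹ * ‖b p‖)) ≤ η p * ∑ i, b p i * sgrad (barrier r) p i := by
      have h1 : ‖b p‖ * Y ≤ 2 * (r⁻¹ * ‖b p‖) := by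
        calc ‖b p‖ * Y ≤ ‖b p‖ * (2 * r⁻¹) := by gcongr
          _ = _ := by ring
      have h2 := mul_le_mul_of_nonneg_left (f3.trans' (neg_le_neg h1)) hη0
      have h3 : 0 ≤ 2 * (r⁻¹ * ‖b p‖) := by positivity
      nlinarith
    have g6 : 2 + S ^ 2 / (2 * ν) + 2 * (r⁻¹ * ‖b p‖) ≤ truncConst n ν Ca * (1 + r⁻¹ * ‖b p‖) := by
      rw [truncConst, ← hS]
      have h3 : 0 ≤ S ^ 2 / (2 * ν) * (r⁻¹ * ‖b p‖) := by positivity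
      linarith
    linarith

/-- Energy inequality for the truncations. -/
theorem trunc_energy (h : LocalSol ν Ca (2 * r) τ a b u) (hν : 0 < ν) (hCa : 0 ≤ Ca)
    (hr : 1 ≤ r) (hκ : 0 < κ) (hk : 0 ≤ k) (hu01 : ∀ p, u p ∈ Icc (0 : ℝ) 1) {t₂ : ℝ}
    (ht₂ : -1 / 2 < t₂) (ht₂' : t₂ < τ) :
    (∫ x in Metric.ball (0 : EuclideanSpace ℝ (Fin n)) (2 * r), trunc r κ k u (x, t₂) ^ 2 / 2)
      + ν / 2 * ∫ p in tcyl n (2 * r) (-1 / 2) t₂, ‖sgrad (trunc r κ k u) p‖ ^ 2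
    ≤ ∫ p in tcyl n (2 * r) (-1 / 2) t₂, {p | 0 < trunc r κ k u p}.indicator
          (fun p => truncConst n ν Ca * (1 + r⁻¹ * ‖b p‖)) p := by
  have hr0 : 0 < r := by linarith
  have hη := trunc_bddLip hr0 hκ hk h.lip hu01
  obtain ⟨Kη, hKη⟩ := hη.1
  have hsupp : ∀ p : SpaceTime n, r / 2 ≤ ‖p.1‖ → trunc r κ k u p = 0 := fun p hp =>
    trunc_eq_zero hκ hk hu01 (one_le_barrier_of_norm hr0 hp)
  have hF : BddLip fun p => trunc r κ k u p ^ 2 / 2 := by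
    have hc : BddLip fun _ : SpaceTime n => (2⁻¹ : ℝ) :=
      ⟨⟨0, LipschitzWith.const _⟩, |2⁻¹|, fun _ => le_rfl⟩
    simpa only [div_eq_mul_inv] using (hη.pow 2).mul hc
  have hg : BddLip fun p => -κ⁻¹ * trunc r κ k u p := by
    have hc : BddLip fun _ : SpaceTime n => -κ⁻¹ :=
      ⟨⟨0, LipschitzWith.const _⟩, |-κ⁻¹|, fun _ => le_rfl⟩
    exact hc.mul hη
  have key := h.energy hF hg (fun p => by positivity) (ρ := r / 2) (by linarith)
    (fun p hp => by rw [hsupp p hp]; simp) (fun p hp => by rw [hsupp p hp]; simp)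
    (t₁ := -1 / 2) (by norm_num) ht₂ ht₂'
  have hz : ∀ x : EuclideanSpace ℝ (Fin n), trunc r κ k u (x, -1 / 2) = 0 := fun x =>
    trunc_eq_zero hκ hk hu01 (one_le_barrier_of_time hr0 le_rfl)
  simp only [hz] at key
  have hsub : tcyl n (2 * r) (-1 / 2) t₂ ⊆ cyl n (2 * r) τ := tcyl_subset_cyl (by norm_num) ht₂'.le
  have hfin := isFiniteMeasure_tcyl (n := n) (2 * r) (-1 / 2) t₂
  have hs := bddMeas_norm_sgrad (μ := volume.restrict (tcyl n (2 * r) (-1 / 2) t₂)) hKη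
  have I1 : IntegrableOn (fun p => ‖sgrad (trunc r κ k u) p‖ ^ 2) (tcyl n (2 * r) (-1 / 2) t₂) := by
    have := (hs.mul hs).integrable
    change Integrable _ _
    simpa only [pow_two] using this
  have hSm : MeasurableSet {p | 0 < trunc r κ k u p} :=
    measurableSet_lt measurable_const hη.continuous.measurable
  have I2 : IntegrableOn ({p | 0 < trunc r κ k u p}.indicator
      (fun p => truncConst n ν Ca * (1 + r⁻¹ * ‖b p‖))) (tcyl n (2 * r) (-1 / 2) t₂) :=
    (((integrable_const _).add ((h.int.mono_set hsub).norm.const_mul _)).const_mul _).indicator hSm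
  have hmon := integral_mono_ae ((I1.const_mul (ν / 2)).sub I2)
    ((h.integrable_energyDensity hF hg).mono_set hsub)
    (ae_mono (Measure.restrict_mono hsub le_rfl)
      (h.energyDensity_trunc_ge hν hCa hr hκ hk hu01))
  have e := integral_sub (I1.const_mul (ν / 2)) I2
  simp only [Pi.sub_apply] at hmon
  rw [e, integral_const_mul] at hmon
  simp only [tcyl] at hmon ⊢
  norm_num at key hmon ⊢
  linarith

end LocalSol

/-! ### Drift-weighted mass of level sets and the De Giorgi iteration. -/

/-- The mass of a set with respect to the measure with density `1 + |b| / r`. -/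
noncomputable def driftMass (r τ : ℝ) (b : SpaceTime n → EuclideanSpace ℝ (Fin n))
    (S : Set (SpaceTime n)) : ℝ≥0∞ :=
  ∫⁻ p in tcyl n (2 * r) (-1 / 2) τ, S.indicator (fun p => 1 + ENNReal.ofReal r⁻¹ * ‖b p‖ₑ) p

theorem enorm_rpow_two (x : ℝ) : ‖x‖ₑ ^ (2 : ℝ) = ENNReal.ofReal (x ^ 2) := by
  rw [← ofReal_norm, ENNReal.ofReal_rpow_of_nonneg (norm_nonneg _) zero_le_two, Real.rpow_two,
    Real.norm_eq_abs, sq_abs]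

namespace LocalSol

variable {ν Ca r τ κ k : ℝ} {a : SpaceTime n → Matrix (Fin n) (Fin n) ℝ}
  {b : SpaceTime n → EuclideanSpace ℝ (Fin n)} {u : SpaceTime n → ℝ}

theorem truncConst_nonneg (hν : 0 < ν) : 0 ≤ truncConst n ν Ca := by
  rw [truncConst]; positivity

theorem ofReal_integral_indicator_le (h : LocalSol ν Ca (2 * r) τ a b u) (hν : 0 < ν) (hr : 0 < r)
    {S : Set (SpaceTime n)} (hS : MeasurableSet S) {t₂ τ' : ℝ} (ht : t₂ ≤ τ') (hτ : τ' ≤ τ) :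
    ENNReal.ofReal (∫ p in tcyl n (2 * r) (-1 / 2) t₂, S.indicator
      (fun p => truncConst n ν Ca * (1 + r⁻¹ * ‖b p‖)) p)
      ≤ ENNReal.ofReal (truncConst n ν Ca) * driftMass r τ' b S := by
  have hC := truncConst_nonneg (n := n) (Ca := Ca) hν
  have hsub : tcyl n (2 * r) (-1 / 2) t₂ ⊆ cyl n (2 * r) τ :=
    tcyl_subset_cyl (by norm_num) (ht.trans hτ)
  have hfin := isFiniteMeasure_tcyl (n := n) (2 * r) (-1 / 2) t₂
  have I2 : IntegrableOn (S.indicator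
      (fun p => truncConst n ν Ca * (1 + r⁻¹ * ‖b p‖))) (tcyl n (2 * r) (-1 / 2) t₂) :=
    (((integrable_const _).add ((h.int.mono_set hsub).norm.const_mul _)).const_mul _).indicator hS
  rw [ofReal_integral_eq_lintegral_ofReal I2 (Eventually.of_forall fun p =>
    indicator_nonneg (fun p _ => by positivity) p), driftMass,
    ← lintegral_const_mul' _ _ ENNReal.ofReal_ne_top]
  refine (lintegral_mono_set (prod_mono le_rfl (Ioo_subset_Ioo_right ht))).trans
    (lintegral_mono fun p => le_of_eq ?_)
  by_cases hp : p ∈ S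
  · rw [indicator_of_mem hp, indicator_of_mem hp, ENNReal.ofReal_mul hC,
      ENNReal.ofReal_add zero_le_one (by positivity), ENNReal.ofReal_one,
      ENNReal.ofReal_mul (inv_nonneg.2 hr.le), ofReal_norm]
  · rw [indicator_of_notMem hp, indicator_of_notMem hp, ENNReal.ofReal_zero, mul_zero]

/-- Both parts of the energy are bounded by one quantity, which plays the role of `E` in the
parabolic embeddings. -/
theorem trunc_energy_lintegral (h : LocalSol ν Ca (2 * r) τ a b u) (hν : 0 < ν) (hCa : 0 ≤ Ca)
    (hr : 1 ≤ r) (hκ : 0 < κ) (hk : 0 ≤ k) (hu01 : ∀ p, u p ∈ Icc (0 : ℝ) 1) {τ' : ℝ}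
    (hτ0 : -1 / 2 < τ') (hτ' : τ' < τ) :
    (∀ t ∈ Ioo (-1 / 2) τ', ∫⁻ x, ‖trunc r κ k u (x, t)‖ₑ ^ (2 : ℝ)
      ≤ ENNReal.ofReal (2 * truncConst n ν Ca * (1 + ν⁻¹)) *
        driftMass r τ' b {p | 0 < trunc r κ k u p}) ∧
    ∫⁻ p in tcyl n (2 * r) (-1 / 2) τ', ‖sgrad (trunc r κ k u) p‖ₑ ^ (2 : ℝ)
      ≤ ENNReal.ofReal (2 * truncConst n ν Ca * (1 + ν⁻¹)) *
        driftMass r τ' b {p | 0 < trunc r κ k u p} := by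
  have hr0 : 0 < r := by linarith
  have hC := truncConst_nonneg (n := n) (Ca := Ca) hν
  have hη := trunc_bddLip hr0 hκ hk h.lip hu01
  obtain ⟨Kη, hKη⟩ := hη.1
  have hSm : MeasurableSet {p | 0 < trunc r κ k u p} :=
    measurableSet_lt measurable_const hη.continuous.measurable
  have hνi : 0 < ν⁻¹ := inv_pos.2 hν
  constructor
  · intro t ht
    have key := h.trunc_energy hν hCa hr hκ hk hu01 ht.1 (ht.2.trans hτ')
    have h0 : 0 ≤ ν / 2 * ∫ p in tcyl n (2 * r) (-1 / 2) t, ‖sgrad (trunc r κ k u) p‖ ^ 2 :=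
      mul_nonneg (by positivity) (integral_nonneg fun p => sq_nonneg _)
    have h1 := (ENNReal.ofReal_le_ofReal (show _ ≤ _ by linarith)).trans
      (h.ofReal_integral_indicator_le hν hr0 hSm ht.2.le hτ'.le) (a := ENNReal.ofReal
        (∫ x in Metric.ball (0 : EuclideanSpace ℝ (Fin n)) (2 * r), trunc r κ k u (x, t) ^ 2 / 2))
    have hsl : BddLip fun x : EuclideanSpace ℝ (Fin n) => trunc r κ k u (x, t) ^ 2 / 2 := by
      have hc : BddLip fun _ : EuclideanSpace ℝ (Fin n) => (2⁻¹ : ℝ) :=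
        ⟨⟨0, LipschitzWith.const _⟩, |2⁻¹|, fun _ => le_rfl⟩
      simpa only [div_eq_mul_inv] using
        ((hη.comp (LipschitzWith.prodMk_right t)).pow 2).mul hc
    rw [← lintegral_ball_le_of_integral hsl fun x => by positivity] at h1
    have e1 : ∫⁻ x, ‖trunc r κ k u (x, t)‖ₑ ^ (2 : ℝ)
        = 2 * ∫⁻ x in Metric.ball (0 : EuclideanSpace ℝ (Fin n)) (2 * r),
          ENNReal.ofReal (trunc r κ k u (x, t) ^ 2 / 2) := by
      rw [← lintegral_const_mul' _ _ (by simp)]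
      rw [← setLIntegral_eq_of_support_subset (s := Metric.ball (0 : EuclideanSpace ℝ (Fin n)) (2 * r))]
      · refine lintegral_congr fun x => ?_
        rw [enorm_rpow_two, ← ENNReal.ofReal_ofNat, ← ENNReal.ofReal_mul zero_le_two]
        congr 1
        ring
      · intro x hx
        by_contra hc
        have hxr : 2 * r ≤ ‖x‖ := by simpa using hc
        refine hx ?_
        beta_reduce
        rw [trunc_eq_zero hκ hk hu01 (one_le_barrier_of_norm hr0 (by simpa using by linarith)),
          enorm_zero, ENNReal.zero_rpow_of_pos two_pos]
    rw [e1]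
    calc _ ≤ 2 * (ENNReal.ofReal (truncConst n ν Ca) * _) := mul_le_mul_right h1 _
      _ = ENNReal.ofReal (2 * truncConst n ν Ca) * _ := by
        rw [ENNReal.ofReal_mul zero_le_two, ENNReal.ofReal_ofNat, mul_assoc]
      _ ≤ _ := by
        refine mul_le_mul_left (ENNReal.ofReal_le_ofReal ?_) _
        exact le_mul_of_one_le_right (by positivity) (by linarith)
  · have key := h.trunc_energy hν hCa hr hκ hk hu01 hτ0 hτ'
    have h0 : 0 ≤ ∫ x in Metric.ball (0 : EuclideanSpace ℝ (Fin n)) (2 * r),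
        trunc r κ k u (x, τ') ^ 2 / 2 := integral_nonneg fun p => by positivity
    have hfin := isFiniteMeasure_tcyl (n := n) (2 * r) (-1 / 2) τ'
    have hs := bddMeas_norm_sgrad (μ := volume.restrict (tcyl n (2 * r) (-1 / 2) τ')) hKη
    have I1 : Integrable (fun p => ‖sgrad (trunc r κ k u) p‖ ^ 2)
        (volume.restrict (tcyl n (2 * r) (-1 / 2) τ')) := by
      simpa only [pow_two] using (hs.mul hs).integrable
    have e1 : ∫⁻ p in tcyl n (2 * r) (-1 / 2) τ', ‖sgrad (trunc r κ k u) p‖ₑ ^ (2 : ℝ)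
        = ENNReal.ofReal (∫ p in tcyl n (2 * r) (-1 / 2) τ', ‖sgrad (trunc r κ k u) p‖ ^ 2) := by
      rw [ofReal_integral_eq_lintegral_ofReal I1 (Eventually.of_forall fun p => sq_nonneg _)]
      refine lintegral_congr fun p => ?_
      rw [← enorm_rpow_two, enorm_norm]
    rw [e1]
    set J := ∫ p in tcyl n (2 * r) (-1 / 2) τ', ‖sgrad (trunc r κ k u) p‖ ^ 2
    set I := ∫ p in tcyl n (2 * r) (-1 / 2) τ', {p | 0 < trunc r κ k u p}.indicator
          (fun p => truncConst n ν Ca * (1 + r⁻¹ * ‖b p‖)) p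
    have hJ : J ≤ 2 * ν⁻¹ * I := by
      have h2 : ν / 2 * J ≤ I := by linarith
      calc J = 2 * ν⁻¹ * (ν / 2 * J) := by field_simp
        _ ≤ _ := by gcongr
    calc _ ≤ ENNReal.ofReal (2 * ν⁻¹ * I) := ENNReal.ofReal_le_ofReal hJ
      _ = ENNReal.ofReal (2 * ν⁻¹) * ENNReal.ofReal I := ENNReal.ofReal_mul (by positivity)
      _ ≤ ENNReal.ofReal (2 * ν⁻¹) * (ENNReal.ofReal (truncConst n ν Ca) * _) :=
        mul_le_mul_right (h.ofReal_integral_indicator_le hν hr0 hSm le_rfl hτ'.le) _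
      _ = ENNReal.ofReal (2 * ν⁻¹ * truncConst n ν Ca) * _ := by
        rw [ENNReal.ofReal_mul (p := 2 * ν⁻¹) (by positivity), mul_assoc]
      _ ≤ _ := by
        refine mul_le_mul_left (ENNReal.ofReal_le_ofReal ?_) _
        nlinarith

end LocalSol

/-- Level sets of a nonnegative solution contract superlinearly. -/
theorem exists_driftMass_contraction {ν Ca q q' l l' p : ℝ} (hn : 2 ≤ n) (hν : 0 < ν)
    (hCa : 0 ≤ Ca) (hq : q.HolderConjugate q') (hl : l.HolderConjugate l')
    (hp : p = 2 / q' + 4 / (n * l')) (hp2 : 2 < p) (hp' : (n : ℝ) * (p - 2) < 4)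
    (hql : n / q + 2 / l < 2) : ∃ C : ℝ, 0 < C ∧ ∀ (r M κ τ τ' h k : ℝ)
      (a : SpaceTime n → Matrix (Fin n) (Fin n) ℝ)
      (b : SpaceTime n → EuclideanSpace ℝ (Fin n)) (u : SpaceTime n → ℝ),
      1 ≤ r → 4 * M ≤ r → 0 < κ → -1 / 2 < τ' → τ' < τ → τ ≤ 0 → LocalSol ν Ca (2 * r) τ a b u →
      (∀ p, u p ∈ Icc (0 : ℝ) 1) → DriftBound q l (2 * r) τ M b → 0 ≤ h → h < k →
      ENNReal.ofReal ((k - h) ^ p) * driftMass r τ' b {z | 0 < trunc r κ k u z}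
        ≤ ENNReal.ofReal C * driftMass r τ' b {z | 0 < trunc r κ h u z} ^ (p / 2) := by
  obtain ⟨C₁, hC₁⟩ := exists_parabolic_embedding hn hp2 hp'
  obtain ⟨C₂, hC₂⟩ := exists_parabolic_embedding_drift hn hq hl hp hql
  set D := 2 * LocalSol.truncConst n ν Ca * (1 + ν⁻¹) with hD
  have hνi : 0 < ν⁻¹ := inv_pos.2 hν
  have hD0 : 0 ≤ D := by
    have := LocalSol.truncConst_nonneg (n := n) (Ca := Ca) hν
    positivity
  have hp0 : 0 ≤ p / 2 := by linarith
  refine ⟨(C₁ + C₂) * D ^ (p / 2) + 1, by positivity, ?_⟩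
  intro r M κ τ τ' h k a b u hr hM hκ hτ0 hτ' hτ hsol hu01 hDr hh hk
  have hr0 : 0 < r := by linarith
  obtain ⟨e1, e2⟩ := hsol.trunc_energy_lintegral hν hCa hr hκ hh hu01 hτ0 hτ'
  rw [← hD] at e1 e2
  set E := ENNReal.ofReal D * driftMass r τ' b {z | 0 < trunc r κ h u z} with hE
  have hη := trunc_bddLip hr0 hκ hh hsol.lip hu01
  have hsupp : ∀ p : SpaceTime n, r / 2 ≤ ‖p.1‖ → trunc r κ h u p = 0 := fun p hp =>
    trunc_eq_zero hκ hh hu01 (one_le_barrier_of_norm hr0 hp)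
  have f1 := hC₁ _ _ (2 * r) _ _ E hη (by linarith) hsupp e1 e2 (by linarith)
  have f2 := hC₂ b _ _ (2 * r) τ M _ _ E hDr (by norm_num) hτ'.le hsol.int.1 hη (by linarith) hsupp e1 e2
  have hbm : AEStronglyMeasurable b (volume.restrict (tcyl n (2 * r) (-1 / 2) τ')) :=
    hsol.int.1.mono_measure (Measure.restrict_mono (tcyl_subset_cyl (by norm_num) hτ'.le) le_rfl)
  have hpm : Measurable fun z => ‖trunc r κ h u z‖ₑ ^ p := hη.continuous.measurable.enorm.pow_const _
  -- Chebyshev for the density `1 + |b| / r`: wherever the truncation at level `k` is positive, the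
  -- one at level `h` exceeds `k - h`. The two summands of the density call for the two embeddings.
  calc ENNReal.ofReal ((k - h) ^ p) * driftMass r τ' b {z | 0 < trunc r κ k u z}
      ≤ ∫⁻ z in tcyl n (2 * r) (-1 / 2) τ', (‖trunc r κ h u z‖ₑ ^ p
        + ENNReal.ofReal r⁻¹ * (‖b z‖ₑ * ‖trunc r κ h u z‖ₑ ^ p)) := by
        rw [driftMass, ← lintegral_const_mul' _ _ ENNReal.ofReal_ne_top]
        refine lintegral_mono fun z => ?_
        by_cases hz : z ∈ {z | 0 < trunc r κ k u z}
        · beta_reduce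
          rw [indicator_of_mem hz]
          have h1 : ENNReal.ofReal ((k - h) ^ p) ≤ ‖trunc r κ h u z‖ₑ ^ p := by
            rw [← ENNReal.ofReal_rpow_of_nonneg (by linarith) (by linarith)]
            refine ENNReal.rpow_le_rpow ?_ (by linarith)
            rw [← ofReal_norm]
            refine ENNReal.ofReal_le_ofReal ((le_trans ?_ (le_max_left _ _)).trans
              (Real.le_norm_self _))
            have h2 : 0 < max (1 - barrier r z - κ⁻¹ * u z - k) 0 := hz
            have := (lt_max_iff.1 h2).resolve_right (lt_irrefl _)
            linarith
          refine (mul_le_mul_left h1 _).trans (le_of_eq ?_)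
          ring
        · beta_reduce
          rw [indicator_of_notMem hz, mul_zero]
          exact zero_le
    _ = (∫⁻ z in tcyl n (2 * r) (-1 / 2) τ', ‖trunc r κ h u z‖ₑ ^ p)
        + ENNReal.ofReal r⁻¹ * ∫⁻ z in tcyl n (2 * r) (-1 / 2) τ',
          ‖b z‖ₑ * ‖trunc r κ h u z‖ₑ ^ p := by
        rw [lintegral_add_left hpm, lintegral_const_mul' _ _ ENNReal.ofReal_ne_top]
    _ ≤ C₁ * E ^ (p / 2) + ENNReal.ofReal r⁻¹ * (C₂ * ENNReal.ofReal M * E ^ (p / 2)) := by gcongr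
    _ = (C₁ + C₂ * (ENNReal.ofReal r⁻¹ * ENNReal.ofReal M)) * E ^ (p / 2) := by ring
    _ ≤ (C₁ + C₂ * 1) * E ^ (p / 2) := by
        gcongr
        rw [← ENNReal.ofReal_mul (inv_nonneg.2 hr0.le), ENNReal.ofReal_le_one,
          inv_mul_le_iff₀ hr0]
        linarith
    _ = ENNReal.ofReal ((C₁ + C₂) * D ^ (p / 2)) *
          driftMass r τ' b {z | 0 < trunc r κ h u z} ^ (p / 2) := by
        rw [hE, ENNReal.mul_rpow_of_nonneg _ _ hp0, ENNReal.ofReal_rpow_of_nonneg hD0 hp0,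
          ENNReal.ofReal_mul (by positivity), ENNReal.ofReal_add (by positivity) (by positivity),
          ENNReal.ofReal_coe_nnreal, ENNReal.ofReal_coe_nnreal, mul_one, mul_assoc]
    _ ≤ _ := by gcongr; linarith

/-- Starts the iteration: smallness of every time slice of a set makes its drift-weighted mass
small. The power `1 / q'` comes from Hölder against the drift, whose factor `4 * M / r` is at most
1. -/
theorem driftMass_le {q q' l r τ τ' M : ℝ} {b : SpaceTime n → EuclideanSpace ℝ (Fin n)}
    (hD : DriftBound q l (2 * r) τ M b) (hq : q.HolderConjugate q') (hl : 1 < l) (hτ : τ ≤ 0)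
    (hb : AEStronglyMeasurable b (volume.restrict (tcyl n (2 * r) (-4) τ))) (hr : 0 < r)
    (hM : 4 * M ≤ r) (hτ' : τ' ≤ τ) {S : Set (SpaceTime n)} (hS : MeasurableSet S) {δ : ℝ≥0∞}
    (hδ : ∀ t ∈ Ioo (-1 / 2) τ', volume ((fun x => (x, t)) ⁻¹' S) ≤ δ) :
    driftMass r τ' b S ≤ δ + δ ^ (1 / q') := by
  have hk : Measurable (S.indicator (1 : SpaceTime n → ℝ≥0∞)) := measurable_one.indicator hS
  have hq'0 := hq.symm.pos
  have hsl : ∀ t, ∀ x : EuclideanSpace ℝ (Fin n), S.indicator (1 : SpaceTime n → ℝ≥0∞) (x, t)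
      = ((fun x => (x, t)) ⁻¹' S).indicator 1 x := fun t x => rfl
  have h0 : ∀ t ∈ Ioo (-1 / 2) τ', ∫⁻ x in Metric.ball (0 : EuclideanSpace ℝ (Fin n)) (2 * r),
      S.indicator 1 (x, t) ≤ δ := fun t ht => by
    refine (setLIntegral_le_lintegral _ _).trans ?_
    simp only [hsl]
    rw [lintegral_indicator_one (measurable_prodMk_right hS)]
    exact hδ t ht
  have h1 := hD.lintegral_le hq hl hτ hb hk (t₁ := -1 / 2) (by norm_num) hτ' (A := δ) fun t ht => by
    refine le_trans (le_of_eq (lintegral_congr fun x => ?_)) (h0 t ht)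
    by_cases hx : (x, t) ∈ S
    · rw [indicator_of_mem hx]; simp
    · rw [indicator_of_notMem hx, ENNReal.zero_rpow_of_pos hq'0]
  have h2 : ∫⁻ z in tcyl n (2 * r) (-1 / 2) τ', S.indicator (1 : SpaceTime n → ℝ≥0∞) z ≤ δ := by
    rw [restrict_tcyl, lintegral_prod_symm _ hk.aemeasurable]
    refine (setLIntegral_mono' measurableSet_Ioo h0).trans ?_
    rw [setLIntegral_const, Real.volume_Ioo]
    refine mul_le_of_le_one_right zero_le ?_
    rw [ENNReal.ofReal_le_one]
    linarith
  calc driftMass r τ' b S = ∫⁻ z in tcyl n (2 * r) (-1 / 2) τ', (S.indicator 1 z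
        + ENNReal.ofReal r⁻¹ * (‖b z‖ₑ * S.indicator 1 z)) := by
        refine lintegral_congr fun z => ?_
        by_cases hz : z ∈ S
        · rw [indicator_of_mem hz, indicator_of_mem hz]; simp
        · rw [indicator_of_notMem hz, indicator_of_notMem hz]; simp
    _ = (∫⁻ z in tcyl n (2 * r) (-1 / 2) τ', S.indicator (1 : SpaceTime n → ℝ≥0∞) z)
        + ENNReal.ofReal r⁻¹ * ∫⁻ z in tcyl n (2 * r) (-1 / 2) τ', ‖b z‖ₑ * S.indicator 1 z := by
        rw [lintegral_add_left hk, lintegral_const_mul' _ _ ENNReal.ofReal_ne_top]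
    _ ≤ δ + ENNReal.ofReal r⁻¹ * (δ ^ (1 / q') * (4 * ENNReal.ofReal M)) := by gcongr
    _ = δ + δ ^ (1 / q') * ENNReal.ofReal (r⁻¹ * (4 * M)) := by
        rw [ENNReal.ofReal_mul (by positivity), ENNReal.ofReal_mul (by norm_num),
          ENNReal.ofReal_ofNat]
        ring
    _ ≤ δ + δ ^ (1 / q') * 1 := by
        gcongr
        rw [ENNReal.ofReal_le_one, inv_mul_le_iff₀ hr]
        linarith
    _ = _ := by rw [mul_one]

/-- A nonnegative solution that is rarely small is bounded below. -/
theorem exists_lower_bound {ν Ca q q' l l' : ℝ} (hn : 2 ≤ n) (hν : 0 < ν)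
    (hCa : 0 ≤ Ca) (hq : q.HolderConjugate q') (hl : l.HolderConjugate l')
    (hql : n / q + 2 / l < 2) (hql' : 1 ≤ n / q + 2 / l) : ∃ δ : ℝ, 0 < δ ∧ ∀ (r M κ τ : ℝ)
      (a : SpaceTime n → Matrix (Fin n) (Fin n) ℝ)
      (b : SpaceTime n → EuclideanSpace ℝ (Fin n)) (u : SpaceTime n → ℝ),
      1 ≤ r → 4 * M ≤ r → 0 < κ → τ ≤ 0 → LocalSol ν Ca (2 * r) τ a b u →
      (∀ p, u p ∈ Icc (0 : ℝ) 1) → DriftBound q l (2 * r) τ M b →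
      (∀ t ∈ Ioo (-1 / 2) τ, volume {x : EuclideanSpace ℝ (Fin n) | ‖x‖ < r / 2 ∧ u (x, t) < κ}
        ≤ ENNReal.ofReal δ) →
      ∀ p : SpaceTime n, ‖p.1‖ < r / 16 → p.2 ∈ Ioo (-1 / 16) τ → κ / 4 ≤ u p := by
  have hn0 : (0 : ℝ) < n := by positivity
  obtain ⟨p, hp⟩ : ∃ p, p = 2 / q' + 4 / (n * l') := ⟨_, rfl⟩
  -- Subcriticality is exactly `p > 2`, which makes the recursion superlinear; the lower bound on `n
  -- / q + 2 / l` keeps `p` within the range of the unweighted embedding.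
  have hpe : p = 2 + 2 / n * (2 - (n / q + 2 / l)) := by
    have i1 : q'⁻¹ = 1 - q⁻¹ := by linarith [hq.inv_add_inv_eq_one]
    have i2 : l'⁻¹ = 1 - l⁻¹ := by linarith [hl.inv_add_inv_eq_one]
    have : p = 2 * q'⁻¹ + 4 / n * l'⁻¹ := by rw [hp]; field_simp
    rw [this, i1, i2]
    field_simp
    ring
  have hp2 : 2 < p := by
    have : 0 < 2 / n * (2 - (n / q + 2 / l)) := by
      have : 0 < 2 - (n / q + 2 / l) := by linarith
      positivity
    linarith
  have hp' : (n : ℝ) * (p - 2) < 4 := by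
    have : (n : ℝ) * (p - 2) = 2 * (2 - (n / q + 2 / l)) := by rw [hpe]; field_simp; ring
    linarith
  obtain ⟨C, hC0, hC⟩ := exists_driftMass_contraction hn hν hCa hq hl hp hp2 hp' hql
  obtain ⟨δ₀, hδ₀, hconv⟩ := exists_fast_convergence (K := C * 4 ^ p) (B := 2 ^ p) (β := p / 2 - 1)
    (by positivity) (Real.one_lt_rpow (by norm_num) (by linarith)) (by linarith)
  have hq'i : 0 < 1 / q' := one_div_pos.2 hq.symm.pos
  obtain ⟨δ, hδ, hδle⟩ : ∃ δ : ℝ, 0 < δ ∧ δ + δ ^ (1 / q') ≤ δ₀ := by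
    have ht : Tendsto (fun x : ℝ => x + x ^ (1 / q')) (𝓝[>] 0) (𝓝 0) := by
      have h1 : ContinuousAt (fun x : ℝ => x + x ^ (1 / q')) 0 :=
        continuousAt_id.add (Real.continuousAt_rpow_const _ _ (Or.inr hq'i.le))
      have h2 := h1.tendsto
      simp only [Real.zero_rpow hq'i.ne', add_zero] at h2
      exact h2.mono_left nhdsWithin_le_nhds
    obtain ⟨δ, h1, h2⟩ := ((ht.eventually (gt_mem_nhds hδ₀)).and self_mem_nhdsWithin).exists
    exact ⟨δ, h2, h1.le⟩
  refine ⟨δ, hδ, ?_⟩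
  intro r M κ τ a b u hr hM hκ hτ hsol hu01 hD hsmall z hz1 hz2
  have hr0 : 0 < r := by linarith
  obtain ⟨τ', hτ1, hτ2⟩ := exists_between hz2.2
  have hτ0 : -1 / 2 < τ' := by linarith [hz2.1]
  -- Levels rising from 0 to 1/2 with gaps `2 ^ (-j) / 4`; the gaps raised to the power `-p` account
  -- for the constants `4 ^ p` and `2 ^ p` given to the fast convergence.
  set kk : ℕ → ℝ := fun j => (1 - (1 / 2) ^ j) / 2 with hkk
  have hkk0 : ∀ j, 0 ≤ kk j := fun j => by
    have : (1 / 2 : ℝ) ^ j ≤ 1 := pow_le_one₀ (by norm_num) (by norm_num)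
    simp only [hkk]; linarith
  have hkkd : ∀ j, kk (j + 1) - kk j = 4⁻¹ * (2 ^ j)⁻¹ := fun j => by
    simp only [hkk, pow_succ, one_div, inv_pow]; ring
  have hm := hconv (fun j => driftMass r τ' b {z | 0 < trunc r κ (kk j) u z}) ?_ fun j => ?_
  rotate_left
  · have hcont := (trunc_bddLip hr0 hκ (hkk0 0) hsol.lip hu01).continuous
    refine (driftMass_le hD hq hl.lt hτ hsol.int.1 hr0 hM hτ2.le
      (measurableSet_lt measurable_const hcont.measurable) (δ := ENNReal.ofReal δ)
      fun t ht => ?_).trans ?_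
    · refine (measure_mono fun x hx => ?_).trans (hsmall t ⟨ht.1, ht.2.trans hτ2⟩)
      have hx' : 0 < trunc r κ (kk 0) u (x, t) := hx
      refine ⟨?_, ?_⟩
      · by_contra hc
        exact hx'.ne' (trunc_eq_zero hκ (hkk0 0) hu01 (one_le_barrier_of_norm hr0 (not_lt.1 hc)))
      · have h2 := (lt_max_iff.1 hx').resolve_right (lt_irrefl _)
        have h3 := barrier_nonneg hr0 (x, t)
        have h4 : κ⁻¹ * u (x, t) < 1 := by linarith [hkk0 0]
        rwa [inv_mul_lt_iff₀ hκ, mul_one] at h4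
    · rw [ENNReal.ofReal_rpow_of_pos hδ, ← ENNReal.ofReal_add hδ.le (by positivity)]
      exact ENNReal.ofReal_le_ofReal hδle
  · have hpos : 0 < kk (j + 1) - kk j := by rw [hkkd]; positivity
    have key := hC r M κ τ τ' (kk j) (kk (j + 1)) a b u hr hM hκ hτ0 hτ2 hτ hsol hu01 hD (hkk0 j)
      (by linarith)
    rw [add_sub_cancel]
    have e1 : C * 4 ^ p * (2 ^ p) ^ j = ((kk (j + 1) - kk j) ^ p)⁻¹ * C := by
      rw [hkkd, Real.mul_rpow (by norm_num) (by positivity), Real.inv_rpow (by norm_num),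
        Real.inv_rpow (by positivity), mul_inv, inv_inv, inv_inv, ← Real.rpow_natCast,
        ← Real.rpow_natCast, ← Real.rpow_mul (by norm_num), ← Real.rpow_mul (by norm_num)]
      rw [mul_comm p]
      ring
    have hpp : 0 < (kk (j + 1) - kk j) ^ p := Real.rpow_pos_of_pos hpos _
    rw [e1, ENNReal.ofReal_mul (by positivity), mul_assoc, ENNReal.ofReal_inv_of_pos hpp]
    rw [mul_comm, ← div_eq_mul_inv, ENNReal.le_div_iff_mul_le (Or.inl (by simp [hpp]))
      (Or.inl ENNReal.ofReal_ne_top), mul_comm]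
    exact key
  · have hzero : driftMass r τ' b {z | 0 < trunc r κ (1 / 2) u z} = 0 := by
      refine le_antisymm (ge_of_tendsto' hm fun j => lintegral_mono fun z => ?_) zero_le
      have hsub : {z | 0 < trunc r κ (1 / 2) u z} ⊆ {z | 0 < trunc r κ (kk j) u z} := ?_
      · exact indicator_le_indicator_of_subset hsub (fun _ => zero_le) z
      intro z hz
      rw [Set.mem_ofPred_eq] at hz ⊢
      refine lt_of_lt_of_le hz ?_
      refine max_le_max (sub_le_sub_left ?_ _) le_rfl
      simp only [hkk]
      have : (0 : ℝ) ≤ (1 / 2) ^ j := by positivity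
      linarith
    by_contra hcon
    rw [not_le] at hcon
    have hcont := (trunc_bddLip (k := 1 / 2) hr0 hκ (by norm_num) hsol.lip hu01).continuous
    -- The positivity set at the limiting level 1/2 is open and null, hence empty. At `z` the
    -- barrier is below 1/4, so `u z < κ / 4` would put `z` into it.
    set O : Set (SpaceTime n) := tcyl n (2 * r) (-1 / 2) τ' ∩ {z | 0 < trunc r κ (1 / 2) u z} with hO
    have hOo : IsOpen O := (Metric.isOpen_ball.prod isOpen_Ioo).inter (isOpen_lt continuous_const hcont)
    have hzO : z ∈ O := by
      refine ⟨⟨by rw [mem_ball_zero_iff]; linarith, by linarith [hz2.1], hτ1⟩, ?_⟩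
      rw [Set.mem_ofPred_eq]
      refine lt_max_of_lt_left ?_
      have h1 : κ⁻¹ * u z < 1 / 4 := by rw [inv_mul_lt_iff₀ hκ]; linarith
      have h2 : barrier r z < 1 / 4 := by
        have h3 : max (-z.2) 0 < 1 / 16 := max_lt (by linarith [hz2.1]) (by norm_num)
        have h4 : 2 * r⁻¹ * ‖z.1‖ < 2 * r⁻¹ * (r / 16) := by gcongr
        have h5 : 2 * r⁻¹ * (r / 16) = 1 / 8 := by field_simp; norm_num
        rw [barrier]; linarith
      linarith
    have hOpos : 0 < volume O := hOo.measure_pos _ ⟨z, hzO⟩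
    refine hOpos.ne' (le_antisymm (le_trans ?_ hzero.le) zero_le)
    rw [driftMass, ← lintegral_indicator_one hOo.measurableSet,
      ← lintegral_indicator (measurableSet_tcyl _ _ _)]
    refine lintegral_mono fun x => ?_
    by_cases hx : x ∈ O
    · rw [indicator_of_mem hx, indicator_of_mem hx.1, indicator_of_mem hx.2]
      exact le_self_add
    · rw [indicator_of_notMem hx]; exact zero_le

/-! ### Expansion of positivity. -/

/-- Expansion of positivity at large relative scale. -/
theorem exists_expansion_of_positivity {ν Ca q l C₀ α : ℝ} (hn : 2 ≤ n) (hν : 0 < ν)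
    (hCa : 0 ≤ Ca) (hq : 1 < q) (hl : 1 < l) (hα : n / q + 2 / l = 1 + α) (hα0 : 0 ≤ α)
    (hα1 : α < 1) (hC₀ : 0 ≤ C₀) : ∃ r κ : ℝ, 1 ≤ r ∧ 0 < κ ∧ ∀ (τ : ℝ)
      (a : SpaceTime n → Matrix (Fin n) (Fin n) ℝ)
      (b : SpaceTime n → EuclideanSpace ℝ (Fin n)) (u : SpaceTime n → ℝ),
      -1 / 2 < τ → τ ≤ 0 → LocalSol ν Ca (2 * r) τ a b u →
      (∀ p, u p ∈ Icc (0 : ℝ) 1) → DriftBound q l (2 * r) τ (C₀ * (2 * r) ^ α) b →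
      volume (Metric.ball (0 : EuclideanSpace ℝ (Fin n)) (r / 2)) / 2 ≤
        volume {p : SpaceTime n | ‖p.1‖ < r / 2 ∧ p.2 ∈ Ioo (-2 : ℝ) (-1) ∧ 1 / 2 ≤ u p} →
      ∀ p : SpaceTime n, ‖p.1‖ < r / 16 → p.2 ∈ Ioo (-1 / 16) τ → κ ≤ u p := by
  have hqc := Real.HolderConjugate.conjExponent hq
  have hlc := Real.HolderConjugate.conjExponent hl
  obtain ⟨δ₀, hδ₀, hlow⟩ := exists_lower_bound hn hν hCa hqc hlc (by linarith) (by linarith)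
  obtain ⟨N, hN⟩ := exists_nat_ge q
  obtain ⟨δ, hδ, hδe⟩ : ∃ δ : ℝ, 0 < δ ∧ 2 ^ (N + 3) * δ = δ₀ :=
    ⟨δ₀ / 2 ^ (N + 3), by positivity, by field_simp⟩
  have hq0 : 0 < q := by linarith
  -- The thresholds `δ₀` and `δ` do not depend on `r`, so `r` can be chosen after them: as `α < 1`,
  -- the ratio of the drift norm to `r` tends to zero. Only then is `κ` obtained.
  obtain ⟨r, hr1, hr2, hr3⟩ : ∃ r : ℝ, 1 ≤ r ∧ 4 * (C₀ * (2 * r) ^ α) ≤ r ∧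
      ((N + 2 : ℕ) * r⁻¹ * (4 * (C₀ * (2 * r) ^ α))) ^ q ≤ δ / 2 := by
    have h0 : Tendsto (fun r : ℝ => 4 * C₀ * 2 ^ α * r ^ (-(1 - α))) atTop (𝓝 0) := by
      simpa using (tendsto_rpow_neg_atTop (show 0 < 1 - α by linarith)).const_mul (4 * C₀ * 2 ^ α)
    have h1 : ∀ r : ℝ, 0 < r → r⁻¹ * (4 * (C₀ * (2 * r) ^ α)) = 4 * C₀ * 2 ^ α * r ^ (-(1 - α)) := by
      intro r hr
      rw [Real.mul_rpow zero_le_two hr.le, neg_sub, Real.rpow_sub_one hr.ne']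
      ring
    have h2 : Tendsto (fun r : ℝ => ((N + 2 : ℕ) * (4 * C₀ * 2 ^ α * r ^ (-(1 - α)))) ^ q) atTop
        (𝓝 0) := by
      have h3 := (h0.const_mul ((N + 2 : ℕ) : ℝ)).rpow_const (p := q) (Or.inr hq0.le)
      rwa [mul_zero, Real.zero_rpow hq0.ne'] at h3
    obtain ⟨r, hr, e1, e2⟩ := ((eventually_ge_atTop (1 : ℝ)).and
      ((h0.eventually (ge_mem_nhds zero_lt_one)).and
        (h2.eventually (ge_mem_nhds (half_pos hδ))))).exists
    have hr0 : 0 < r := by linarith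
    rw [← h1 r hr0] at e1 e2
    refine ⟨r, hr, ?_, ?_⟩
    · rwa [inv_mul_le_iff₀ hr0, mul_one] at e1
    · rwa [mul_assoc]
  have hr0 : 0 < r := by linarith
  have hM : 0 ≤ C₀ * (2 * r) ^ α := by positivity
  obtain ⟨κ, hκ, hsmall⟩ := exists_rarely_small (n := n) hν hCa hr0 hqc hl hM (N := N) (by linarith) hδ hr3
  refine ⟨r, κ / 4, hr1, by positivity, ?_⟩
  intro τ a b u hτ1 hτ0 hsol hu01 hD hvol p hp1 hp2
  refine hlow r _ κ τ a b u hr1 hr2 hκ hτ0 hsol hu01 hD (fun t ht => ?_) p hp1 hp2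
  rw [← hδe]
  exact hsmall τ a b u hsol hu01 (by linarith) hτ0 hD hvol t ⟨by linarith [ht.1], ht.2⟩

/-! ### Parabolic dilations. -/

/-- The parabolic dilation `(x, t) ↦ (s x, s² t)`. -/
noncomputable def dil (n : ℕ) {s : ℝ} (hs : s ≠ 0) : SpaceTime n ≃L[ℝ] SpaceTime n :=
  (ContinuousLinearEquiv.smulLeft (Units.mk0 s hs)).prodCongr
    (ContinuousLinearEquiv.smulLeft (Units.mk0 (s ^ 2) (pow_ne_zero 2 hs)))

section dil

variable {s : ℝ} (hs : s ≠ 0)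

theorem dil_apply (p : SpaceTime n) : dil n hs p = (s • p.1, s ^ 2 * p.2) := rfl

theorem dil_mem {p : SpaceTime n} : dil n hs p ∈ lowerHalfSpace n ↔ p ∈ lowerHalfSpace n := by
  have h : 0 < s ^ 2 := by positivity
  simp only [lowerHalfSpace, mem_prod, mem_univ, true_and, mem_Iio, dil_apply]
  constructor
  · intro h1; by_contra h2; exact absurd h1 (not_lt.2 (mul_nonneg h.le (not_lt.1 h2)))
  · intro h1; exact mul_neg_of_pos_of_neg h h1

theorem preimage_dil : dil n hs ⁻¹' lowerHalfSpace n = lowerHalfSpace n := by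
  ext p; exact dil_mem hs

/-- The value of the scaling factor plays no role in the integral identities and signs to be
transported, so uniqueness of Haar measure replaces the computation of a determinant. -/
theorem exists_map_dil : ∃ c : ℝ≥0∞, c ≠ 0 ∧ c ≠ ∞ ∧
    (volume : Measure (SpaceTime n)).map (dil n hs) = c • volume := by
  have : ((volume : Measure (SpaceTime n)).map (dil n hs)).IsAddHaarMeasure :=
    ContinuousLinearEquiv.isAddHaarMeasure_map _ _
  refine ⟨Measure.addHaarScalarFactor ((volume : Measure (SpaceTime n)).map (dil n hs)) volume,
    ?_, ENNReal.coe_ne_top, Measure.isAddLeftInvariant_eq_smul _ _⟩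
  exact_mod_cast (Measure.addHaarScalarFactor_pos_of_isAddHaarMeasure _ _).ne'

theorem quasiMeasurePreserving_dil : Measure.QuasiMeasurePreserving (dil n hs)
    (volume.restrict (lowerHalfSpace n)) (volume.restrict (lowerHalfSpace n)) := by
  obtain ⟨c, -, -, hc⟩ := exists_map_dil (n := n) hs
  have hq : Measure.QuasiMeasurePreserving (dil n hs) volume volume :=
    ⟨(dil n hs).continuous.measurable, by rw [hc]; exact Measure.smul_absolutelyContinuous⟩
  exact hq.restrict (fun p hp => (dil_mem hs).2 hp)

theorem ae_comp_dil {P : SpaceTime n → Prop} (h : ∀ᵐ p ∂(volume.restrict (lowerHalfSpace n)), P p) :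
    ∀ᵐ p ∂(volume.restrict (lowerHalfSpace n)), P (dil n hs p) :=
  (quasiMeasurePreserving_dil hs).ae h

theorem exists_integral_dil : ∃ c : ℝ, 0 < c ∧ ∀ f : SpaceTime n → ℝ,
    ∫ p in lowerHalfSpace n, f (dil n hs p) = c * ∫ p in lowerHalfSpace n, f p := by
  obtain ⟨c, h0, ht, hc⟩ := exists_map_dil (n := n) hs
  refine ⟨c.toReal, ENNReal.toReal_pos h0 ht, fun f => ?_⟩
  have := setIntegral_map_equiv (μ := (volume : Measure (SpaceTime n)))
    (dil n hs).toHomeomorph.toMeasurableEquiv f (lowerHalfSpace n)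
  have e : (volume : Measure (SpaceTime n)).map (dil n hs).toHomeomorph.toMeasurableEquiv
      = c • volume := hc
  rw [e, Measure.restrict_smul, integral_smul_measure] at this
  have e2 : (dil n hs).toHomeomorph.toMeasurableEquiv ⁻¹' lowerHalfSpace n = lowerHalfSpace n :=
    preimage_dil hs
  rw [e2] at this
  exact this.symm

theorem spaceDeriv_comp_dil (i : Fin n) (f : SpaceTime n → ℝ) (p : SpaceTime n) :
    spaceDeriv i (f ∘ dil n hs) p = s * spaceDeriv i f (dil n hs p) := by
  rw [spaceDeriv, ContinuousLinearEquiv.comp_right_fderiv, spaceDeriv]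
  have : dil n hs (EuclideanSpace.single i 1, 0) = s • (EuclideanSpace.single i 1, 0) := by
    simp [dil_apply]
  simp only [ContinuousLinearMap.comp_apply, ContinuousLinearEquiv.coe_coe, this, map_smul,
    smul_eq_mul]

theorem timeDeriv_comp_dil (f : SpaceTime n → ℝ) (p : SpaceTime n) :
    timeDeriv (f ∘ dil n hs) p = s ^ 2 * timeDeriv f (dil n hs p) := by
  rw [timeDeriv, ContinuousLinearEquiv.comp_right_fderiv, timeDeriv]
  have : dil n hs (0, 1) = s ^ 2 • (0, 1) := by
    simp [dil_apply]
  simp only [ContinuousLinearMap.comp_apply, ContinuousLinearEquiv.coe_coe, this, map_smul,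
    smul_eq_mul]

theorem spaceDeriv_comp_dil_symm (i : Fin n) (f : SpaceTime n → ℝ) (p : SpaceTime n) :
    spaceDeriv i (f ∘ (dil n hs).symm) (dil n hs p) = s⁻¹ * spaceDeriv i f p := by
  have h := spaceDeriv_comp_dil hs i (f ∘ (dil n hs).symm) p
  have e : (f ∘ (dil n hs).symm) ∘ dil n hs = f := by ext; simp
  rw [e] at h
  rw [h, inv_mul_cancel_left₀ hs]

theorem tsupport_comp_dil_symm {f : SpaceTime n → ℝ} (hf : tsupport f ⊆ lowerHalfSpace n) :
    tsupport (f ∘ (dil n hs).symm) ⊆ lowerHalfSpace n := by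
  have : tsupport (f ∘ (dil n hs).symm) = (dil n hs).symm ⁻¹' tsupport f :=
    tsupport_comp_eq_preimage f (dil n hs).symm.toHomeomorph
  rw [this]
  intro p hp
  have h1 := (dil_mem hs).2 (hf hp)
  rwa [(dil n hs).apply_symm_apply] at h1

theorem hasCompactSupport_comp_dil_symm {f : SpaceTime n → ℝ} (hf : HasCompactSupport f) :
    HasCompactSupport (f ∘ (dil n hs).symm) :=
  hf.comp_homeomorph (dil n hs).symm.toHomeomorph

end dil

theorem BoundedCoeff.comp_dil {a : SpaceTime n → Matrix (Fin n) (Fin n) ℝ}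
    (ha : BoundedCoeff (lowerHalfSpace n) a) {s : ℝ} (hs : s ≠ 0) :
    BoundedCoeff (lowerHalfSpace n) (a ∘ dil n hs) := by
  obtain ⟨h1, C, hC⟩ := ha
  refine ⟨fun i j => (h1 i j).comp_quasiMeasurePreserving (quasiMeasurePreserving_dil hs), C,
    fun i j => ae_comp_dil hs (hC i j)⟩

theorem UniformlyElliptic.comp_dil {ν : ℝ} {a : SpaceTime n → Matrix (Fin n) (Fin n) ℝ}
    (ha : UniformlyElliptic ν (lowerHalfSpace n) a) {s : ℝ} (hs : s ≠ 0) :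
    UniformlyElliptic ν (lowerHalfSpace n) (a ∘ dil n hs) := ae_comp_dil hs ha

theorem DivNonpos.comp_dil {b : SpaceTime n → EuclideanSpace ℝ (Fin n)}
    (hb : DivNonpos (lowerHalfSpace n) b) {s : ℝ} (hs : 0 < s) :
    DivNonpos (lowerHalfSpace n) (fun p => s • b (dil n hs.ne' p)) := by
  intro φ hφ hc hsupp h0
  obtain ⟨c, hc0, hint⟩ := exists_integral_dil (n := n) hs.ne'
  have key := hb (φ ∘ (dil n hs.ne').symm) (hφ.comp (dil n hs.ne').symm.contDiff)
    (hasCompactSupport_comp_dil_symm hs.ne' hc) (tsupport_comp_dil_symm hs.ne' hsupp)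
    fun p => h0 _
  have h1 := hint fun p => ∑ i, b p i * spaceDeriv i (φ ∘ (dil n hs.ne').symm) p
  have h2 : ∀ p, ∑ i, (s • b (dil n hs.ne' p)) i * spaceDeriv i φ p
      = s ^ 2 * ∑ i, b (dil n hs.ne' p) i *
        spaceDeriv i (φ ∘ (dil n hs.ne').symm) (dil n hs.ne' p) := fun p => by
    rw [Finset.mul_sum]
    refine Finset.sum_congr rfl fun i _ => ?_
    rw [spaceDeriv_comp_dil_symm, PiLp.smul_apply, smul_eq_mul]
    field_simp
  simp only [h2]
  rw [integral_const_mul, h1]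
  positivity

theorem spaceDeriv_affine (i : Fin n) (f : SpaceTime n → ℝ) (c d : ℝ) (p : SpaceTime n) :
    spaceDeriv i (fun p => c * f p + d) p = c * spaceDeriv i f p := by
  rw [spaceDeriv, fderiv_add_const, show (fun p => c * f p) = c • f from rfl, fderiv_const_smul_field]
  rfl

theorem timeDeriv_affine (f : SpaceTime n → ℝ) (c d : ℝ) (p : SpaceTime n) :
    timeDeriv (fun p => c * f p + d) p = c * timeDeriv f p := by
  rw [timeDeriv, fderiv_add_const, show (fun p => c * f p) = c • f from rfl, fderiv_const_smul_field]
  rfl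

theorem IsLipschitzSolution.comp_dil {a : SpaceTime n → Matrix (Fin n) (Fin n) ℝ}
    {b : SpaceTime n → EuclideanSpace ℝ (Fin n)} {u : SpaceTime n → ℝ}
    (hu : IsLipschitzSolution (lowerHalfSpace n) a b u) {s : ℝ} (hs : 0 < s) (c d : ℝ) :
    IsLipschitzSolution (lowerHalfSpace n) (a ∘ dil n hs.ne') (fun p => s • b (dil n hs.ne' p))
      (fun p => c * (u ∘ dil n hs.ne') p + d) := by
  obtain ⟨hL, heq⟩ := hu
  refine ⟨fun x hx => ?_, fun η hη hc hsupp => ?_⟩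
  · obtain ⟨K, t, ht, hK⟩ := hL ((dil_mem hs.ne').2 hx)
    refine ⟨‖c‖₊ * (K * ‖(dil n hs.ne' : SpaceTime n →L[ℝ] SpaceTime n)‖₊), dil n hs.ne' ⁻¹' t,
      ?_, LipschitzOnWith.of_dist_le_mul fun y hy z hz => ?_⟩
    · have h1 : Tendsto (dil n hs.ne') (𝓝[lowerHalfSpace n] x)
          (𝓝[lowerHalfSpace n] (dil n hs.ne' x)) :=
        (dil n hs.ne').continuous.continuousWithinAt.tendsto_nhdsWithin
          fun p hp => (dil_mem hs.ne').2 hp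
      exact h1 ht
    · have h1 := hK.dist_le_mul _ hy _ hz
      have h2 := (dil n hs.ne' : SpaceTime n →L[ℝ] SpaceTime n).lipschitz.dist_le_mul y z
      rw [dist_add_right, Real.dist_eq, ← mul_sub, abs_mul, ← Real.dist_eq, NNReal.coe_mul,
        coe_nnnorm, Real.norm_eq_abs, mul_assoc]
      refine mul_le_mul_of_nonneg_left (h1.trans ?_) (abs_nonneg _)
      rw [NNReal.coe_mul, mul_assoc]
      exact mul_le_mul_of_nonneg_left h2 K.coe_nonneg
  · obtain ⟨k, hk0, hint⟩ := exists_integral_dil (n := n) hs.ne'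
    have hη' : ∃ K, LipschitzWith K (η ∘ (dil n hs.ne').symm) := by
      obtain ⟨K, hK⟩ := hη
      exact ⟨_, hK.comp ((dil n hs.ne').symm : SpaceTime n →L[ℝ] SpaceTime n).lipschitz⟩
    have key := heq (η ∘ (dil n hs.ne').symm) hη'
      (hasCompactSupport_comp_dil_symm hs.ne' hc) (tsupport_comp_dil_symm hs.ne' hsupp)
    have h1 := hint fun p => timeDeriv u p * (η ∘ (dil n hs.ne').symm) p
        + ∑ i, ∑ j, a p i j * spaceDeriv j u p * spaceDeriv i (η ∘ (dil n hs.ne').symm) p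
        + ∑ i, b p i * spaceDeriv i u p * (η ∘ (dil n hs.ne').symm) p
    rw [key, mul_zero] at h1
    have h2 : ∀ p, timeDeriv (fun p => c * (u ∘ dil n hs.ne') p + d) p * η p
        + ∑ i, ∑ j, (a ∘ dil n hs.ne') p i j *
          spaceDeriv j (fun p => c * (u ∘ dil n hs.ne') p + d) p * spaceDeriv i η p
        + ∑ i, (s • b (dil n hs.ne' p)) i *
          spaceDeriv i (fun p => c * (u ∘ dil n hs.ne') p + d) p * η p
        = c * s ^ 2 * (timeDeriv u (dil n hs.ne' p) * (η ∘ (dil n hs.ne').symm) (dil n hs.ne' p)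
        + ∑ i, ∑ j, a (dil n hs.ne' p) i j * spaceDeriv j u (dil n hs.ne' p) *
          spaceDeriv i (η ∘ (dil n hs.ne').symm) (dil n hs.ne' p)
        + ∑ i, b (dil n hs.ne' p) i * spaceDeriv i u (dil n hs.ne' p) *
          (η ∘ (dil n hs.ne').symm) (dil n hs.ne' p)) := fun p => by
      simp only [mul_add, Finset.mul_sum]
      congr 1
      · congr 1
        · rw [timeDeriv_affine, timeDeriv_comp_dil]
          simp
          ring
        · refine Finset.sum_congr rfl fun i _ => Finset.sum_congr rfl fun j _ => ?_
          rw [spaceDeriv_comp_dil_symm, spaceDeriv_affine, spaceDeriv_comp_dil]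
          simp only [Function.comp_apply]
          field_simp
      · refine Finset.sum_congr rfl fun i _ => ?_
        rw [spaceDeriv_affine, spaceDeriv_comp_dil, PiLp.smul_apply, smul_eq_mul]
        simp only [Function.comp_apply, ContinuousLinearEquiv.symm_apply_apply]
        ring
    simp only [h2]
    rw [integral_const_mul, h1, mul_zero]

theorem isOpen_lowerHalfSpace : IsOpen (lowerHalfSpace n) := isOpen_univ.prod isOpen_Iio

theorem cyl_subset_lowerHalfSpace {R τ : ℝ} (hτ : τ ≤ 0) : cyl n R τ ⊆ lowerHalfSpace n :=
  fun _ hp => ⟨mem_univ _, hp.2.2.trans_le hτ⟩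

theorem DriftBound.mono {q l R τ τ' M : ℝ} {b : SpaceTime n → EuclideanSpace ℝ (Fin n)}
    (h : DriftBound q l R τ M b) (hτ : τ' ≤ τ) : DriftBound q l R τ' M b :=
  (lintegral_mono_set (Ioo_subset_Ioo_right hτ)).trans h

theorem DriftBound.integrableOn {q l R M : ℝ} {b : SpaceTime n → EuclideanSpace ℝ (Fin n)}
    (h : DriftBound q l R 0 M b) (hq : 1 < q) (hl : 1 < l)
    (hb : AEStronglyMeasurable b (volume.restrict (lowerHalfSpace n))) :
    IntegrableOn b (cyl n R 0) := by
  have hb1 : AEStronglyMeasurable b (volume.restrict (cyl n R 0)) :=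
    hb.mono_measure (Measure.restrict_mono (cyl_subset_lowerHalfSpace le_rfl) le_rfl)
  refine ⟨hb1, ?_⟩
  have hqc := Real.HolderConjugate.conjExponent hq
  have := h.lintegral_le hqc hl le_rfl hb1 (k := 1) measurable_one (t₁ := -4) (t₂ := 0) le_rfl le_rfl
    (A := volume (Metric.ball (0 : EuclideanSpace ℝ (Fin n)) R)) (fun t _ => by simp)
  simp only [Pi.one_apply, mul_one] at this
  exact this.trans_lt (ENNReal.mul_lt_top (ENNReal.rpow_lt_top_of_nonneg
    (one_div_nonneg.2 hqc.symm.nonneg) Metric.isBounded_ball.measure_lt_top.ne)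
    (ENNReal.mul_lt_top (by simp) ENNReal.ofReal_lt_top))

/-! ### From the half-space to local solutions, with the scaling of the drift. -/

/-- A bounded solution in the half-space restricts to a local solution. -/
theorem exists_localSol {ν Ca q l R M τ : ℝ} {a : SpaceTime n → Matrix (Fin n) (Fin n) ℝ}
    {b : SpaceTime n → EuclideanSpace ℝ (Fin n)} {u : SpaceTime n → ℝ}
    (ham : ∀ i j, AEMeasurable (fun p => a p i j) (volume.restrict (lowerHalfSpace n)))
    (hab : ∀ᵐ p ∂(volume.restrict (lowerHalfSpace n)), ∀ i j, |a p i j| ≤ Ca)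
    (hell : UniformlyElliptic ν (lowerHalfSpace n) a) (hdiv : DivNonpos (lowerHalfSpace n) b)
    (hb : AEStronglyMeasurable b (volume.restrict (lowerHalfSpace n)))
    (hu : IsLipschitzSolution (lowerHalfSpace n) a b u) (hq : 1 < q) (hl : 1 < l)
    (hD : DriftBound q l R 0 M b) (hu01 : ∀ p ∈ lowerHalfSpace n, u p ∈ Icc (0 : ℝ) 1) (hτ : τ < 0) :
    ∃ v : SpaceTime n → ℝ, LocalSol ν Ca R τ a b v ∧ (∀ p, v p ∈ Icc (0 : ℝ) 1) ∧
      ∀ p ∈ cyl n R τ, v p = u p := by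
  have hsub : cyl n R τ ⊆ lowerHalfSpace n := cyl_subset_lowerHalfSpace hτ.le
  have hmono : (volume : Measure (SpaceTime n)).restrict (cyl n R τ)
    ≤ volume.restrict (lowerHalfSpace n) := Measure.restrict_mono hsub le_rfl
  -- As `τ < 0`, this compact set lies in the open half-space, and local Lipschitz continuity
  -- becomes Lipschitz continuity on it. Extending and clamping to `[0, 1]` changes neither values
  -- nor derivatives in the open cylinder.
  set S : Set (SpaceTime n) := Metric.closedBall 0 R ×ˢ Icc (-4) τ with hS
  have hSc : IsCompact S := (isCompact_closedBall _ _).prod isCompact_Icc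
  have hSQ : S ⊆ lowerHalfSpace n := fun p hp => ⟨mem_univ _, hp.2.2.trans_lt hτ⟩
  have hUS : cyl n R τ ⊆ S := prod_mono Metric.ball_subset_closedBall Ioo_subset_Icc_self
  obtain ⟨K, hK⟩ := (hu.1.mono hSQ).exists_lipschitzOnWith_of_compact hSc
  obtain ⟨w, hw, hwu⟩ := hK.extend_real
  set v : SpaceTime n → ℝ := fun p => max 0 (min 1 (w p)) with hv
  have hvL : LipschitzWith K v := (hw.const_min 1).const_max 0
  have hvu : ∀ p ∈ cyl n R τ, v p = u p := fun p hp => by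
    have h1 := hu01 p (hsub hp)
    simp only [hv]
    rw [← hwu (hUS hp), min_eq_right h1.2, max_eq_right h1.1]
  have hvd : ∀ p ∈ cyl n R τ, fderiv ℝ v p = fderiv ℝ u p := fun p hp => by
    refine Filter.EventuallyEq.fderiv_eq ?_
    filter_upwards [(isOpen_cyl R τ).mem_nhds hp] with x hx using hvu x hx
  have hint : IntegrableOn b (cyl n R τ) := (hD.integrableOn hq hl hb).mono_set
    (prod_mono le_rfl (Ioo_subset_Ioo_right hτ.le))
  refine ⟨v, ⟨fun i j => (ham i j).mono_measure hmono, ae_mono hmono hab, ?_, hint, ?_, ⟨K, hvL⟩, ?_⟩,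
    fun p => ⟨le_max_left _ _, max_le zero_le_one (min_le_left _ _)⟩, hvu⟩
  · filter_upwards [ae_mono hmono hell] with p hp ξ using (hp ξ).1
  · rintro φ ⟨Kφ, hφ⟩ hc hs h0
    exact hdiv.lipschitz (isOpen_cyl R τ) hsub isOpen_lowerHalfSpace.measurableSet hint hφ hc hs h0
  · intro η hη hc hs
    have key := hu.2 η hη hc (hs.trans hsub)
    rw [← key]
    rw [setIntegral_eq_of_subset_of_forall_sdiff_eq_zero isOpen_lowerHalfSpace.measurableSet hsub
      (f := fun p => (timeDeriv u p * η p
        + ∑ i, ∑ j, a p i j * spaceDeriv j u p * spaceDeriv i η p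
        + ∑ i, b p i * spaceDeriv i u p * η p))]
    · refine setIntegral_congr_fun (isOpen_cyl R τ).measurableSet fun p hp => ?_
      simp only [timeDeriv, spaceDeriv, hvd p hp]
    · intro p hp
      have h1 : p ∉ tsupport η := fun h => hp.2 (hs h)
      have h2 : η p = 0 := image_eq_zero_of_notMem_tsupport h1
      have h3 : fderiv ℝ η p = 0 := by
        by_contra h
        exact h1 (support_fderiv_subset ℝ h)
      simp [spaceDeriv, h2, h3]

/-- Behaviour of the drift bound under parabolic dilations. -/
theorem driftBound_dil {q l α C₀ r R : ℝ} {b : SpaceTime n → EuclideanSpace ℝ (Fin n)}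
    (hq : 0 < q) (hl : 0 < l) (hα : n / q + 2 / l = 1 + α) (hC₀ : 0 ≤ C₀) (hr : 1 ≤ r) (hR : 0 < R)
    {s : ℝ} (hs : 0 < s) (hsR : R = s * (2 * r))
    (h : ∫⁻ t in Ioo (-R ^ 2) 0, (∫⁻ x in Metric.ball (0 : EuclideanSpace ℝ (Fin n)) R,
      ‖b (x, t)‖ₑ ^ q) ^ (l / q) ≤ ENNReal.ofReal (C₀ * R ^ α) ^ l) :
    DriftBound q l (2 * r) 0 (C₀ * (2 * r) ^ α) (fun p => s • b (dil n hs.ne' p)) := by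
  set B := Metric.ball (0 : EuclideanSpace ℝ (Fin n)) R with hB
  set G : ℝ → ℝ≥0∞ := fun t => ∫⁻ x in B, ‖b (x, t)‖ₑ ^ q with hG
  have hx : ∀ f : EuclideanSpace ℝ (Fin n) → ℝ≥0∞,
      ∫⁻ x in Metric.ball (0 : EuclideanSpace ℝ (Fin n)) (2 * r), f (s • x)
      = ENNReal.ofReal (s ^ n)⁻¹ * ∫⁻ x in B, f x := fun f => by
    have e := (Homeomorph.smulOfNeZero s hs.ne' :
      EuclideanSpace ℝ (Fin n) ≃ₜ EuclideanSpace ℝ (Fin n)).toMeasurableEquiv.restrict_map volume B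
    have e1 : (volume : Measure (EuclideanSpace ℝ (Fin n))).map (Homeomorph.smulOfNeZero s hs.ne' :
      EuclideanSpace ℝ (Fin n) ≃ₜ EuclideanSpace ℝ (Fin n)).toMeasurableEquiv
        = ENNReal.ofReal (s ^ n)⁻¹ • volume := by
      have := Measure.map_addHaar_smul (volume : Measure (EuclideanSpace ℝ (Fin n))) hs.ne'
      rw [finrank_euclideanSpace_fin, abs_of_pos (by positivity)] at this
      exact this
    have e2 : (Homeomorph.smulOfNeZero s hs.ne' :
      EuclideanSpace ℝ (Fin n) ≃ₜ EuclideanSpace ℝ (Fin n)).toMeasurableEquiv ⁻¹' B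
        = Metric.ball 0 (2 * r) := by
      ext x
      change s • x ∈ B ↔ _
      rw [hB, mem_ball_zero_iff, mem_ball_zero_iff, norm_smul, Real.norm_of_nonneg hs.le, hsR,
        mul_lt_mul_iff_right₀ hs]
    rw [e1, e2] at e
    have e3 := lintegral_map_equiv f (Homeomorph.smulOfNeZero s hs.ne' :
      EuclideanSpace ℝ (Fin n) ≃ₜ EuclideanSpace ℝ (Fin n)).toMeasurableEquiv
      (μ := volume.restrict (Metric.ball 0 (2 * r)))
    rw [← e, Measure.restrict_smul, lintegral_smul_measure, smul_eq_mul] at e3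
    exact e3.symm
  have hs2 : s ^ 2 ≠ 0 := by positivity
  have ht : ∀ f : ℝ → ℝ≥0∞, ∫⁻ t in Ioo (-4 * r ^ 2) 0, f (s ^ 2 * t)
      = ENNReal.ofReal (s ^ 2)⁻¹ * ∫⁻ t in Ioo (-R ^ 2) 0, f t := fun f => by
    have e := (Homeomorph.mulLeft₀ (s ^ 2) hs2).toMeasurableEquiv.restrict_map volume (Ioo (-R ^ 2) 0)
    have e1 : (volume : Measure ℝ).map (Homeomorph.mulLeft₀ (s ^ 2) hs2).toMeasurableEquiv
        = ENNReal.ofReal (s ^ 2)⁻¹ • volume := by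
      have := Real.map_volume_mul_left hs2
      rw [abs_of_pos (by positivity)] at this
      exact this
    have e2 : (Homeomorph.mulLeft₀ (s ^ 2) hs2).toMeasurableEquiv ⁻¹' (Ioo (-R ^ 2) 0)
        = Ioo (-4 * r ^ 2) 0 := by
      ext t
      change s ^ 2 * t ∈ Ioo (-R ^ 2) 0 ↔ _
      have h2 : 0 < s ^ 2 := by positivity
      have h3 : -R ^ 2 = s ^ 2 * (-4 * r ^ 2) := by rw [hsR]; ring
      rw [mem_Ioo, mem_Ioo, h3, mul_lt_mul_iff_right₀ h2]
      refine and_congr_right fun _ => ?_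
      rw [← mul_zero (s ^ 2), mul_lt_mul_iff_right₀ h2, mul_zero]
    rw [e1, e2] at e
    have e3 := lintegral_map_equiv f (Homeomorph.mulLeft₀ (s ^ 2) hs2).toMeasurableEquiv
      (μ := volume.restrict (Ioo (-4 * r ^ 2) 0))
    rw [← e, Measure.restrict_smul, lintegral_smul_measure, smul_eq_mul] at e3
    exact e3.symm
  have hlq : 0 ≤ l / q := by positivity
  have hsl : ∀ t, (∫⁻ x in Metric.ball (0 : EuclideanSpace ℝ (Fin n)) (2 * r),
      ‖s • b (dil n hs.ne' (x, t))‖ₑ ^ q) ^ (l / q)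
      = ENNReal.ofReal (s ^ l * s ^ (-(n * l / q))) * G (s ^ 2 * t) ^ (l / q) := fun t => by
    have e1 : ∀ x, ‖s • b (dil n hs.ne' (x, t))‖ₑ ^ q
        = ENNReal.ofReal (s ^ q) * ‖b (s • x, s ^ 2 * t)‖ₑ ^ q := fun x => by
      rw [enorm_smul, ENNReal.mul_rpow_of_nonneg _ _ hq.le, ← ofReal_norm s,
        Real.norm_of_nonneg hs.le, ENNReal.ofReal_rpow_of_pos hs, dil_apply]
    simp only [e1]
    rw [lintegral_const_mul' _ _ ENNReal.ofReal_ne_top, hx fun y => ‖b (y, s ^ 2 * t)‖ₑ ^ q,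
      ENNReal.mul_rpow_of_nonneg _ _ hlq, ENNReal.mul_rpow_of_nonneg _ _ hlq,
      ENNReal.ofReal_rpow_of_pos (by positivity), ENNReal.ofReal_rpow_of_pos (by positivity),
      ← mul_assoc, ← ENNReal.ofReal_mul (by positivity)]
    congr 3
    · rw [← Real.rpow_mul hs.le, mul_div_cancel₀ _ hq.ne']
    · rw [← Real.rpow_natCast, ← Real.rpow_neg hs.le, ← Real.rpow_mul hs.le]
      congr 1; ring
  rw [DriftBound]
  simp only [hsl]
  -- The dilated cylinder has time length `4 * r ^ 2`; since `r ≥ 1`, it contains the last 4 units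
  -- of time, and only those are kept.
  calc ∫⁻ t in Ioo (-4) 0, ENNReal.ofReal (s ^ l * s ^ (-(n * l / q))) * G (s ^ 2 * t) ^ (l / q)
      ≤ ∫⁻ t in Ioo (-4 * r ^ 2) 0,
          ENNReal.ofReal (s ^ l * s ^ (-(n * l / q))) * G (s ^ 2 * t) ^ (l / q) :=
        lintegral_mono_set (Ioo_subset_Ioo_left (by nlinarith))
    _ = ENNReal.ofReal (s ^ l * s ^ (-(n * l / q))) *
          (ENNReal.ofReal (s ^ 2)⁻¹ * ∫⁻ t in Ioo (-R ^ 2) 0, G t ^ (l / q)) := by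
        rw [lintegral_const_mul' _ _ ENNReal.ofReal_ne_top, ht fun t => G t ^ (l / q)]
    _ ≤ ENNReal.ofReal (s ^ l * s ^ (-(n * l / q))) *
          (ENNReal.ofReal (s ^ 2)⁻¹ * ENNReal.ofReal (C₀ * R ^ α) ^ l) := by gcongr
    _ = ENNReal.ofReal (C₀ * (2 * r) ^ α) ^ l := by
        rw [ENNReal.ofReal_rpow_of_nonneg (by positivity) hl.le,
          ENNReal.ofReal_rpow_of_nonneg (by positivity) hl.le, ← ENNReal.ofReal_mul (by positivity),
          ← ENNReal.ofReal_mul (by positivity)]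
        congr 1
        have hα' : α = n / q + 2 / l - 1 := by linarith
        rw [hsR, Real.mul_rpow hs.le (by positivity), Real.mul_rpow hC₀ (by positivity),
          Real.mul_rpow (by positivity) (by positivity), Real.mul_rpow hC₀ (by positivity),
          ← Real.rpow_mul hs.le]
        -- All powers of the dilation factor cancel; this is where `α = n / q + 2 / l - 1` is the
        -- right exponent.
        have e : s ^ l * s ^ (-(n * l / q)) * ((s ^ 2)⁻¹ * s ^ (α * l)) = 1 := by
          rw [← Real.rpow_natCast, ← Real.rpow_neg hs.le, ← Real.rpow_add hs, ← Real.rpow_add hs,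
            ← Real.rpow_add hs]
          rw [show l + -(n * l / q) + (-((2 : ℕ) : ℝ) + α * l) = 0 by
            rw [hα']; push_cast; field_simp; ring]
          exact Real.rpow_zero _
        calc _ = (s ^ l * s ^ (-(n * l / q)) * ((s ^ 2)⁻¹ * s ^ (α * l))) *
              (C₀ ^ l * ((2 * r) ^ α) ^ l) := by ring
          _ = _ := by rw [e, one_mul]

/-! ### The oscillation argument. -/

/-- Liouville theorem for drifts measured with finite exponents. -/
theorem liouville_of_frequently {ν q l α C₀ : ℝ} (hn : 2 ≤ n) (hν : 0 < ν)
    {a : SpaceTime n → Matrix (Fin n) (Fin n) ℝ}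
    {b : SpaceTime n → EuclideanSpace ℝ (Fin n)} {u : SpaceTime n → ℝ}
    (ha : BoundedCoeff (lowerHalfSpace n) a) (hell : UniformlyElliptic ν (lowerHalfSpace n) a)
    (hdiv : DivNonpos (lowerHalfSpace n) b)
    (hb : AEStronglyMeasurable b (volume.restrict (lowerHalfSpace n)))
    (hq : 1 < q) (hl : 1 < l) (hα : n / q + 2 / l = 1 + α) (hα0 : 0 ≤ α)
    (hα1 : α < 1) (hC₀ : 0 ≤ C₀)
    (hD : ∀ R₀ : ℝ, ∃ R, R₀ ≤ R ∧ ∫⁻ t in Ioo (-R ^ 2) 0,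
      (∫⁻ x in Metric.ball (0 : EuclideanSpace ℝ (Fin n)) R, ‖b (x, t)‖ₑ ^ q) ^ (l / q)
        ≤ ENNReal.ofReal (C₀ * R ^ α) ^ l)
    (hu : IsLipschitzSolution (lowerHalfSpace n) a b u)
    (hbdd : ∃ M : ℝ, ∀ p ∈ lowerHalfSpace n, |u p| ≤ M) :
    ∃ c : ℝ, ∀ p ∈ lowerHalfSpace n, u p = c := by
  obtain ⟨Ca, hCa0, hCa⟩ : ∃ Ca, 0 ≤ Ca ∧
      ∀ᵐ p ∂(volume.restrict (lowerHalfSpace n)), ∀ i j, |a p i j| ≤ Ca := by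
    obtain ⟨C, hC⟩ := ha.2
    refine ⟨max C 0, le_max_right _ _, ?_⟩
    simp only [ae_all_iff]
    intro i j
    filter_upwards [hC i j] with p hp using hp.trans (le_max_left _ _)
  obtain ⟨r, κ, hr, hκ, hexp⟩ := exists_expansion_of_positivity hn hν hCa0 hq hl hα hα0 hα1 hC₀
  have hr0 : 0 < r := by linarith
  -- Expansion of positivity at scale `s`, for an affine image of `u`. The sign of `c` is free so
  -- that it covers the normalised solution and its complement to 1.
  have hone : ∀ (s : ℝ) (hs : 0 < s) (c d : ℝ),
      (∫⁻ t in Ioo (-(s * (2 * r)) ^ 2) 0,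
        (∫⁻ x in Metric.ball (0 : EuclideanSpace ℝ (Fin n)) (s * (2 * r)), ‖b (x, t)‖ₑ ^ q) ^ (l / q)
          ≤ ENNReal.ofReal (C₀ * (s * (2 * r)) ^ α) ^ l) →
      (∀ p ∈ lowerHalfSpace n, c * u p + d ∈ Icc (0 : ℝ) 1) →
      volume (Metric.ball (0 : EuclideanSpace ℝ (Fin n)) (r / 2)) / 2 ≤
        volume {p : SpaceTime n | ‖p.1‖ < r / 2 ∧ p.2 ∈ Ioo (-2 : ℝ) (-1) ∧
          1 / 2 ≤ c * u (dil n hs.ne' p) + d} →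
      ∀ p : SpaceTime n, ‖p.1‖ < s * (r / 16) → p.2 ∈ Ioo (-(s ^ 2 / 16)) 0 → κ ≤ c * u p + d := by
    intro s hs c d hds h01 hvol p hp1 hp2
    obtain ⟨z, rfl⟩ := (dil n hs.ne').surjective p
    have hs2 : 0 < s ^ 2 := by positivity
    rw [dil_apply] at hp1 hp2
    have hz1 : ‖z.1‖ < r / 16 := by
      rw [norm_smul, Real.norm_of_nonneg hs.le] at hp1
      exact lt_of_mul_lt_mul_left hp1 hs.le
    have hz2 : -1 / 16 < z.2 := by
      have := hp2.1
      refine lt_of_mul_lt_mul_left (a := s ^ 2) ?_ hs2.le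
      linarith
    have hz3 : z.2 < 0 := by
      by_contra h
      exact absurd hp2.2 (not_lt.2 (mul_nonneg hs2.le (not_lt.1 h)))
    obtain ⟨τ, hτ1, hτ2⟩ := exists_between hz3
    have hDb := driftBound_dil (R := s * (2 * r)) (by linarith) (by linarith) hα hC₀ hr (by positivity)
      hs rfl hds
    have hbm : AEStronglyMeasurable (fun p => s • b (dil n hs.ne' p))
        (volume.restrict (lowerHalfSpace n)) :=
      (hb.comp_quasiMeasurePreserving (quasiMeasurePreserving_dil hs.ne')).const_smul s
    obtain ⟨v, hv, hv01, hvu⟩ := exists_localSol (ha.comp_dil hs.ne').1 (ae_comp_dil hs.ne' hCa)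
      (hell.comp_dil hs.ne') (hdiv.comp_dil hs) hbm (hu.comp_dil hs c d) hq hl hDb
      (fun p hp => h01 _ ((dil_mem hs.ne').2 hp)) hτ2
    have hvz : v z = c * u (dil n hs.ne' z) + d := hvu z
      ⟨by rw [mem_ball_zero_iff]; linarith, by linarith, hτ1⟩
    rw [← hvz]
    refine hexp τ _ _ v (by linarith) hτ2.le hv hv01 (hDb.mono hτ2.le) (hvol.trans
      (measure_mono fun p hp => ⟨hp.1, hp.2.1, ?_⟩)) z hz1 ⟨hz2, hτ1⟩
    rw [hvu p ⟨by rw [mem_ball_zero_iff]; linarith [hp.1], by linarith [hp.2.1.1],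
      by linarith [hp.2.1.2]⟩]
    exact hp.2.2
  by_contra! hcon
  have h0Q : ((0, -1) : SpaceTime n) ∈ lowerHalfSpace n := ⟨mem_univ _, by simp⟩
  obtain ⟨p', hp'Q, hp'⟩ := hcon (u (0, -1))
  obtain ⟨M, hM⟩ := hbdd
  set S := u '' lowerHalfSpace n with hS
  have hSne : S.Nonempty := ⟨_, _, h0Q, rfl⟩
  have hSb : BddBelow S := ⟨-M, by rintro _ ⟨p, hp, rfl⟩; exact (abs_le.1 (hM p hp)).1⟩
  have hSa : BddAbove S := ⟨M, by rintro _ ⟨p, hp, rfl⟩; exact (abs_le.1 (hM p hp)).2⟩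
  have hlo : ∀ p ∈ lowerHalfSpace n, sInf S ≤ u p := fun p hp => csInf_le hSb ⟨p, hp, rfl⟩
  have hhi : ∀ p ∈ lowerHalfSpace n, u p ≤ sSup S := fun p hp => le_csSup hSa ⟨p, hp, rfl⟩
  have hosc : 0 < sSup S - sInf S := by
    rcases lt_or_gt_of_ne hp' with h | h
    · linarith [hlo _ hp'Q, hhi _ h0Q]
    · linarith [hlo _ h0Q, hhi _ hp'Q]
  -- The points `p₀`, `p₁` are fixed before the scale: in normalised units `u` is within `κ` of its
  -- infimum at `p₀` and of its supremum at `p₁`.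
  obtain ⟨_, ⟨p₀, hp₀, rfl⟩, hup₀⟩ := exists_lt_of_csInf_lt hSne
    (show sInf S < sInf S + κ * (sSup S - sInf S) by linarith [mul_pos hκ hosc])
  obtain ⟨_, ⟨p₁, hp₁, rfl⟩, hup₁⟩ := exists_lt_of_lt_csSup hSne
    (show sSup S - κ * (sSup S - sInf S) < sSup S by linarith [mul_pos hκ hosc])
  -- The first summand puts both points in the ball of radius `s * (r / 16)`. The second gives `s ≥
  -- 1 + 16 * (|p₀.2| + |p₁.2|)`, hence `s ^ 2 / 16` exceeds both times in absolute value.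
  obtain ⟨R, hR, hDR⟩ := hD (32 * (‖p₀.1‖ + ‖p₁.1‖ + 1) + 2 * r * (1 + 16 * (|p₀.2| + |p₁.2|)))
  obtain ⟨s, hs⟩ : ∃ s, s = R / (2 * r) := ⟨_, rfl⟩
  have hsR : R = s * (2 * r) := by rw [hs]; field_simp
  have hs1 : 1 + 16 * (|p₀.2| + |p₁.2|) ≤ s := by
    rw [hs, le_div_iff₀ (by positivity)]
    have : 0 ≤ 32 * (‖p₀.1‖ + ‖p₁.1‖ + 1) := by positivity
    linarith
  have habs := add_nonneg (abs_nonneg p₀.2) (abs_nonneg p₁.2)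
  have hs0 : 0 < s := by linarith
  have hss : s ≤ s ^ 2 := by nlinarith
  have hsr : ‖p₀.1‖ + ‖p₁.1‖ + 1 ≤ s * (r / 16) := by
    have : 0 ≤ 2 * r * (1 + 16 * (|p₀.2| + |p₁.2|)) := by positivity
    rw [hsR] at hR
    linarith
  rw [hsR] at hDR
  set c := (sSup S - sInf S)⁻¹ with hc
  have hc0 : 0 < c := inv_pos.2 hosc
  have hcm : c * (sSup S - sInf S) = 1 := inv_mul_cancel₀ hosc.ne'
  have h01 : ∀ p ∈ lowerHalfSpace n, c * u p + -(c * sInf S) ∈ Icc (0 : ℝ) 1 := fun p hp => by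
    have h1 := mul_le_mul_of_nonneg_left (hlo p hp) hc0.le
    have h2 := mul_le_mul_of_nonneg_left (hhi p hp) hc0.le
    constructor <;> linarith
  have h01' : ∀ p ∈ lowerHalfSpace n, -c * u p + (c * sInf S + 1) ∈ Icc (0 : ℝ) 1 := fun p hp => by
    have := h01 p hp
    constructor <;> linarith [this.1, this.2]
  have hp₀t : p₀.2 < 0 := hp₀.2
  have hp₁t : p₁.2 < 0 := hp₁.2
  -- At every point the normalised solution or its complement is at least 1/2, so one of the two
  -- sets fills half of the cylinder, whose volume is that of the ball because its time length is 1.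
  have hvol : volume (Metric.ball (0 : EuclideanSpace ℝ (Fin n)) (r / 2)) ≤
      volume {p : SpaceTime n | ‖p.1‖ < r / 2 ∧ p.2 ∈ Ioo (-2 : ℝ) (-1) ∧
          1 / 2 ≤ c * u (dil n hs0.ne' p) + -(c * sInf S)} +
      volume {p : SpaceTime n | ‖p.1‖ < r / 2 ∧ p.2 ∈ Ioo (-2 : ℝ) (-1) ∧
          1 / 2 ≤ -c * u (dil n hs0.ne' p) + (c * sInf S + 1)} := by
    refine le_trans ?_ (measure_union_le _ _)
    have e : volume (Metric.ball (0 : EuclideanSpace ℝ (Fin n)) (r / 2))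
        = volume (tcyl n (r / 2) (-2) (-1)) := by
      rw [tcyl, Measure.volume_eq_prod, Measure.prod_prod, Real.volume_Ioo]
      norm_num
    rw [e]
    refine measure_mono fun p hp => ?_
    have hp1 : ‖p.1‖ < r / 2 := by simpa using hp.1
    rcases le_total (1 / 2) (c * u (dil n hs0.ne' p) + -(c * sInf S)) with h | h
    · exact Or.inl ⟨hp1, hp.2, h⟩
    · exact Or.inr ⟨hp1, hp.2, by linarith⟩
  by_cases hcase : volume (Metric.ball (0 : EuclideanSpace ℝ (Fin n)) (r / 2)) / 2 ≤
      volume {p : SpaceTime n | ‖p.1‖ < r / 2 ∧ p.2 ∈ Ioo (-2 : ℝ) (-1) ∧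
          1 / 2 ≤ c * u (dil n hs0.ne' p) + -(c * sInf S)}
  · have := hone s hs0 _ _ hDR h01 hcase p₀ (by linarith [norm_nonneg p₁.1])
      ⟨by linarith [abs_nonneg p₁.2, neg_abs_le p₀.2], hp₀t⟩
    have h1 := mul_lt_mul_of_pos_left hup₀ hc0
    have h2 : c * (κ * (sSup S - sInf S)) = κ := by rw [mul_left_comm, hcm, mul_one]
    linarith
  · have hcase' : volume (Metric.ball (0 : EuclideanSpace ℝ (Fin n)) (r / 2)) / 2 ≤
        volume {p : SpaceTime n | ‖p.1‖ < r / 2 ∧ p.2 ∈ Ioo (-2 : ℝ) (-1) ∧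
          1 / 2 ≤ -c * u (dil n hs0.ne' p) + (c * sInf S + 1)} := by
      by_contra h
      have := ENNReal.add_lt_add (not_le.1 hcase) (not_le.1 h)
      rw [ENNReal.add_halves] at this
      exact absurd hvol (not_le.2 this)
    have := hone s hs0 _ _ hDR h01' hcase' p₁ (by linarith [norm_nonneg p₀.1])
      ⟨by linarith [abs_nonneg p₀.2, neg_abs_le p₁.2], hp₁t⟩
    have h1 := mul_lt_mul_of_pos_left hup₁ hc0
    have h2 : c * (κ * (sSup S - sInf S)) = κ := by rw [mul_left_comm, hcm, mul_one]
    linarith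

/-! ### Reduction to finite exponents. -/

theorem ofReal_le_of_inv_eq {q : ℝ≥0∞} (hq : 1 ≤ q) {q₁ e : ℝ} (hq₁ : 0 < q₁) (he : 0 ≤ e)
    (h : 1 / q₁ = (q⁻¹).toReal + e) : ENNReal.ofReal q₁ ≤ q := by
  have hfin : q⁻¹ ≠ ∞ := ENNReal.inv_ne_top.2 (zero_lt_one.trans_le hq).ne'
  rw [← ENNReal.inv_le_inv, ← ENNReal.ofReal_toReal hfin, ← ENNReal.ofReal_inv_of_pos hq₁,
    show q₁⁻¹ = (q⁻¹).toReal + e by rw [← h, one_div]]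
  exact ENNReal.ofReal_le_ofReal (by linarith)

/-- Lowering the exponents of a mixed norm on a product of sets of finite measure. -/
theorem lintegral_le_mixedNorm {q l : ℝ≥0∞} (hq : 1 ≤ q) (hl : 1 ≤ l) {q₁ l₁ e : ℝ} (hq₁ : 0 < q₁)
    (hl₁ : 0 < l₁) (he : 0 ≤ e) (hqe : 1 / q₁ = (q⁻¹).toReal + e) (hle : 1 / l₁ = (l⁻¹).toReal + e)
    {B : Set (EuclideanSpace ℝ (Fin n))} {I : Set ℝ} (hB : MeasurableSet B) (hI : MeasurableSet I)
    (hBf : volume B ≠ ∞) {b : SpaceTime n → EuclideanSpace ℝ (Fin n)}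
    (hb : AEStronglyMeasurable b (volume.restrict (B ×ˢ I))) :
    ∫⁻ t in I, (∫⁻ x in B, ‖b (x, t)‖ₑ ^ q₁) ^ (l₁ / q₁)
      ≤ (volume B ^ e * volume I ^ e * mixedNorm q l (B ×ˢ I) b) ^ l₁ := by
  rw [Measure.volume_eq_prod, ← Measure.prod_restrict] at hb
  set g : ℝ → ℝ≥0∞ := fun t => (∫⁻ x in B, ‖b (x, t)‖ₑ ^ q₁) ^ (1 / q₁) with hg
  have hgm : AEMeasurable g (volume.restrict I) :=
    (hb.enorm.pow_const q₁).lintegral_prod_left'.pow_const _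
  set H : ℝ → ℝ≥0∞ := fun t => eLpNorm (fun x => (B ×ˢ I).indicator b (x, t)) q volume with hH
  have hq₁e := ofReal_le_of_inv_eq hq hq₁ he hqe
  have hl₁e := ofReal_le_of_inv_eq hl hl₁ he hle
  have e1 : 1 / (ENNReal.ofReal q₁).toReal - 1 / q.toReal = e := by
    rw [ENNReal.toReal_ofReal hq₁.le, hqe, ENNReal.toReal_inv, one_div]; ring
  have e2 : 1 / (ENNReal.ofReal l₁).toReal - 1 / l.toReal = e := by
    rw [ENNReal.toReal_ofReal hl₁.le, hle, ENNReal.toReal_inv, one_div]; ring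
  -- Hölder on the slice costs `volume B ^ e`; the same increase of the reciprocal exponent in time
  -- will cost `volume I ^ e`. Working with reciprocals covers infinite exponents too.
  have hslice : ∀ᵐ t ∂(volume.restrict I), ‖g t‖ₑ ≤ ((volume B).toNNReal ^ e : ℝ≥0) * ‖H t‖ₑ := by
    filter_upwards [hb.prodMk_right, ae_restrict_mem hI] with t ht htI
    have h1 := eLpNorm_le_eLpNorm_mul_rpow_measure_univ hq₁e ht
    rw [e1, Measure.restrict_apply_univ, eLpNorm_eq_lintegral_rpow_enorm_toReal
      (by simpa using hq₁) ENNReal.ofReal_ne_top, ENNReal.toReal_ofReal hq₁.le] at h1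
    have h2 : H t = eLpNorm (fun x => b (x, t)) q (volume.restrict B) := by
      rw [← eLpNorm_indicator_eq_eLpNorm_restrict hB, hH]
      have h3 : (fun x => (B ×ˢ I).indicator b (x, t)) = B.indicator fun x => b (x, t) := by
        ext1 x
        have hiff : (x, t) ∈ B ×ˢ I ↔ x ∈ B := ⟨fun h => h.1, fun h => ⟨h, htI⟩⟩
        by_cases hxB : x ∈ B <;> simp [hiff, hxB, -mem_prod]
      simp only [h3]
    rw [enorm_eq_self, enorm_eq_self, h2, ENNReal.coe_rpow_of_nonneg _ he,
      ENNReal.coe_toNNReal hBf, mul_comm]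
    exact h1
  have h3 : eLpNorm g (ENNReal.ofReal l₁) (volume.restrict I)
      ≤ volume B ^ e * volume I ^ e * mixedNorm q l (B ×ˢ I) b := by
    refine (eLpNorm_le_eLpNorm_mul_rpow_measure_univ hl₁e hgm.aestronglyMeasurable).trans ?_
    rw [e2, Measure.restrict_apply_univ]
    have h4 := eLpNorm_le_nnreal_smul_eLpNorm_of_ae_le_mul' hslice l
    have h5 : eLpNorm H l (volume.restrict I) ≤ mixedNorm q l (B ×ˢ I) b := eLpNorm_restrict_le _ _ _ _
    rw [ENNReal.smul_def, smul_eq_mul, ENNReal.coe_rpow_of_nonneg _ he, ENNReal.coe_toNNReal hBf] at h4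
    calc _ ≤ volume B ^ e * mixedNorm q l (B ×ˢ I) b * volume I ^ e :=
          mul_le_mul_left (h4.trans (mul_le_mul_right h5 _)) _
      _ = _ := by ring
  rw [eLpNorm_eq_lintegral_rpow_enorm_toReal (by simpa using hl₁) ENNReal.ofReal_ne_top,
    ENNReal.toReal_ofReal hl₁.le] at h3
  have h6 := ENNReal.rpow_le_rpow h3 hl₁.le
  rw [← ENNReal.rpow_mul, one_div_mul_cancel hl₁.ne', ENNReal.rpow_one] at h6
  refine le_trans (le_of_eq (lintegral_congr fun t => ?_)) h6
  rw [enorm_eq_self, hg, ← ENNReal.rpow_mul]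
  congr 1
  ring

/-- The hypothesis on the scaled norms yields integral bounds with finite exponents along a
sequence of radii. -/
theorem exists_drift_bound {q l : ℝ≥0∞} (hn : 2 ≤ n) (hq : 1 ≤ q) (hl : 1 ≤ l)
    {b : SpaceTime n → EuclideanSpace ℝ (Fin n)}
    (hb : AEStronglyMeasurable b (volume.restrict (lowerHalfSpace n)))
    (hN : liminf (fun R : ℝ => scaledNorm q l b R 1 1 0 0) atTop < ∞) {q₁ l₁ e α₁ : ℝ}
    (hq₁ : 0 < q₁) (hl₁ : 0 < l₁) (he : 0 ≤ e) (hqe : 1 / q₁ = (q⁻¹).toReal + e)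
    (hle : 1 / l₁ = (l⁻¹).toReal + e) (hα₁ : α₁ = alphaExp n q l + (n + 2) * e) :
    ∃ C₀ : ℝ, 0 ≤ C₀ ∧ ∀ R₀ : ℝ, ∃ R, R₀ ≤ R ∧ ∫⁻ t in Ioo (-R ^ 2) 0,
      (∫⁻ x in Metric.ball (0 : EuclideanSpace ℝ (Fin n)) R, ‖b (x, t)‖ₑ ^ q₁) ^ (l₁ / q₁)
        ≤ ENNReal.ofReal (C₀ * R ^ α₁) ^ l₁ := by
  have hnt : Nontrivial (EuclideanSpace ℝ (Fin n)) := by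
    have : Nonempty (Fin n) := ⟨⟨0, by omega⟩⟩
    infer_instance
  obtain ⟨C, hC1, hC2⟩ := exists_between hN
  -- A finite lower limit gives bounds only along some arbitrarily large radii, which is all that
  -- the oscillation argument needs.
  have hfreq := frequently_lt_of_liminf_lt (by isBoundedDefault) hC1
  set w := (volume (Metric.ball (0 : EuclideanSpace ℝ (Fin n)) 1)).toReal with hw
  have hw0 : 0 ≤ w := ENNReal.toReal_nonneg
  have hwe : volume (Metric.ball (0 : EuclideanSpace ℝ (Fin n)) 1) = ENNReal.ofReal w :=
    (ENNReal.ofReal_toReal Metric.isBounded_ball.measure_lt_top.ne).symm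
  refine ⟨w ^ e * C.toReal, by positivity, fun R₀ => ?_⟩
  obtain ⟨R, hR, hRC⟩ := (frequently_atTop.1 hfreq) (max R₀ 1)
  have hR1 : 1 ≤ R := (le_max_right _ _).trans hR
  have hR0 : 0 < R := by linarith
  refine ⟨R, (le_max_left _ _).trans hR, ?_⟩
  have hcyl : parCylinder (n := n) R 1 1 0 0 = Metric.ball 0 R ×ˢ Ioo (-R ^ 2) 0 := by
    simp [parCylinder]
  have hmix : mixedNorm q l (Metric.ball 0 R ×ˢ Ioo (-R ^ 2) 0) b
      ≤ ENNReal.ofReal (C.toReal * R ^ alphaExp n q l) := by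
    rw [scaledNorm, hcyl, Real.rpow_neg hR0.le, ENNReal.ofReal_inv_of_pos (by positivity)] at hRC
    have h1 : ENNReal.ofReal (R ^ alphaExp n q l) ≠ 0 := by
      simpa using Real.rpow_pos_of_pos hR0 _
    have h2 := mul_le_mul_right hRC.le (ENNReal.ofReal (R ^ alphaExp n q l))
    rw [← mul_assoc, ENNReal.mul_inv_cancel h1 ENNReal.ofReal_ne_top, one_mul] at h2
    rw [mul_comm, ENNReal.ofReal_mul (by positivity), ENNReal.ofReal_toReal hC2.ne]
    exact h2
  have hbm : AEStronglyMeasurable b (volume.restrict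
      (Metric.ball (0 : EuclideanSpace ℝ (Fin n)) R ×ˢ Ioo (-R ^ 2) 0)) :=
    hb.mono_measure (Measure.restrict_mono (Set.prod_mono (subset_univ _) Ioo_subset_Iio_self) le_rfl)
  refine (lintegral_le_mixedNorm hq hl hq₁ hl₁ he hqe hle measurableSet_ball measurableSet_Ioo
    Metric.isBounded_ball.measure_lt_top.ne hbm).trans (ENNReal.rpow_le_rpow ?_ hl₁.le)
  calc _ ≤ volume (Metric.ball (0 : EuclideanSpace ℝ (Fin n)) R) ^ e * volume (Ioo (-R ^ 2) 0) ^ e *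
        ENNReal.ofReal (C.toReal * R ^ alphaExp n q l) := mul_le_mul_right hmix _
    -- The volumes of the ball and of the time interval contribute `R ^ (n * e)` and `R ^ (2 * e)`,
    -- whence the shift of `α` by `(n + 2) * e`.
    _ = ENNReal.ofReal ((R ^ n * w) ^ e * (R ^ 2) ^ e * (C.toReal * R ^ alphaExp n q l)) := by
      rw [Measure.addHaar_ball _ _ hR0.le, finrank_euclideanSpace_fin, hwe, Real.volume_Ioo,
        ← ENNReal.ofReal_mul (by positivity), ENNReal.ofReal_rpow_of_nonneg (by positivity) he,
        ENNReal.ofReal_rpow_of_nonneg (by nlinarith) he, ← ENNReal.ofReal_mul (by positivity),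
        ← ENNReal.ofReal_mul (mul_nonneg (by positivity) (Real.rpow_nonneg (by nlinarith) _))]
      congr 4
      ring
    _ = _ := by
      congr 1
      rw [hα₁, Real.mul_rpow (by positivity) hw0, Real.rpow_add hR0, add_mul, Real.rpow_add hR0,
        Real.rpow_mul hR0.le, Real.rpow_mul hR0.le, Real.rpow_natCast, Real.rpow_two]
      ring

end ParabolicLiouville

open ParabolicLiouville

theorem corollary3p7 (n : ℕ) (hn : 2 ≤ n) (ν : ℝ) (hν : 0 < ν)
    (a : SpaceTime n → Matrix (Fin n) (Fin n) ℝ)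
    (b : SpaceTime n → EuclideanSpace ℝ (Fin n))
    (ha : BoundedCoeff (lowerHalfSpace n) a)
    (hell : UniformlyElliptic ν (lowerHalfSpace n) a)
    (hdiv : DivNonpos (lowerHalfSpace n) b)
    (q l : ℝ≥0∞) (hq : 1 ≤ q) (hl : 1 ≤ l)
    (hα : alphaExp n q l ∈ Ico (0 : ℝ) 1)
    (hb : MemMixedLoc q l (lowerHalfSpace n) b)
    (hN : liminf (fun R : ℝ => scaledNorm q l b R 1 1 0 0) atTop < ∞)
    (u : SpaceTime n → ℝ)
    (hu : IsLipschitzSolution (lowerHalfSpace n) a b u)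
    (hbdd : ∃ M : ℝ, ∀ p ∈ lowerHalfSpace n, |u p| ≤ M) :
    ∃ c : ℝ, ∀ p ∈ lowerHalfSpace n, u p = c := by
  set α := alphaExp n q l with hαdef
  set x := (q⁻¹).toReal with hx
  set y := (l⁻¹).toReal with hy
  have hαe : α = n * x + 2 * y - 1 := rfl
  have hx0 : 0 ≤ x := ENNReal.toReal_nonneg
  have hy0 : 0 ≤ y := ENNReal.toReal_nonneg
  have hn2 : (2 : ℝ) ≤ n := by exact_mod_cast hn
  -- Half of the gap `1 - α` is spent, so the new exponent is `(1 + α) / 2 < 1`. Both reciprocal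
  -- exponents become positive and, since `n ≥ 2`, remain below 1, so the new exponents are finite
  -- and larger than 1.
  obtain ⟨e, he⟩ : ∃ e, e = (1 - α) / (2 * (n + 2)) := ⟨_, rfl⟩
  have he0 : 0 < e := by
    have : 0 < 1 - α := by linarith [hα.2]
    rw [he]; positivity
  have hne : (n + 2) * e = (1 - α) / 2 := by rw [he]; field_simp
  have hx1 : x + e < 1 := by nlinarith [hα.2]
  have hy1 : y + e < 1 := by nlinarith [hα.2]
  have hxe : 0 < x + e := by linarith
  have hye : 0 < y + e := by linarith
  obtain ⟨C₀, hC₀, hD⟩ := exists_drift_bound (q₁ := 1 / (x + e)) (l₁ := 1 / (y + e)) (e := e) hn hq hl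
    hb.1 hN (by positivity) (by positivity) he0.le (one_div_one_div _) (one_div_one_div _) rfl
  refine liouville_of_frequently hn hν ha hell hdiv hb.1 (by rwa [lt_div_iff₀ hxe, one_mul])
    (by rwa [lt_div_iff₀ hye, one_mul]) ?_ ?_ ?_ hC₀ hD hu hbdd
  · rw [← hαdef, div_div_eq_mul_div, div_div_eq_mul_div, div_one, div_one]
    linarith
  · rw [← hαdef, hne]; linarith [hα.1, hα.2]
  · rw [← hαdef, hne]; linarith [hα.2]
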